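/- Let $\mathbb{D}$ be the open unit disk in $\mathbb{C}$, and let $H \in A^2_1(\mathbb{D})$, i.e. $H$ is holomorphic in $\mathbb{D}$ and $\int_{\mathbb{D}} |H(z)|^2 (1-|z|)\, |dz|^2 < \infty$, where $|dz|^2$ is area measure. For a real-valued $h \in L^\infty(\partial\mathbb{D})$ consider the problem $$\Delta u = |H|^2 e^{2u} \ \text{ in } \mathbb{D}, \qquad u = h \ \text{ on } \partial\mathbb{D}. \tag{$*$}$$ A (weak) solution of $(*)$ is a function $u : \mathbb{D} \to \mathbb{R}$ such that 1. $u$ and $|H|^2 e^{2u}$ are locally integrable in $\mathbb{D}$, and for every $\phi \in C_c^\infty(\mathbb{D})$ $$\int_{\mathbb{D}} u\, \Delta\phi \, |dz|^2 = \int_{\mathbb{D}} |H|^2 e^{2u} \phi \, |dz|^2;$$ 2. for all $r<1$ sufficiently close to $1$ the function $\theta \mapsto u(re^{i\theta})$ is integrable on $(0,2\pi]$, and as $r \to 1^-$ the measures $u(re^{i\theta})\, d\theta$ converge weak-$*$ to $h\, d\theta$, i.e. $\int_0^{2\pi} \phi(e^{i\theta}) u(re^{i\theta})\, d\theta \to \int_0^{2\pi}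 \phi(e^{i\theta}) h(e^{i\theta})\, d\theta$ for every $\phi \in C(\partial\mathbb{D})$. Then for every $h \in L^\infty(\partial\mathbb{D})$ the problem $(*)$ has a solution, and it is unique up to equality almost everywhere in $\mathbb{D}$. Moreover, the solution is increasing in $h$: if $h_1, h_2 \in L^\infty(\partial\mathbb{D})$ satisfy $h_1 \le h_2$ almost everywhere on $\partial\mathbb{D}$, and $u_1, u_2$ are solutions with boundary values $h_1, h_2$ respectively, then $u_1 \le u_2$ almost everywhere in $\mathbb{D}$. -/

import Mathlib

open MeasureTheory Filter Topology
open scoped Real ContDiff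

/-- The open unit disk `𝔻`. -/
def unitDisk : Set ℂ := Metric.ball 0 1

/-- `H` (restricted to `𝔻`) belongs to the weighted Bergman space `A²₁(𝔻)`: it is holomorphic in
the unit disk and `∫_𝔻 |H(z)|² (1 - |z|) |dz|² < ∞`. -/
def IsWeightedBergman (H : ℂ → ℂ) : Prop :=
  DifferentiableOn ℂ H unitDisk ∧
    IntegrableOn (fun z : ℂ => ‖H z‖ ^ 2 * (1 - ‖z‖)) unitDisk

/-- The measure `dθ` on the interval `(0, 2π]`, which parametrizes the unit circle
through `θ ↦ e^{iθ}`. -/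
noncomputable def angleMeasure : Measure ℝ := volume.restrict (Set.Ioc 0 (2 * π))

/-- `h ∈ L^∞(∂𝔻)` (real-valued), the unit circle carrying arc length. -/
def IsBoundaryLInfty (h : Circle → ℝ) : Prop :=
  MemLp (fun θ : ℝ => h (Circle.exp θ)) ⊤ angleMeasure

/-- `Δu = |H|² e^{2u}` in `𝔻` in the weak sense: `u` and `|H|² e^{2u}` are locally integrable in
`𝔻`, and `∫_𝔻 u Δφ = ∫_𝔻 |H|² e^{2u} φ` for every `φ ∈ C_c^∞(𝔻)`. -/
def IsWeakGCESolution (H : ℂ → ℂ) (u : ℂ → ℝ) : Prop :=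
  LocallyIntegrableOn u unitDisk ∧
  LocallyIntegrableOn (fun z => ‖H z‖ ^ 2 * Real.exp (2 * u z)) unitDisk ∧
  ∀ φ : ℂ → ℝ, ContDiff ℝ ∞ φ → HasCompactSupport φ → tsupport φ ⊆ unitDisk →
    ∫ z in unitDisk, u z * Laplacian.laplacian φ z =
      ∫ z in unitDisk, ‖H z‖ ^ 2 * Real.exp (2 * u z) * φ z

/-- `u = h` on `∂𝔻`: for `r < 1` close to `1` the function `u` is integrable over `|z| = r`, and
the measures `u(re^{iθ}) dθ` converge weak-* to `h dθ` as `r → 1⁻`, i.e. when tested against every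
continuous function on the circle. -/
def HasWeakBoundaryValues (u : ℂ → ℝ) (h : Circle → ℝ) : Prop :=
  (∀ᶠ r : ℝ in 𝓝[<] 1, Integrable (fun θ : ℝ => u (circleMap 0 r θ)) angleMeasure) ∧
  ∀ φ : C(Circle, ℝ),
    Tendsto (fun r : ℝ => ∫ θ, φ (Circle.exp θ) * u (circleMap 0 r θ) ∂angleMeasure) (𝓝[<] 1)
      (𝓝 (∫ θ, φ (Circle.exp θ) * h (Circle.exp θ) ∂angleMeasure))

/-- `u` is a weak solution of the problem `Δu = |H|² e^{2u}` in `𝔻`, `u = h` on `∂𝔻`. -/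
def IsDirichletSolution (H : ℂ → ℂ) (h : Circle → ℝ) (u : ℂ → ℝ) : Prop :=
  IsWeakGCESolution H u ∧ HasWeakBoundaryValues u h

/-!
The problem is reduced to an integral equation. For a density `f` with `∫_𝔻 |f| (1 - |z|) < ∞` let
`G f` be its Green potential, so that `-Δ (G f) = f` weakly, and `G f` has boundary values `0` in
the sense that its `L¹` norms over the circles `|z| = r` tend to `0` as `r → 1`. Let `P h` be the
Poisson integral of `h`. Solutions satisfy `u = P h - G (|H|² e^{2u})` up to a null set, and a
function that satisfies this everywhere in `𝔻`, with `|H|² e^{2u}` integrable against `1 - |z|` and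
bounded on smaller disks, is a solution.

That solutions satisfy this equation is `ae_eq_poissonIntegral_sub_greenPotential`. First, the test
functions `X(|z|) Re(e^{ic} z^n)`, whose Laplacian can be prescribed radially, show that the
right-hand side `f = |H|² e^{2u}` is integrable against `1 - |z|`
(`weightedIntegrable_of_weakLaplacianEq`), because the circle means of `u` stay bounded. The
difference `u + G f - P h` is then weakly harmonic with boundary values `0`; the same test functions
show that its Fourier modes vanish on almost every circle (`ae_eq_zero_of_weakLaplacianEq_zero`).

Monotonicity in `h`, and with it uniqueness, follows from the comparison principle
`harmonic_le_greenPotential`: if `k ≤ 0` is harmonic and `F ≥ 0` on the set where `k > G F`, then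
that set is empty. It is applied to `k = P (h₁ - h₂)` and `F = |H|² (e^{2u₁} - e^{2u₂})`, for which
`k - G F = u₁ - u₂`. Since `G f ≥ 0`, solutions satisfy `u ≤ P h ≤ ‖h‖_∞`, so `f` is bounded by a
multiple of `|H|²` and `u` has a continuous representative.

For existence put `u = P h - v`, which turns the equation into `v = G (a e^{-2v})` with
`a = |H|² e^{2 P h} ≥ 0`. For bounded `a` it is solved by the method of continuity in a space of
bounded continuous functions (`exists_solution_truncExp`): the nonlinearity is decreasing, so the
comparison principle yields a stability estimate independent of the size of `a`, and each short step
is a contraction. In general `a` is cut off near the boundary; the solutions increase with `a` and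
stay below `G a`, and their limit is a solution (`exists_solution_of_weightedIntegrable`).
-/

namespace DiskDirichlet

/-! ### Polar coordinates -/

/-- The measure `r dr` on the half-line `(0, ∞)`. -/
noncomputable def radialMeasure : Measure ℝ :=
  (volume.restrict (Set.Ioi 0)).withDensity (fun r => ENNReal.ofReal r)

instance : IsFiniteMeasure angleMeasure := by
  unfold angleMeasure; infer_instance

instance : SFinite radialMeasure := by
  unfold radialMeasure; infer_instance

lemma lintegral_radialMeasure {f : ℝ → ENNReal} (hf : Measurable f) :
    ∫⁻ r, f r ∂radialMeasure = ∫⁻ r in Set.Ioi 0, ENNReal.ofReal r * f r := by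
  unfold radialMeasure
  rw [lintegral_withDensity_eq_lintegral_mul _ (by fun_prop) hf]
  rfl

lemma integral_radialMeasure (f : ℝ → ℝ) :
    ∫ r, f r ∂radialMeasure = ∫ r in Set.Ioi 0, r * f r := by
  unfold radialMeasure
  rw [integral_withDensity_eq_integral_toReal_smul (by fun_prop) (by simp)]
  refine setIntegral_congr_fun measurableSet_Ioi fun r hr => ?_
  simp [ENNReal.toReal_ofReal (le_of_lt hr)]

lemma ae_radialMeasure {p : ℝ → Prop} :
    (∀ᵐ r ∂radialMeasure, p r) ↔ ∀ᵐ r, 0 < r → p r := by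
  unfold radialMeasure
  rw [ae_withDensity_iff (by fun_prop), ae_restrict_iff' measurableSet_Ioi]
  refine eventually_congr (Eventually.of_forall fun r => ?_)
  simp only [Set.mem_Ioi, ne_eq, ENNReal.ofReal_eq_zero, not_le]
  tauto

@[fun_prop] lemma continuous_polar : Continuous (fun p : ℝ × ℝ => circleMap 0 p.1 p.2) := by
  unfold circleMap; fun_prop

/-- Translation by `π` turns Mathlib's range `(-π, π)` of the polar angle into `(0, 2π]`. -/
lemma lintegral_angle_neg (f : ℂ → ENNReal) (r : ℝ) :
    ∫⁻ θ in Set.Ioo (-π) π, f (-(circleMap 0 r θ)) = ∫⁻ θ, f (circleMap 0 r θ) ∂angleMeasure := by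
  have h := (measurePreserving_add_right (volume : Measure ℝ) π).setLIntegral_comp_preimage_emb
    (measurableEmbedding_addRight π) (fun θ => f (circleMap 0 r θ)) (Set.Ioc 0 (2 * π))
  unfold angleMeasure
  rw [← h, setLIntegral_congr Ioo_ae_eq_Ioc]
  have : (fun x : ℝ => x + π) ⁻¹' Set.Ioc 0 (2 * π) = Set.Ioc (-π) π := by
    ext x; simp only [Set.mem_preimage, Set.mem_Ioc]
    constructor <;> rintro ⟨h1, h2⟩ <;> constructor <;> linarith
  rw [this]
  refine lintegral_congr fun θ => ?_
  congr 1
  simp [circleMap, add_mul, Complex.exp_add, Complex.exp_pi_mul_I]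

/-- Integration in polar coordinates, with the angle running over `(0, 2π]`. -/
lemma measurePreserving_polar :
    MeasurePreserving (fun p : ℝ × ℝ => circleMap 0 p.1 p.2)
      (radialMeasure.prod angleMeasure) volume := by
  refine ⟨continuous_polar.measurable, Measure.ext_of_lintegral _ fun f hf => ?_⟩
  rw [lintegral_map hf continuous_polar.measurable,
    lintegral_prod (fun p : ℝ × ℝ => f (circleMap 0 p.1 p.2))
      (hf.comp continuous_polar.measurable).aemeasurable,
    lintegral_radialMeasure (Measurable.lintegral_prod_right' (ν := angleMeasure)
      (f := fun p : ℝ × ℝ => f (circleMap 0 p.1 p.2)) (hf.comp continuous_polar.measurable))]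
  have h1 := lintegral_neg_eq_self f (μ := (volume : Measure ℂ))
  rw [← h1, ← Complex.lintegral_comp_polarCoord_symm, polarCoord_target,
    Measure.volume_eq_prod, ← Measure.prod_restrict, lintegral_prod]
  · refine setLIntegral_congr_fun measurableSet_Ioi fun r _ => ?_
    simp only [Complex.polarCoord_symm_apply, smul_eq_mul]
    rw [lintegral_const_mul', ← lintegral_angle_neg]
    · congr 1
      refine lintegral_congr fun θ => ?_
      rw [circleMap, Complex.exp_mul_I]; simp
    · simp
  · refine Measurable.aemeasurable ?_
    simp only [Complex.polarCoord_symm_apply, smul_eq_mul]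
    fun_prop

@[simp] lemma angleMeasure_univ : angleMeasure Set.univ = ENNReal.ofReal (2 * π) := by
  simp [angleMeasure]

@[simp] lemma angleMeasure_real_univ : angleMeasure.real Set.univ = 2 * π := by
  simp [Measure.real, Real.pi_pos.le]

lemma lintegral_polar {f : ℂ → ENNReal} (hf : AEMeasurable f) :
    ∫⁻ z, f z = ∫⁻ r, ∫⁻ θ, f (circleMap 0 r θ) ∂angleMeasure ∂radialMeasure := by
  rw [← measurePreserving_polar.map_eq] at hf
  rw [← lintegral_prod (fun p : ℝ × ℝ => f (circleMap 0 p.1 p.2))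
    (hf.comp_measurable continuous_polar.measurable), ← measurePreserving_polar.map_eq]
  exact lintegral_map' hf continuous_polar.aemeasurable

lemma integrable_polar {f : ℂ → ℝ} (hf : Integrable f) :
    Integrable (fun p : ℝ × ℝ => f (circleMap 0 p.1 p.2)) (radialMeasure.prod angleMeasure) :=
  measurePreserving_polar.integrable_comp_of_integrable hf

lemma integral_polar {f : ℂ → ℝ} (hf : Integrable f) :
    ∫ z, f z = ∫ r in Set.Ioi 0, r * ∫ θ, f (circleMap 0 r θ) ∂angleMeasure := by
  rw [← integral_radialMeasure, ← integral_prod _ (integrable_polar hf),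
    ← measurePreserving_polar.map_eq]
  refine integral_map continuous_polar.aemeasurable ?_
  rw [measurePreserving_polar.map_eq]; exact hf.1

lemma measurableSet_unitDisk : MeasurableSet unitDisk := Metric.isOpen_ball.measurableSet

lemma isOpen_unitDisk : IsOpen unitDisk := Metric.isOpen_ball

@[simp] lemma mem_unitDisk {z : ℂ} : z ∈ unitDisk ↔ ‖z‖ < 1 := by simp [unitDisk]

lemma circleMap_zero_eq (r θ : ℝ) : circleMap 0 r θ = r * circleMap 0 1 θ := by
  simp [circleMap]

@[simp] lemma circleExp_coe (θ : ℝ) : (Circle.exp θ : ℂ) = circleMap 0 1 θ := by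
  simp [circleMap]

/-! ### The singularity `1 / |z - ζ|` -/

lemma lintegral_ball_inv_norm_sub (ζ : ℂ) (δ : ℝ) :
    ∫⁻ z in Metric.ball ζ δ, ENNReal.ofReal ‖z - ζ‖⁻¹ ≤ ENNReal.ofReal (2 * π * δ) := by
  have e : ∫⁻ z in Metric.ball ζ δ, ENNReal.ofReal ‖z - ζ‖⁻¹
      = ∫⁻ z in Metric.ball (0 : ℂ) δ, ENNReal.ofReal ‖z‖⁻¹ := by
    have h := (measurePreserving_sub_right (volume : Measure ℂ) ζ).setLIntegral_comp_preimage_emb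
      (measurableEmbedding_subRight ζ) (fun z => ENNReal.ofReal ‖z‖⁻¹) (Metric.ball 0 δ)
    rw [← h]
    congr 2
    ext x; simp [dist_eq_norm]
  rw [e, ← lintegral_indicator Metric.isOpen_ball.measurableSet, lintegral_polar
    (Measurable.aemeasurable ((by fun_prop : Measurable fun z : ℂ => ENNReal.ofReal ‖z‖⁻¹).indicator
      Metric.isOpen_ball.measurableSet))]
  calc _ ≤ ∫⁻ r, (Set.Ioo 0 δ).indicator
        (fun r => ENNReal.ofReal (2 * π) * ENNReal.ofReal r⁻¹) r ∂radialMeasure := by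
        refine lintegral_mono_ae (ae_radialMeasure.2 (Eventually.of_forall fun r hr => ?_))
        by_cases h : r < δ
        · simp [Set.indicator, abs_of_pos hr, h, hr, mul_comm]
        · simp [Set.indicator, abs_of_pos hr, h]
    _ = ∫⁻ r in Set.Ioo 0 δ, ENNReal.ofReal (2 * π) := by
        rw [lintegral_radialMeasure (Measurable.indicator (by fun_prop) measurableSet_Ioo),
          ← lintegral_indicator measurableSet_Ioi, ← lintegral_indicator measurableSet_Ioo]
        refine lintegral_congr fun r => ?_
        by_cases hr : 0 < r
        · by_cases h : r < δ
          · simp only [Set.mem_Ioi, hr, Set.indicator_of_mem, Set.mem_Ioo, h, and_self]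
            rw [mul_left_comm, ← ENNReal.ofReal_mul hr.le, mul_inv_cancel₀ hr.ne']; simp
          · simp [Set.indicator, hr, h]
        · simp [Set.indicator, hr]
    _ ≤ _ := by
        simp [ENNReal.ofReal_mul, Real.pi_pos.le]

lemma integrableOn_ball_inv_norm_sub (ζ : ℂ) (δ : ℝ) :
    IntegrableOn (fun z : ℂ => ‖z - ζ‖⁻¹) (Metric.ball ζ δ) := by
  refine ⟨by fun_prop, ?_⟩
  rw [hasFiniteIntegral_iff_ofReal (Eventually.of_forall fun z => by positivity)]
  exact (lintegral_ball_inv_norm_sub ζ δ).trans_lt ENNReal.ofReal_lt_top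

lemma abs_log_le_inv_add {x : ℝ} (hx : 0 ≤ x) : |Real.log x| ≤ x⁻¹ + x := by
  rcases hx.eq_or_lt with rfl | hx
  · simp
  · have h1 := Real.log_le_sub_one_of_pos hx
    have h2 := Real.log_le_sub_one_of_pos (inv_pos.2 hx)
    rw [Real.log_inv] at h2
    have := inv_pos.2 hx
    rw [abs_le]; constructor <;> linarith

lemma locallyIntegrable_log_norm_sub (ζ : ℂ) :
    LocallyIntegrable (fun z : ℂ => Real.log ‖z - ζ‖) := by
  intro z
  refine ⟨Metric.ball ζ (‖z - ζ‖ + 1), Metric.isOpen_ball.mem_nhds (by simp [dist_eq_norm]), ?_⟩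
  have h2 : IntegrableOn (fun z : ℂ => ‖z - ζ‖) (Metric.ball ζ (‖z - ζ‖ + 1)) :=
    ((by fun_prop : Continuous fun z : ℂ => ‖z - ζ‖).locallyIntegrable.integrableOn_isCompact
      (isCompact_closedBall ζ (‖z - ζ‖ + 1))).mono_set Metric.ball_subset_closedBall
  refine ((integrableOn_ball_inv_norm_sub ζ _).add h2).mono'
    (by fun_prop : Measurable fun z : ℂ => Real.log ‖z - ζ‖).aestronglyMeasurable ?_
  exact Eventually.of_forall fun z => abs_log_le_inv_add (norm_nonneg _)

/-! ### The Laplacian in polar coordinates -/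

section PolarLaplacian

variable {φ : ℂ → ℝ}

/-- The Laplacian as the trace of the second derivative in a rotated orthonormal frame. -/
lemma laplacian_eq_rotated (φ : ℂ → ℝ) (z : ℂ) {e : ℂ} (he : ‖e‖ = 1) :
    Laplacian.laplacian φ z =
      fderiv ℝ (fderiv ℝ φ) z e e + fderiv ℝ (fderiv ℝ φ) z (e * Complex.I) (e * Complex.I) := by
  rw [InnerProductSpace.laplacian_eq_iteratedFDeriv_complexPlane]
  simp only [iteratedFDeriv_two_apply, Matrix.cons_val_zero, Matrix.cons_val_one]
  have h1 : e = e.re • (1 : ℂ) + e.im • Complex.I := by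
    simp
  have h2 : e * Complex.I = (-e.im) • (1 : ℂ) + e.re • Complex.I := by
    simp [Complex.ext_iff]
  have h3 : e.re ^ 2 + e.im ^ 2 = 1 := by
    have := Complex.sq_norm e
    rw [he, Complex.normSq_apply] at this; linarith
  rw [h2]
  conv_rhs => rw [h1]
  simp only [map_add, map_smul, add_apply, smul_apply,
    smul_eq_mul]
  simp only [Complex.add_re, Complex.add_im, Complex.smul_re, Complex.smul_im, Complex.one_re,
    Complex.one_im, Complex.I_re, Complex.I_im, smul_eq_mul]
  linear_combination (-(fderiv ℝ (fderiv ℝ φ) z 1 1)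
    - (fderiv ℝ (fderiv ℝ φ) z Complex.I Complex.I)) * h3

lemma hasDerivAt_radial (θ r : ℝ) :
    HasDerivAt (fun r : ℝ => circleMap 0 r θ) (circleMap 0 1 θ) r := by
  have h : (fun r : ℝ => circleMap 0 r θ) = fun r : ℝ => (r : ℂ) * circleMap 0 1 θ :=
    funext fun r => circleMap_zero_eq r θ
  rw [h]
  simpa using (Complex.ofRealCLM.hasDerivAt (x := r)).mul_const (circleMap 0 1 θ)

lemma hasDerivAt_comp_radial (h : ContDiff ℝ 2 φ) (θ r : ℝ) :
    HasDerivAt (fun r : ℝ => φ (circleMap 0 r θ))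
      (fderiv ℝ φ (circleMap 0 r θ) (circleMap 0 1 θ)) r :=
  ((h.differentiable (by norm_num)).differentiableAt.hasFDerivAt).comp_hasDerivAt r
    (hasDerivAt_radial θ r)

lemma hasDerivAt_fderiv_radial (h : ContDiff ℝ 2 φ) (θ r : ℝ) :
    HasDerivAt (fun r : ℝ => fderiv ℝ φ (circleMap 0 r θ) (circleMap 0 1 θ))
      (fderiv ℝ (fderiv ℝ φ) (circleMap 0 r θ) (circleMap 0 1 θ) (circleMap 0 1 θ)) r := by
  have h1 : Differentiable ℝ (fderiv ℝ φ) :=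
    (h.fderiv_right (m := 1) (by norm_num)).differentiable (by norm_num)
  have h2 := (h1.differentiableAt.hasFDerivAt.comp_hasDerivAt r
    (hasDerivAt_radial θ r)).clm_apply (hasDerivAt_const r (circleMap 0 1 θ))
  simpa using h2

lemma hasDerivAt_comp_angular (h : ContDiff ℝ 2 φ) (r θ : ℝ) :
    HasDerivAt (fun θ : ℝ => φ (circleMap 0 r θ))
      (fderiv ℝ φ (circleMap 0 r θ) (circleMap 0 r θ * Complex.I)) θ :=
  ((h.differentiable (by norm_num)).differentiableAt.hasFDerivAt).comp_hasDerivAt θ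
    (hasDerivAt_circleMap 0 r θ)

lemma hasDerivAt_fderiv_angular (h : ContDiff ℝ 2 φ) (r θ : ℝ) :
    HasDerivAt (fun θ : ℝ => fderiv ℝ φ (circleMap 0 r θ) (circleMap 0 r θ * Complex.I))
      (fderiv ℝ (fderiv ℝ φ) (circleMap 0 r θ) (circleMap 0 r θ * Complex.I)
        (circleMap 0 r θ * Complex.I) - fderiv ℝ φ (circleMap 0 r θ) (circleMap 0 r θ)) θ := by
  have h1 : Differentiable ℝ (fderiv ℝ φ) :=
    (h.fderiv_right (m := 1) (by norm_num)).differentiable (by norm_num)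
  have h2 := (h1.differentiableAt.hasFDerivAt.comp_hasDerivAt θ
    (hasDerivAt_circleMap 0 r θ)).clm_apply ((hasDerivAt_circleMap 0 r θ).mul_const Complex.I)
  rw [mul_assoc _ Complex.I, Complex.I_mul_I, mul_neg_one, map_neg, ← sub_eq_add_neg] at h2
  exact h2

/-- `r Δφ = ∂_r (r ∂_r φ) + r⁻¹ ∂_θ² φ`. -/
lemma mul_laplacian_polar (φ : ℂ → ℝ) {r : ℝ} (hr : 0 < r) (θ : ℝ) :
    r * Laplacian.laplacian φ (circleMap 0 r θ) =
      (fderiv ℝ φ (circleMap 0 r θ) (circleMap 0 1 θ) + r *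
        fderiv ℝ (fderiv ℝ φ) (circleMap 0 r θ) (circleMap 0 1 θ) (circleMap 0 1 θ)) +
      r⁻¹ * (fderiv ℝ (fderiv ℝ φ) (circleMap 0 r θ) (circleMap 0 r θ * Complex.I)
        (circleMap 0 r θ * Complex.I) - fderiv ℝ φ (circleMap 0 r θ) (circleMap 0 r θ)) := by
  rw [laplacian_eq_rotated φ _ (e := circleMap 0 1 θ) (by simp)]
  have h1 : circleMap 0 r θ * Complex.I = r • (circleMap 0 1 θ * Complex.I) := by
    rw [circleMap_zero_eq]; simp [mul_assoc]
  have h2 : (fderiv ℝ φ (circleMap 0 r θ)) (circleMap 0 r θ)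
      = r * fderiv ℝ φ (circleMap 0 r θ) (circleMap 0 1 θ) := by
    conv_lhs => arg 2; rw [circleMap_zero_eq, ← Complex.real_smul]
    rw [map_smul, smul_eq_mul]
  rw [h1, h2]
  simp only [map_smul, smul_apply, smul_eq_mul]
  field_simp
  ring

end PolarLaplacian

/-! ### The fundamental solution and Green's identity -/

section TestFunctions

variable {φ : ℂ → ℝ}

lemma continuous_laplacian (h : ContDiff ℝ 2 φ) : Continuous (Laplacian.laplacian φ) := by
  have h2 : Continuous (fderiv ℝ (fderiv ℝ φ)) :=
    (h.fderiv_right (m := 1) (by norm_num)).continuous_fderiv (by norm_num)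
  have : Laplacian.laplacian φ = fun z => fderiv ℝ (fderiv ℝ φ) z 1 1 +
      fderiv ℝ (fderiv ℝ φ) z (1 * Complex.I) (1 * Complex.I) :=
    funext fun z => laplacian_eq_rotated φ z (by simp)
  rw [this]; fun_prop

lemma laplacian_eq_zero_of_notMem_tsupport {z : ℂ} (hz : z ∉ tsupport φ) :
    Laplacian.laplacian φ z = 0 := by
  have h : φ =ᶠ[𝓝 z] fun _ => (0 : ℝ) := notMem_tsupport_iff_eventuallyEq.1 hz
  rw [(InnerProductSpace.laplacian_congr_nhds h).self_of_nhds]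
  simp

lemma tsupport_laplacian_subset : tsupport (Laplacian.laplacian φ) ⊆ tsupport φ :=
  closure_minimal (fun _ hz => not_not.1 fun h => hz (laplacian_eq_zero_of_notMem_tsupport h))
    (isClosed_tsupport φ)

lemma hasCompactSupport_laplacian (h : HasCompactSupport φ) :
    HasCompactSupport (Laplacian.laplacian φ) :=
  h.of_isClosed_subset (isClosed_tsupport _) tsupport_laplacian_subset

lemma integrable_log_mul_laplacian (h : ContDiff ℝ 2 φ) (hc : HasCompactSupport φ) (ζ : ℂ) :
    Integrable (fun z => Real.log ‖z - ζ‖ * Laplacian.laplacian φ z) := by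
  have := (locallyIntegrable_log_norm_sub ζ).integrable_smul_left_of_hasCompactSupport
    (continuous_laplacian h) (hasCompactSupport_laplacian hc)
  simpa [mul_comm] using this

/-- Along every ray, `∫₀^∞ log r · ∂_r (r ∂_r φ) dr = φ 0`. -/
lemma integral_log_radial (h : ContDiff ℝ 2 φ) {R : ℝ}
    (hc : tsupport φ ⊆ Metric.ball 0 R) (θ : ℝ)
    (hint : IntegrableOn (fun r : ℝ => Real.log r *
        (fderiv ℝ φ (circleMap 0 r θ) (circleMap 0 1 θ) + r *
        fderiv ℝ (fderiv ℝ φ) (circleMap 0 r θ) (circleMap 0 1 θ) (circleMap 0 1 θ)))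
        (Set.Ioi 0)) :
    ∫ r in Set.Ioi 0, Real.log r * (fderiv ℝ φ (circleMap 0 r θ) (circleMap 0 1 θ) + r *
        fderiv ℝ (fderiv ℝ φ) (circleMap 0 r θ) (circleMap 0 1 θ) (circleMap 0 1 θ)) = φ 0 := by
  have hd : Continuous (fderiv ℝ φ) := h.continuous_fderiv (by norm_num)
  have hcm : Continuous (fun r : ℝ => circleMap 0 r θ) := by unfold circleMap; fun_prop
  have key := integral_Ioi_of_hasDerivAt_of_tendsto
    (f := fun r : ℝ => r * Real.log r * fderiv ℝ φ (circleMap 0 r θ) (circleMap 0 1 θ)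
      - φ (circleMap 0 r θ)) (a := 0) (m := 0) (f' := fun r : ℝ => Real.log r *
        (fderiv ℝ φ (circleMap 0 r θ) (circleMap 0 1 θ) + r *
        fderiv ℝ (fderiv ℝ φ) (circleMap 0 r θ) (circleMap 0 1 θ) (circleMap 0 1 θ))) ?_ ?_ hint ?_
  · rw [key]; simp [circleMap]
  · refine Continuous.continuousWithinAt ?_
    exact (Real.continuous_mul_log.mul ((hd.comp hcm).clm_apply continuous_const)).sub
      (h.continuous.comp hcm)
  · intro r hr
    have hr : 0 < r := hr
    have h1 := ((Real.hasDerivAt_mul_log hr.ne').mul (hasDerivAt_fderiv_radial h θ r)).sub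
      (hasDerivAt_comp_radial h θ r)
    exact h1.congr_deriv (by ring)
  · refine tendsto_const_nhds.congr' ?_
    filter_upwards [eventually_gt_atTop R] with r hr
    have hz : circleMap 0 r θ ∉ tsupport φ := fun hz => by
      have := hc hz
      simp only [mem_ball_zero_iff, norm_circleMap_zero] at this
      linarith [le_abs_self r]
    rw [image_eq_zero_of_notMem_tsupport hz, show fderiv ℝ φ (circleMap 0 r θ) = 0 from
      image_eq_zero_of_notMem_tsupport fun hz' => hz (tsupport_fderiv_subset ℝ hz')]
    simp

/-- In polar coordinates the angular part of the Laplacian drops out and the radial part contributes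
`φ 0` along every ray. -/
lemma integral_log_norm_mul_laplacian_zero (h : ContDiff ℝ 2 φ) (hc : HasCompactSupport φ) :
    ∫ z, Real.log ‖z‖ * Laplacian.laplacian φ z = 2 * π * φ 0 := by
  obtain ⟨R, hR0, hR⟩ : ∃ R > 0, tsupport φ ⊆ Metric.ball 0 R := by
    obtain ⟨R, hR⟩ := hc.isBounded.subset_ball (0 : ℂ)
    exact ⟨max R 1, by positivity, hR.trans (Metric.ball_subset_ball (le_max_left _ _))⟩
  have hd1 : Continuous (fderiv ℝ φ) := h.continuous_fderiv (by norm_num)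
  have hd2 : Continuous (fderiv ℝ (fderiv ℝ φ)) :=
    (h.fderiv_right (m := 1) (by norm_num)).continuous_fderiv (by norm_num)
  have hi : Integrable (fun z => Real.log ‖z‖ * Laplacian.laplacian φ z) := by
    simpa using integrable_log_mul_laplacian h hc 0
  set q : ℝ → ℝ → ℝ := fun r θ => fderiv ℝ φ (circleMap 0 r θ) (circleMap 0 1 θ) + r *
        fderiv ℝ (fderiv ℝ φ) (circleMap 0 r θ) (circleMap 0 1 θ) (circleMap 0 1 θ) with hq
  have hqc : Continuous (fun p : ℝ × ℝ => q p.1 p.2) := by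
    have : Continuous (fun p : ℝ × ℝ => circleMap 0 1 p.2) := by unfold circleMap; fun_prop
    simp only [hq]
    have h1 := hd1.comp continuous_polar
    have h2 := hd2.comp continuous_polar
    exact (h1.clm_apply this).add (continuous_fst.mul ((h2.clm_apply this).clm_apply this))
  have hqz : ∀ r θ, R ≤ r → q r θ = 0 := fun r θ hr => by
    have hz : circleMap 0 r θ ∉ tsupport φ := fun hz => by
      have := hR hz
      simp only [mem_ball_zero_iff, norm_circleMap_zero] at this
      linarith [le_abs_self r]
    have hz1 : circleMap 0 r θ ∉ tsupport (fderiv ℝ φ) := fun hz' =>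
      hz (tsupport_fderiv_subset ℝ hz')
    simp only [hq]
    rw [image_eq_zero_of_notMem_tsupport hz1, show fderiv ℝ (fderiv ℝ φ) (circleMap 0 r θ) = 0 from
      image_eq_zero_of_notMem_tsupport fun hz' => hz1 (tsupport_fderiv_subset ℝ hz')]
    simp
  -- `log r * q r θ` is integrable on the half-strip
  have hint : Integrable (fun p : ℝ × ℝ => Real.log p.1 * q p.1 p.2)
      ((volume.restrict (Set.Ioi 0)).prod angleMeasure) := by
    have e : (volume.restrict (Set.Ioi (0 : ℝ))).prod angleMeasure
        = (volume.prod volume).restrict (Set.Ioi 0 ×ˢ Set.Ioc 0 (2 * π)) := by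
      rw [angleMeasure, Measure.prod_restrict]
    have hlog : IntegrableOn (fun p : ℝ × ℝ => Real.log p.1)
        (Set.Ioc 0 R ×ˢ Set.Ioc 0 (2 * π)) (volume.prod volume) := by
      have h1 : IntegrableOn Real.log (Set.Ioc 0 R) :=
        (intervalIntegrable_iff_integrableOn_Ioc_of_le hR0.le).1
          (intervalIntegral.intervalIntegrable_log')
      have := h1.comp_fst angleMeasure
      rwa [angleMeasure, Measure.prod_restrict] at this
    obtain ⟨C, hC⟩ := ((isCompact_Icc (a := (0:ℝ)) (b := R)).prod
      (isCompact_Icc (a := (0:ℝ)) (b := 2 * π))).exists_bound_of_continuousOn hqc.continuousOn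
    rw [e]
    have h2 : IntegrableOn (fun p : ℝ × ℝ => Real.log p.1 * q p.1 p.2)
        (Set.Ioc 0 R ×ˢ Set.Ioc 0 (2 * π)) (volume.prod volume) := by
      refine hlog.mul_bdd (c := C) hqc.aestronglyMeasurable ?_
      refine (ae_restrict_iff' (measurableSet_Ioc.prod measurableSet_Ioc)).2
        (Eventually.of_forall fun p hp => hC p ?_)
      exact ⟨Set.Ioc_subset_Icc_self hp.1, Set.Ioc_subset_Icc_self hp.2⟩
    refine h2.of_forall_sdiff_eq_zero (measurableSet_Ioi.prod measurableSet_Ioc) fun p hp => ?_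
    rw [hqz, mul_zero]
    by_contra hlt
    exact hp.2 ⟨⟨hp.1.1, (not_le.1 hlt).le⟩, hp.1.2⟩
  have hi' := hint.swap
  rw [integral_polar hi]
  calc _ = ∫ r in Set.Ioi 0, ∫ θ, Real.log r * q r θ ∂angleMeasure := by
        refine setIntegral_congr_fun measurableSet_Ioi fun r hr => ?_
        have hr : 0 < r := hr
        have hcm : Continuous (circleMap 0 r) := continuous_circleMap 0 r
        -- the angular part integrates to zero by periodicity
        have hang : ∫ θ, (fderiv ℝ (fderiv ℝ φ) (circleMap 0 r θ) (circleMap 0 r θ * Complex.I)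
            (circleMap 0 r θ * Complex.I) - fderiv ℝ φ (circleMap 0 r θ) (circleMap 0 r θ))
            ∂angleMeasure = 0 := by
          rw [angleMeasure, ← intervalIntegral.integral_of_le (by positivity),
            intervalIntegral.integral_eq_sub_of_hasDerivAt
              (fun θ _ => hasDerivAt_fderiv_angular h r θ)]
          · simp [circleMap]
          · refine Continuous.intervalIntegrable ?_ _ _
            fun_prop
        have hc1 : ∀ {f : ℝ → ℝ}, Continuous f → Integrable f angleMeasure := fun hf => by
          rw [angleMeasure, ← IntegrableOn, ← intervalIntegrable_iff_integrableOn_Ioc_of_le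
            (by positivity)]
          exact hf.intervalIntegrable _ _
        simp only [norm_circleMap_zero, abs_of_pos hr]
        rw [integral_const_mul, integral_const_mul, mul_left_comm, ← integral_const_mul]
        simp_rw [mul_laplacian_polar φ hr]
        rw [integral_add (hc1 ?_) (hc1 ?_), integral_const_mul, hang]
        · simp [hq]
        · exact hqc.comp (Continuous.prodMk_right r)
        · fun_prop
    _ = ∫ θ, (∫ r in Set.Ioi 0, Real.log r * q r θ) ∂angleMeasure :=
        integral_integral_swap hint
    _ = ∫ θ, φ 0 ∂angleMeasure := by
        refine integral_congr_ae ?_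
        filter_upwards [hi'.prod_right_ae] with θ hθ
        exact integral_log_radial h hR θ hθ
    _ = _ := by simp

/-- The logarithm is the fundamental solution of the Laplacian in the plane. -/
lemma integral_log_norm_sub_mul_laplacian (h : ContDiff ℝ 2 φ) (hc : HasCompactSupport φ) (ζ : ℂ) :
    ∫ z, Real.log ‖z - ζ‖ * Laplacian.laplacian φ z = 2 * π * φ ζ := by
  have h1 : ContDiff ℝ 2 (fun z => φ (z + ζ)) := h.comp (contDiff_id.add contDiff_const)
  have hc1 : HasCompactSupport (fun z => φ (z + ζ)) := hc.comp_homeomorph (Homeomorph.addRight ζ)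
  have h2 : ∀ z, Laplacian.laplacian (fun z => φ (z + ζ)) z = Laplacian.laplacian φ (z + ζ) := by
    intro z
    rw [laplacian_eq_rotated _ z (e := 1) (by simp),
      laplacian_eq_rotated _ (z + ζ) (e := 1) (by simp)]
    have : fderiv ℝ (fun z => φ (z + ζ)) = fun z => fderiv ℝ φ (z + ζ) :=
      funext fun z => fderiv_comp_add_right ζ
    rw [this, fderiv_comp_add_right ζ]
  have h3 := integral_log_norm_mul_laplacian_zero h1 hc1
  rw [zero_add] at h3
  rw [← h3, ← integral_add_right_eq_self _ ζ]
  simp [h2]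

lemma exists_closedBall_of_tsupport_subset (hc : HasCompactSupport φ) (hs : tsupport φ ⊆ unitDisk) :
    ∃ ρ, 0 < ρ ∧ ρ < 1 ∧ tsupport φ ⊆ Metric.closedBall 0 ρ := by
  rcases (tsupport φ).eq_empty_or_nonempty with he | hne
  · exact ⟨1 / 2, by norm_num, by norm_num, by simp [he]⟩
  · obtain ⟨z, hz, hmax⟩ := hc.isCompact.exists_isMaxOn hne continuous_norm.continuousOn
    have hz1 : ‖z‖ < 1 := mem_unitDisk.1 (hs hz)
    refine ⟨max ‖z‖ (1 / 2), by positivity, by simp [hz1]; norm_num, fun w hw => ?_⟩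
    have : ‖w‖ ≤ ‖z‖ := hmax hw
    simp [this]

/-- Harmonic functions in the disk are weakly harmonic. -/
lemma integral_harmonic_mul_laplacian {k : ℂ → ℝ}
    (hk : InnerProductSpace.HarmonicOnNhd k unitDisk)
    (h : ContDiff ℝ ∞ φ) (hc : HasCompactSupport φ) (hs : tsupport φ ⊆ unitDisk) :
    ∫ z in unitDisk, k z * Laplacian.laplacian φ z = 0 := by
  obtain ⟨ρ, hρ0, hρ1, hρ⟩ := exists_closedBall_of_tsupport_subset hc hs
  -- extend `k` by a cutoff that is `1` near the support of `φ`
  let χ : ContDiffBump (0 : ℂ) :=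
    { rIn := (1 + ρ) / 2, rOut := (3 + ρ) / 4, rIn_pos := by linarith, rIn_lt_rOut := by linarith }
  have hχs : tsupport χ = Metric.closedBall 0 ((3 + ρ) / 4) := χ.tsupport_eq
  have hχd : tsupport χ ⊆ unitDisk := by
    rw [hχs]; exact Metric.closedBall_subset_ball (by linarith)
  have hK : ContDiff ℝ ∞ (fun z => χ z * k z) := by
    rw [contDiff_iff_contDiffAt]
    intro z
    by_cases hz : z ∈ unitDisk
    · exact χ.contDiffAt.mul ((HarmonicAt.analyticAt (hk z hz)).contDiffAt)
    · have : (fun z => χ z * k z) =ᶠ[𝓝 z] fun _ => 0 := by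
        have h0 : χ =ᶠ[𝓝 z] 0 := notMem_tsupport_iff_eventuallyEq.1 fun hz' => hz (hχd hz')
        filter_upwards [h0] with w hw
        simp [hw]
      exact contDiffAt_const.congr_of_eventuallyEq this
  have hKc : HasCompactSupport (fun z => χ z * k z) := χ.hasCompactSupport.mul_right
  have hG := SchwartzMap.integral_mul_laplacian_right_eq_left (hKc.toSchwartzMap hK)
    (hc.toSchwartzMap h) (μ := (volume : Measure ℂ))
  simp only [SchwartzMap.laplacian_apply] at hG
  have e1 : ((hKc.toSchwartzMap hK : SchwartzMap ℂ ℝ) : ℂ → ℝ) = fun z => χ z * k z := rfl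
  have e2 : ((hc.toSchwartzMap h : SchwartzMap ℂ ℝ) : ℂ → ℝ) = φ := rfl
  rw [e1, e2] at hG
  have hone : ∀ z ∈ tsupport φ, χ =ᶠ[𝓝 z] 1 := fun z hz =>
    χ.eventuallyEq_one_of_mem_ball (by
      have := hρ hz
      simp only [mem_closedBall_zero_iff] at this
      simp only [mem_ball_zero_iff]
      show ‖z‖ < (1 + ρ) / 2
      linarith)
  calc _ = ∫ z, k z * Laplacian.laplacian φ z := by
        refine setIntegral_eq_integral_of_forall_compl_eq_zero fun z hz => ?_
        rw [laplacian_eq_zero_of_notMem_tsupport fun hz' => hz (hs hz'), mul_zero]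
    _ = ∫ z, χ z * k z * Laplacian.laplacian φ z := by
        refine integral_congr_ae (Eventually.of_forall fun z => ?_)
        by_cases hz : z ∈ tsupport φ
        · simp [(hone z hz).self_of_nhds]
        · simp [laplacian_eq_zero_of_notMem_tsupport hz]
    _ = _ := hG
    _ = 0 := by
        rw [← integral_zero ℂ ℝ (μ := volume)]
        refine integral_congr_ae (Eventually.of_forall fun z => ?_)
        by_cases hz : z ∈ tsupport φ
        · have e : (fun z => χ z * k z) =ᶠ[𝓝 z] k := by
            filter_upwards [hone z hz] with w hw
            simp [hw]
          have h0 : Laplacian.laplacian k z = 0 := (hk z (hs hz)).2.self_of_nhds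
          simp only
          rw [(InnerProductSpace.laplacian_congr_nhds e).self_of_nhds, h0, zero_mul]
        · simp [image_eq_zero_of_notMem_tsupport hz]

end TestFunctions

/-! ### The Green kernel of the disk -/

/-- The Green kernel of the unit disk, without the factor `(2π)⁻¹`. For distinct `z, ζ ∈ 𝔻` it is
`log |1 - ζ̄ z| - log |z - ζ|` (see `greenKernel_eq_log`); written in this form it is nonnegative on
all of `ℂ × ℂ` and vanishes as soon as one of the points is outside the disk. -/
noncomputable def greenKernel (z ζ : ℂ) : ℝ :=
  (1 / 2) * Real.log (1 + max 0 (1 - ‖z‖ ^ 2) * max 0 (1 - ‖ζ‖ ^ 2) / ‖z - ζ‖ ^ 2)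

lemma greenKernel_nonneg (z ζ : ℂ) : 0 ≤ greenKernel z ζ := by
  unfold greenKernel
  refine mul_nonneg (by norm_num) (Real.log_nonneg ?_)
  have : 0 ≤ max 0 (1 - ‖z‖ ^ 2) * max 0 (1 - ‖ζ‖ ^ 2) / ‖z - ζ‖ ^ 2 := by positivity
  linarith

lemma greenKernel_eq_zero {z : ℂ} (hz : 1 ≤ ‖z‖) (ζ : ℂ) : greenKernel z ζ = 0 := by
  unfold greenKernel
  rw [max_eq_left (by nlinarith)]; simp

lemma measurable_greenKernel : Measurable (fun p : ℂ × ℂ => greenKernel p.1 p.2) := by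
  unfold greenKernel; fun_prop

lemma measurable_greenKernel_right (z : ℂ) : Measurable (fun ζ => greenKernel z ζ) := by
  unfold greenKernel; fun_prop

lemma measurable_greenKernel_left (ζ : ℂ) : Measurable (fun z => greenKernel z ζ) := by
  unfold greenKernel; fun_prop

lemma sq_norm_one_sub_conj_mul (z ζ : ℂ) :
    ‖1 - starRingEnd ℂ ζ * z‖ ^ 2 = ‖z - ζ‖ ^ 2 + (1 - ‖z‖ ^ 2) * (1 - ‖ζ‖ ^ 2) := by
  simp only [Complex.sq_norm, Complex.normSq_apply]
  simp
  ring

lemma one_sub_conj_mul_ne_zero {z ζ : ℂ} (hz : ‖z‖ < 1) (hζ : ‖ζ‖ < 1) :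
    1 - starRingEnd ℂ ζ * z ≠ 0 := by
  intro h
  have h1 : ‖starRingEnd ℂ ζ * z‖ = 1 := by rw [← sub_eq_zero.1 h]; simp
  rw [norm_mul, RCLike.norm_conj] at h1
  nlinarith [norm_nonneg z, norm_nonneg ζ]

lemma greenKernel_eq_log {z ζ : ℂ} (hz : ‖z‖ < 1) (hζ : ‖ζ‖ < 1) (h : z ≠ ζ) :
    greenKernel z ζ = Real.log ‖1 - starRingEnd ℂ ζ * z‖ - Real.log ‖z - ζ‖ := by
  have h1 : 0 < ‖z - ζ‖ := norm_pos_iff.2 (sub_ne_zero.2 h)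
  have h2 : 0 < ‖1 - starRingEnd ℂ ζ * z‖ := norm_pos_iff.2 (one_sub_conj_mul_ne_zero hz hζ)
  have e : 1 + (1 - ‖z‖ ^ 2) * (1 - ‖ζ‖ ^ 2) / ‖z - ζ‖ ^ 2
      = (‖1 - starRingEnd ℂ ζ * z‖ / ‖z - ζ‖) ^ 2 := by
    rw [div_pow, sq_norm_one_sub_conj_mul]; field_simp
  unfold greenKernel
  rw [max_eq_right (by nlinarith [norm_nonneg z]), max_eq_right (by nlinarith [norm_nonneg ζ]), e,
    Real.log_pow, Real.log_div h2.ne' h1.ne']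
  push_cast; ring

/-- A singularity of order one instead of a logarithmic one, with a factor that vanishes at the
boundary; it comes from `log (1 + x) ≤ 2 √x`. -/
lemma greenKernel_le_sqrt (z ζ : ℂ) :
    greenKernel z ζ ≤ √(max 0 (1 - ‖z‖ ^ 2)) * ‖z - ζ‖⁻¹ := by
  set A := max 0 (1 - ‖z‖ ^ 2) with hA
  set B := max 0 (1 - ‖ζ‖ ^ 2) with hB
  have hA0 : 0 ≤ A := le_max_left _ _
  have hB0 : 0 ≤ B := le_max_left _ _
  have hB1 : B ≤ 1 := max_le zero_le_one (by nlinarith [norm_nonneg ζ])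
  set y := √A * ‖z - ζ‖⁻¹ with hy
  have hy0 : 0 ≤ y := by positivity
  have hle : A * B / ‖z - ζ‖ ^ 2 ≤ y ^ 2 := by
    rw [hy, mul_pow, Real.sq_sqrt hA0, inv_pow, div_eq_mul_inv]
    have : A * B ≤ A := mul_le_of_le_one_right hA0 hB1
    gcongr
  have h0 : 0 ≤ A * B / ‖z - ζ‖ ^ 2 := by positivity
  unfold greenKernel
  calc _ ≤ (1 / 2) * Real.log ((1 + y) ^ 2) := by
        gcongr
        nlinarith
    _ = Real.log (1 + y) := by rw [Real.log_pow]; push_cast; ring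
    _ ≤ y := by linarith [Real.log_le_sub_one_of_pos (show 0 < 1 + y by linarith)]

lemma greenKernel_le_inv (z ζ : ℂ) : greenKernel z ζ ≤ ‖z - ζ‖⁻¹ := by
  refine (greenKernel_le_sqrt z ζ).trans (mul_le_of_le_one_left (by positivity) ?_)
  rw [Real.sqrt_le_one]
  exact max_le zero_le_one (by nlinarith [norm_nonneg z])

/-- Away from the diagonal the kernel decays linearly at the boundary. -/
lemma greenKernel_le_of_dist {z ζ : ℂ} {d : ℝ} (hd : 0 < d) (h : d ≤ ‖z - ζ‖) (hζ : ‖ζ‖ < 1) :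
    greenKernel z ζ ≤ (d ^ 2)⁻¹ * (1 - ‖ζ‖) := by
  have hA0 : 0 ≤ max 0 (1 - ‖z‖ ^ 2) := le_max_left _ _
  have hA1 : max 0 (1 - ‖z‖ ^ 2) ≤ 1 := max_le zero_le_one (by nlinarith [norm_nonneg z])
  have hB : max 0 (1 - ‖ζ‖ ^ 2) ≤ 2 * (1 - ‖ζ‖) :=
    max_le (by linarith) (by nlinarith [norm_nonneg ζ])
  have hB0 : 0 ≤ max 0 (1 - ‖ζ‖ ^ 2) := le_max_left _ _
  set A := max 0 (1 - ‖z‖ ^ 2)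
  set B := max 0 (1 - ‖ζ‖ ^ 2)
  have h0 : 0 ≤ A * B / ‖z - ζ‖ ^ 2 := by positivity
  have h1 : A * B / ‖z - ζ‖ ^ 2 ≤ 2 * (1 - ‖ζ‖) / d ^ 2 := by
    have : A * B ≤ 2 * (1 - ‖ζ‖) := by nlinarith
    gcongr
  have h2 := Real.log_le_sub_one_of_pos (show 0 < 1 + A * B / ‖z - ζ‖ ^ 2 by linarith)
  have h3 : greenKernel z ζ = (1 / 2) * Real.log (1 + A * B / ‖z - ζ‖ ^ 2) := rfl
  rw [h3]
  calc _ ≤ (1 / 2) * (2 * (1 - ‖ζ‖) / d ^ 2) := by linarith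
    _ = _ := by ring

lemma continuousAt_greenKernel {z ζ : ℂ} (h : z ≠ ζ) :
    ContinuousAt (fun z => greenKernel z ζ) z := by
  unfold greenKernel
  refine continuousAt_const.mul (ContinuousAt.log ?_ ?_)
  · refine continuousAt_const.add (ContinuousAt.div (by fun_prop) (by fun_prop) ?_)
    exact pow_ne_zero _ (norm_ne_zero_iff.2 (sub_ne_zero.2 h))
  · have : 0 ≤ max 0 (1 - ‖z‖ ^ 2) * max 0 (1 - ‖ζ‖ ^ 2) / ‖z - ζ‖ ^ 2 := by positivity
    linarith

/-! ### Circle means of the Green kernel -/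

lemma harmonicAt_log_norm_one_sub {ζ z : ℂ} (hζ : ‖ζ‖ < 1) (hz : ‖z‖ < 1) :
    InnerProductSpace.HarmonicAt (fun z => Real.log ‖1 - starRingEnd ℂ ζ * z‖) z :=
  AnalyticAt.harmonicAt_log_norm (by fun_prop) (one_sub_conj_mul_ne_zero hz hζ)

lemma greenKernel_eventuallyEq_codiscreteWithin {ζ z₀ : ℂ} {ρ : ℝ} (hζ : ‖ζ‖ < 1)
    (hb : Metric.closedBall z₀ |ρ| ⊆ unitDisk) :
    (fun z => Real.log ‖1 - starRingEnd ℂ ζ * z‖ - Real.log ‖z - ζ‖)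
      =ᶠ[codiscreteWithin (Metric.sphere z₀ |ρ|)] (fun z => greenKernel z ζ) := by
  have h1 : {ζ}ᶜ ∈ codiscreteWithin (Metric.sphere z₀ |ρ|) := by
    rw [codiscreteWithin_iff_locallyFiniteComplementWithin]
    intro z hz
    exact ⟨Set.univ, univ_mem, (Set.finite_singleton ζ).subset (by
      intro w hw; simpa using hw.2.2)⟩
  filter_upwards [h1, self_mem_codiscreteWithin _] with z hz hz'
  exact (greenKernel_eq_log (mem_unitDisk.1 (hb (Metric.sphere_subset_closedBall hz'))) hζ hz).symm

lemma circleIntegrable_greenKernel {ζ z₀ : ℂ} {ρ : ℝ} (hζ : ‖ζ‖ < 1)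
    (hb : Metric.closedBall z₀ |ρ| ⊆ unitDisk) :
    CircleIntegrable (fun z => greenKernel z ζ) z₀ ρ := by
  refine CircleIntegrable.congr_codiscreteWithin
    (greenKernel_eventuallyEq_codiscreteWithin hζ hb) (CircleIntegrable.sub ?_ ?_)
  · refine ContinuousOn.circleIntegrable' fun z hz => ContinuousAt.continuousWithinAt ?_
    exact (harmonicAt_log_norm_one_sub hζ
      (mem_unitDisk.1 (hb (Metric.sphere_subset_closedBall hz)))).1.continuousAt
  · exact circleIntegrable_log_norm_sub_const ρ

/-- The first logarithm is harmonic, and the circle means of the second one are known (Jensen). -/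
lemma circleAverage_greenKernel {ζ z₀ : ℂ} {ρ : ℝ} (hρ : ρ ≠ 0) (hζ : ‖ζ‖ < 1)
    (hb : Metric.closedBall z₀ |ρ| ⊆ unitDisk) :
    Real.circleAverage (fun z => greenKernel z ζ) z₀ ρ =
      Real.log ‖1 - starRingEnd ℂ ζ * z₀‖ - (Real.log ρ + Real.posLog (ρ⁻¹ * ‖z₀ - ζ‖)) := by
  have hh : InnerProductSpace.HarmonicOnNhd (fun z => Real.log ‖1 - starRingEnd ℂ ζ * z‖)
      (Metric.closedBall z₀ |ρ|) := fun z hz =>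
    harmonicAt_log_norm_one_sub hζ (mem_unitDisk.1 (hb hz))
  rw [← Real.circleAverage_congr_codiscreteWithin
    (greenKernel_eventuallyEq_codiscreteWithin hζ hb) hρ, Real.circleAverage_fun_sub,
    hh.circleAverage_eq, circleAverage_log_norm_sub_const_eq_log_radius_add_posLog hρ]
  · exact (hh.continuousOn.mono Metric.sphere_subset_closedBall).circleIntegrable'
  · exact circleIntegrable_log_norm_sub_const ρ

/-- The kernel is superharmonic. -/
lemma circleAverage_greenKernel_le {ζ z₀ : ℂ} {ρ : ℝ} (hρ : 0 < ρ) (hζ : ‖ζ‖ < 1)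
    (hb : Metric.closedBall z₀ ρ ⊆ unitDisk) (hne : ζ ≠ z₀) :
    Real.circleAverage (fun z => greenKernel z ζ) z₀ ρ ≤ greenKernel z₀ ζ := by
  have hz₀ : ‖z₀‖ < 1 := mem_unitDisk.1 (hb (Metric.mem_closedBall_self hρ.le))
  rw [circleAverage_greenKernel hρ.ne' hζ (by rwa [abs_of_pos hρ]),
    greenKernel_eq_log hz₀ hζ hne.symm]
  have h1 : 0 < ‖z₀ - ζ‖ := norm_pos_iff.2 (sub_ne_zero.2 hne.symm)
  have h2 : Real.log (ρ⁻¹ * ‖z₀ - ζ‖) ≤ Real.posLog (ρ⁻¹ * ‖z₀ - ζ‖) := le_max_right _ _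
  rw [Real.log_mul (by positivity) h1.ne', Real.log_inv] at h2
  linarith

/-- The kernel is harmonic away from its pole. -/
lemma circleAverage_greenKernel_eq {ζ z₀ : ℂ} {ρ : ℝ} (hρ : 0 < ρ) (hζ : ‖ζ‖ < 1)
    (hb : Metric.closedBall z₀ ρ ⊆ unitDisk) (h : ρ ≤ ‖z₀ - ζ‖) :
    Real.circleAverage (fun z => greenKernel z ζ) z₀ ρ = greenKernel z₀ ζ := by
  have hz₀ : ‖z₀‖ < 1 := mem_unitDisk.1 (hb (Metric.mem_closedBall_self hρ.le))
  have h1 : 0 < ‖z₀ - ζ‖ := hρ.trans_le h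
  rw [circleAverage_greenKernel hρ.ne' hζ (by rwa [abs_of_pos hρ]),
    greenKernel_eq_log hz₀ hζ (sub_ne_zero.1 (norm_pos_iff.1 h1)), Real.posLog_eq_log,
    Real.log_mul (by positivity) h1.ne', Real.log_inv]
  · ring
  · rw [abs_of_pos (by positivity), le_inv_mul_iff₀ hρ]; simpa using h

lemma circleAverage_eq_angle (f : ℂ → ℝ) (c : ℂ) (r : ℝ) :
    Real.circleAverage f c r = (2 * π)⁻¹ * ∫ θ, f (circleMap c r θ) ∂angleMeasure := by
  rw [Real.circleAverage_def, intervalIntegral.integral_of_le (by positivity), smul_eq_mul]; rfl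

lemma circleIntegrable_iff_angle {f : ℂ → ℝ} {c : ℂ} {r : ℝ} :
    CircleIntegrable f c r ↔ Integrable (fun θ => f (circleMap c r θ)) angleMeasure := by
  rw [CircleIntegrable, intervalIntegrable_iff_integrableOn_Ioc_of_le (by positivity)]; rfl

/-- The mean of `g(·, ζ)` over the circle `|z| = r` is `-log (max r |ζ|)`. -/
lemma lintegral_greenKernel_circle {ζ : ℂ} {r : ℝ} (hr : 0 < r) (hr1 : r < 1) (hζ : ‖ζ‖ < 1) :
    ∫⁻ θ, ENNReal.ofReal (greenKernel (circleMap 0 r θ) ζ) ∂angleMeasure =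
      ENNReal.ofReal (2 * π * (-Real.log (max r ‖ζ‖))) := by
  have hb : Metric.closedBall (0 : ℂ) |r| ⊆ unitDisk := by
    rw [abs_of_pos hr]; exact Metric.closedBall_subset_ball hr1
  rw [← ofReal_integral_eq_lintegral_ofReal
    (circleIntegrable_iff_angle.1 (circleIntegrable_greenKernel hζ hb))
    (Eventually.of_forall fun θ => greenKernel_nonneg _ _)]
  congr 1
  have h := circleAverage_greenKernel hr.ne' hζ hb
  rw [circleAverage_eq_angle] at h
  have e : Real.log r + Real.posLog (r⁻¹ * ‖(0 : ℂ) - ζ‖) = Real.log (max r ‖ζ‖) := by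
    rw [zero_sub, norm_neg]
    rcases le_total r ‖ζ‖ with h | h
    · rw [max_eq_right h, Real.posLog_eq_log, Real.log_mul (by positivity) (hr.trans_le h).ne',
        Real.log_inv]
      · ring
      · rw [abs_of_nonneg (by positivity), le_inv_mul_iff₀ hr]; simpa using h
    · rw [max_eq_left h, Real.posLog_eq_zero_iff _ |>.2, add_zero]
      rw [abs_of_nonneg (by positivity), inv_mul_le_iff₀ hr]; simpa using h
  rw [e] at h
  simp only [mul_zero, sub_zero, norm_one, Real.log_one, zero_sub] at h
  rw [← h]
  field_simp

-- from here on only the estimates and mean values above are used, never the formula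
attribute [irreducible] greenKernel

/-! ### Green potentials -/

/-- `∫_𝔻 |f(ζ)| (1 - |ζ|) |dζ|² < ∞`, the natural condition for the Green potential of `f`. -/
def WeightedIntegrable (f : ℂ → ℝ) : Prop :=
  IntegrableOn (fun ζ => f ζ * (1 - ‖ζ‖)) unitDisk

/-- `f` is bounded on every disk `|z| ≤ ρ` with `ρ < 1`. -/
def BoundedOnSmallerDisks (f : ℂ → ℝ) : Prop :=
  ∀ ρ < 1, ∃ C, ∀ z, ‖z‖ ≤ ρ → |f z| ≤ C

/-- The Green potential `G f (z) = (2π)⁻¹ ∫_𝔻 g(z, ζ) f(ζ) |dζ|²`, which solves `-Δ(G f) = f`. -/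
noncomputable def greenPotential (f : ℂ → ℝ) (z : ℂ) : ℝ :=
  (2 * π)⁻¹ * ∫ ζ in unitDisk, greenKernel z ζ * f ζ

lemma WeightedIntegrable.aestronglyMeasurable {f : ℂ → ℝ} (hf : WeightedIntegrable f) :
    AEStronglyMeasurable f (volume.restrict unitDisk) := by
  have h : AEStronglyMeasurable (fun ζ => f ζ * (1 - ‖ζ‖) * (1 - ‖ζ‖)⁻¹)
      (volume.restrict unitDisk) :=
    hf.1.mul (by fun_prop : Measurable fun ζ : ℂ => (1 - ‖ζ‖)⁻¹).aestronglyMeasurable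
  refine h.congr ((ae_restrict_iff' measurableSet_unitDisk).2 (Eventually.of_forall fun z hz => ?_))
  have : 1 - ‖z‖ ≠ 0 := by have := mem_unitDisk.1 hz; linarith
  simp only
  field_simp

lemma WeightedIntegrable.mono {f g : ℂ → ℝ} (hf : WeightedIntegrable f)
    (hg : AEStronglyMeasurable g (volume.restrict unitDisk)) (h : ∀ z ∈ unitDisk, |g z| ≤ |f z|) :
    WeightedIntegrable g := by
  refine Integrable.mono hf
    (hg.mul (by fun_prop : Continuous fun ζ : ℂ => 1 - ‖ζ‖).aestronglyMeasurable)
    ((ae_restrict_iff' measurableSet_unitDisk).2 (Eventually.of_forall fun z hz => ?_))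
  rw [norm_mul, norm_mul]
  exact mul_le_mul_of_nonneg_right (h z hz) (norm_nonneg _)

lemma WeightedIntegrable.congr {f g : ℂ → ℝ} (hf : WeightedIntegrable f)
    (h : f =ᵐ[volume.restrict unitDisk] g) : WeightedIntegrable g := by
  refine Integrable.congr hf ?_
  filter_upwards [h] with z hz
  rw [hz]

lemma WeightedIntegrable.sub {f g : ℂ → ℝ} (hf : WeightedIntegrable f)
    (hg : WeightedIntegrable g) : WeightedIntegrable (fun z => f z - g z) := by
  unfold WeightedIntegrable
  simp_rw [sub_mul]
  exact Integrable.sub hf hg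

instance : IsFiniteMeasure (volume.restrict unitDisk) := by
  constructor
  rw [Measure.restrict_apply_univ]
  exact measure_ball_lt_top

lemma weightedIntegrable_of_bounded {f : ℂ → ℝ} {C : ℝ}
    (hf : AEStronglyMeasurable f (volume.restrict unitDisk)) (h : ∀ z ∈ unitDisk, |f z| ≤ C) :
    WeightedIntegrable f := by
  refine Integrable.of_bound (C := C)
    (hf.mul (by fun_prop : Continuous fun ζ : ℂ => 1 - ‖ζ‖).aestronglyMeasurable)
    ((ae_restrict_iff' measurableSet_unitDisk).2 (Eventually.of_forall fun z hz => ?_))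
  have := mem_unitDisk.1 hz
  have h0 := h z hz
  have h1 : |1 - ‖z‖| ≤ 1 := by rw [abs_le]; constructor <;> linarith [norm_nonneg z]
  rw [norm_mul, Real.norm_eq_abs, Real.norm_eq_abs]
  nlinarith [abs_nonneg (f z), abs_nonneg (1 - ‖z‖)]

lemma unitDisk_subset_ball {ζ : ℂ} (hζ : ‖ζ‖ < 1) : unitDisk ⊆ Metric.ball ζ 2 := by
  intro z hz
  have := mem_unitDisk.1 hz
  rw [Metric.mem_ball, dist_eq_norm]
  linarith [norm_sub_le z ζ]

lemma integrableOn_unitDisk_inv_norm_sub {z : ℂ} (hz : ‖z‖ < 1) :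
    IntegrableOn (fun ζ : ℂ => ‖z - ζ‖⁻¹) unitDisk := by
  have := (integrableOn_ball_inv_norm_sub z 2).mono_set (unitDisk_subset_ball hz)
  simpa [norm_sub_rev] using this

lemma integral_inv_norm_sub_le {z : ℂ} {s : Set ℂ} {δ : ℝ} (hδ : 0 ≤ δ) (hs : s ⊆ Metric.ball z δ) :
    ∫ ζ in s, ‖z - ζ‖⁻¹ ≤ 2 * π * δ := by
  rw [integral_eq_lintegral_of_nonneg_ae (Eventually.of_forall fun _ => by positivity)
    (by fun_prop : Measurable fun ζ : ℂ => ‖z - ζ‖⁻¹).aestronglyMeasurable]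
  refine ENNReal.toReal_le_of_le_ofReal (by positivity) ?_
  refine le_trans ?_ (lintegral_ball_inv_norm_sub z δ)
  simp_rw [norm_sub_rev z]
  exact lintegral_mono_set hs

lemma integrable_greenKernel_mul_of_bounded {f : ℂ → ℝ} {C : ℝ}
    (hf : AEStronglyMeasurable f (volume.restrict unitDisk)) (h : ∀ z ∈ unitDisk, |f z| ≤ C)
    (z : ℂ) : IntegrableOn (fun ζ => greenKernel z ζ * f ζ) unitDisk := by
  by_cases hz : ‖z‖ < 1
  · refine Integrable.mul_bdd (c := C) ?_ hf
      ((ae_restrict_iff' measurableSet_unitDisk).2 (Eventually.of_forall h))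
    refine (integrableOn_unitDisk_inv_norm_sub hz).mono'
      (measurable_greenKernel_right z).aestronglyMeasurable (Eventually.of_forall fun ζ => ?_)
    rw [Real.norm_of_nonneg (greenKernel_nonneg _ _)]
    exact greenKernel_le_inv z ζ
  · simp [greenKernel_eq_zero (not_lt.1 hz)]

/-- The potential of a bounded density vanishes at the boundary. -/
lemma abs_greenPotential_le {f : ℂ → ℝ} {C : ℝ} (hC : 0 ≤ C)
    (h : ∀ z ∈ unitDisk, |f z| ≤ C) (z : ℂ) :
    |greenPotential f z| ≤ 2 * C * √(max 0 (1 - ‖z‖ ^ 2)) := by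
  by_cases hz : ‖z‖ < 1
  · have h1 : ‖∫ ζ in unitDisk, greenKernel z ζ * f ζ‖
        ≤ ∫ ζ in unitDisk, C * √(max 0 (1 - ‖z‖ ^ 2)) * ‖z - ζ‖⁻¹ := by
      refine norm_integral_le_of_norm_le ((integrableOn_unitDisk_inv_norm_sub hz).const_mul _)
        ((ae_restrict_iff' measurableSet_unitDisk).2 (Eventually.of_forall fun ζ hζ => ?_))
      rw [norm_mul, Real.norm_of_nonneg (greenKernel_nonneg _ _), Real.norm_eq_abs, mul_assoc,
        mul_comm]
      exact mul_le_mul (h ζ hζ) (greenKernel_le_sqrt z ζ) (greenKernel_nonneg _ _) hC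
    have h2 := integral_inv_norm_sub_le (by norm_num : (0:ℝ) ≤ 2) (unitDisk_subset_ball hz)
    rw [integral_const_mul] at h1
    unfold greenPotential
    rw [abs_mul, abs_of_pos (by positivity), inv_mul_le_iff₀ (by positivity)]
    refine h1.trans ?_
    calc _ ≤ C * √(max 0 (1 - ‖z‖ ^ 2)) * (2 * π * 2) := by gcongr
      _ = _ := by ring
  · simp only [greenPotential, greenKernel_eq_zero (not_lt.1 hz), zero_mul, integral_zero, mul_zero,
      abs_zero]
    positivity

lemma greenPotential_nonneg {f : ℂ → ℝ} (h : ∀ z ∈ unitDisk, 0 ≤ f z) (z : ℂ) :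
    0 ≤ greenPotential f z :=
  mul_nonneg (by positivity) (setIntegral_nonneg measurableSet_unitDisk fun ζ hζ =>
    mul_nonneg (greenKernel_nonneg _ _) (h ζ hζ))

lemma greenPotential_congr {f g : ℂ → ℝ} (h : f =ᵐ[volume.restrict unitDisk] g) :
    greenPotential f = greenPotential g := by
  funext z
  unfold greenPotential
  congr 1
  refine integral_congr_ae ?_
  filter_upwards [h] with ζ hζ
  rw [hζ]

lemma ae_ne (z : ℂ) : ∀ᵐ ζ ∂(volume.restrict unitDisk), ζ ≠ z :=
  ae_restrict_of_ae (by simp [ae_iff])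

/-- The potential of a bounded density is continuous: truncating the kernel near the diagonal gives
continuous functions that converge uniformly. -/
lemma continuous_greenPotential {f : ℂ → ℝ} {C : ℝ} (hC : 0 ≤ C)
    (hf : AEStronglyMeasurable f (volume.restrict unitDisk)) (h : ∀ z ∈ unitDisk, |f z| ≤ C) :
    Continuous (greenPotential f) := by
  set m : ℕ → ℂ → ℂ → ℝ := fun n z ζ => min 1 ((n + 1) * ‖z - ζ‖) with hm
  have hm0 : ∀ n z ζ, 0 ≤ m n z ζ := fun n z ζ => by positivity
  have hm1 : ∀ n z ζ, m n z ζ ≤ 1 := fun n z ζ => min_le_left _ _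
  have hmm : ∀ n z, Measurable (fun ζ => m n z ζ) := fun n z => by simp only [hm]; fun_prop
  have hbd : ∀ n z ζ, greenKernel z ζ * m n z ζ ≤ n + 1 := fun n z ζ => by
    calc _ ≤ ‖z - ζ‖⁻¹ * ((n + 1) * ‖z - ζ‖) :=
          mul_le_mul (greenKernel_le_inv z ζ) (min_le_right _ _) (hm0 _ _ _) (by positivity)
      _ = (n + 1) * (‖z - ζ‖⁻¹ * ‖z - ζ‖) := by ring
      _ ≤ (n + 1) * 1 := by gcongr; exact inv_mul_le_one
      _ = _ := mul_one _
  have hcont : ∀ n : ℕ, Continuous fun z =>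
      (2 * π)⁻¹ * ∫ ζ in unitDisk, greenKernel z ζ * m n z ζ * f ζ := fun n => by
    refine continuous_const.mul (continuous_iff_continuousAt.2 fun z => ?_)
    refine continuousAt_of_dominated (bound := fun _ => (n + 1) * C) ?_ ?_ (integrable_const _) ?_
    · exact Eventually.of_forall fun z =>
        (((measurable_greenKernel_right z).mul (hmm n z)).aestronglyMeasurable).mul hf
    · refine Eventually.of_forall fun z => (ae_restrict_iff' measurableSet_unitDisk).2
        (Eventually.of_forall fun ζ hζ => ?_)
      rw [norm_mul, Real.norm_of_nonneg (mul_nonneg (greenKernel_nonneg _ _) (hm0 _ _ _))]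
      exact mul_le_mul (hbd n z ζ) (h ζ hζ) (norm_nonneg _) (by positivity)
    · filter_upwards [ae_ne z] with ζ hζ
      refine ((continuousAt_greenKernel hζ.symm).mul ?_).mul continuousAt_const
      simp only [hm]; fun_prop
  refine TendstoUniformly.continuous (F := fun (n : ℕ) z =>
      (2 * π)⁻¹ * ∫ ζ in unitDisk, greenKernel z ζ * m n z ζ * f ζ) (p := atTop) ?_
    (Frequently.of_forall hcont)
  rw [Metric.tendstoUniformly_iff]
  intro ε hε
  have hlim : Tendsto (fun n : ℕ => C * (1 / ((n : ℝ) + 1))) atTop (𝓝 (C * 0)) :=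
    tendsto_one_div_add_atTop_nhds_zero_nat.const_mul C
  rw [mul_zero] at hlim
  filter_upwards [hlim.eventually_lt_const hε] with n hn z
  refine lt_of_le_of_lt ?_ hn
  have hsub : (unitDisk ∩ Metric.ball z (1 / ((n : ℝ) + 1))) ⊆ Metric.ball z (1 / ((n : ℝ) + 1)) :=
    Set.inter_subset_right
  have hi : Integrable (fun ζ => C * (Metric.ball z (1 / ((n : ℝ) + 1))).indicator
      (fun ζ => ‖z - ζ‖⁻¹) ζ) (volume.restrict unitDisk) := by
    refine (IntegrableOn.integrable_indicator ?_ Metric.isOpen_ball.measurableSet).const_mul C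
    have := (integrableOn_ball_inv_norm_sub z (1 / ((n : ℝ) + 1)))
    simp_rw [norm_sub_rev z]
    exact this.restrict
  have hI : Integrable (fun ζ => greenKernel z ζ * m n z ζ * f ζ) (volume.restrict unitDisk) := by
    refine (integrable_const ((n + 1 : ℝ) * C)).mono'
      ((((measurable_greenKernel_right z).mul (hmm n z)).aestronglyMeasurable).mul hf)
      ((ae_restrict_iff' measurableSet_unitDisk).2 (Eventually.of_forall fun ζ hζ => ?_))
    rw [norm_mul, Real.norm_of_nonneg (mul_nonneg (greenKernel_nonneg _ _) (hm0 _ _ _))]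
    exact mul_le_mul (hbd n z ζ) (h ζ hζ) (norm_nonneg _) (by positivity)
  rw [greenPotential, dist_eq_norm, ← mul_sub, ← integral_sub
    (integrable_greenKernel_mul_of_bounded hf h z) hI, norm_mul,
    Real.norm_of_nonneg (by positivity), inv_mul_le_iff₀ (by positivity)]
  calc _ ≤ ∫ ζ in unitDisk, C * (Metric.ball z (1 / ((n : ℝ) + 1))).indicator
          (fun ζ => ‖z - ζ‖⁻¹) ζ := by
        refine norm_integral_le_of_norm_le hi
          ((ae_restrict_iff' measurableSet_unitDisk).2 (Eventually.of_forall fun ζ hζ => ?_))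
        rw [← sub_mul, ← mul_one_sub, norm_mul, mul_comm, Real.norm_of_nonneg
          (mul_nonneg (greenKernel_nonneg _ _) (sub_nonneg.2 (hm1 _ _ _)))]
        refine mul_le_mul (h ζ hζ) ?_ (mul_nonneg (greenKernel_nonneg _ _)
          (sub_nonneg.2 (hm1 _ _ _))) hC
        by_cases hb : ζ ∈ Metric.ball z (1 / ((n : ℝ) + 1))
        · rw [Set.indicator_of_mem hb]
          exact (mul_le_of_le_one_right (greenKernel_nonneg _ _)
            (by linarith [hm0 n z ζ])).trans (greenKernel_le_inv z ζ)
        · have : m n z ζ = 1 := by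
            rw [Metric.mem_ball, dist_eq_norm, norm_sub_rev, not_lt,
              div_le_iff₀ (by positivity)] at hb
            exact min_eq_left (by linarith)
          rw [Set.indicator_of_notMem hb, this]; simp
    _ = C * ∫ ζ in unitDisk ∩ Metric.ball z (1 / ((n : ℝ) + 1)), ‖z - ζ‖⁻¹ := by
        rw [integral_const_mul, setIntegral_indicator Metric.isOpen_ball.measurableSet]
    _ ≤ C * (2 * π * (1 / ((n : ℝ) + 1))) := by
        gcongr
        exact integral_inv_norm_sub_le (by positivity) hsub
    _ = _ := by ring

/-- The part of the disk at positive distance from `z` contributes integrably. -/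
lemma WeightedIntegrable.integrableOn_greenKernel_mul {f : ℂ → ℝ} (hf : WeightedIntegrable f)
    {z : ℂ} {d : ℝ} (hd : 0 < d) {s : Set ℂ} (hs : s ⊆ unitDisk) (hsm : MeasurableSet s)
    (h : ∀ ζ ∈ s, d ≤ ‖z - ζ‖) : IntegrableOn (fun ζ => greenKernel z ζ * f ζ) s := by
  refine Integrable.mono ((IntegrableOn.mono_set hf hs).const_mul (d ^ 2)⁻¹)
    ((measurable_greenKernel_right z).aestronglyMeasurable.mul
      (hf.aestronglyMeasurable.mono_measure (Measure.restrict_mono hs le_rfl)))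
    ((ae_restrict_iff' hsm).2 (Eventually.of_forall fun ζ hζ => ?_))
  have h1 := mem_unitDisk.1 (hs hζ)
  rw [norm_mul, norm_mul, norm_mul, Real.norm_of_nonneg (greenKernel_nonneg _ _),
    Real.norm_of_nonneg (r := (d ^ 2)⁻¹) (by positivity),
    Real.norm_of_nonneg (r := 1 - ‖ζ‖) (by linarith)]
  have := greenKernel_le_of_dist hd (h ζ hζ) h1
  calc _ ≤ (d ^ 2)⁻¹ * (1 - ‖ζ‖) * ‖f ζ‖ := by gcongr
    _ = _ := by ring

lemma indicator_bound {f : ℂ → ℝ} {s : Set ℂ} {C : ℝ} (hC0 : 0 ≤ C) (hC : ∀ z ∈ s, |f z| ≤ C)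
    (z : ℂ) : |s.indicator f z| ≤ C := by
  by_cases hz : z ∈ s <;> simp [hz, hC, hC0]

lemma BoundedOnSmallerDisks.exists_bound {f : ℂ → ℝ} (hb : BoundedOnSmallerDisks f) {ρ : ℝ}
    (hρ : ρ < 1) : ∃ C, 0 ≤ C ∧ ∀ z ∈ Metric.closedBall (0 : ℂ) ρ, |f z| ≤ C := by
  obtain ⟨C, hC⟩ := hb ρ hρ
  exact ⟨max C 0, le_max_right _ _, fun z hz =>
    (hC z (by simpa using hz)).trans (le_max_left _ _)⟩

lemma integrable_greenKernel_mul {f : ℂ → ℝ} (hf : WeightedIntegrable f)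
    (hb : BoundedOnSmallerDisks f) (z : ℂ) :
    IntegrableOn (fun ζ => greenKernel z ζ * f ζ) unitDisk := by
  by_cases hz : ‖z‖ < 1
  · set ρ := (1 + ‖z‖) / 2 with hρ
    obtain ⟨C, hC0, hC⟩ := hb.exists_bound (show ρ < 1 by linarith)
    have hm : MeasurableSet (Metric.closedBall (0 : ℂ) ρ) :=
      Metric.isClosed_closedBall.measurableSet
    have h1 := integrable_greenKernel_mul_of_bounded (hf.aestronglyMeasurable.indicator hm)
      (fun z _ => indicator_bound hC0 hC z) z
    have h2 : IntegrableOn (fun ζ => greenKernel z ζ * f ζ) (unitDisk \ Metric.closedBall 0 ρ) := by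
      refine hf.integrableOn_greenKernel_mul (d := (1 - ‖z‖) / 2) (by linarith) Set.sdiff_subset
        (measurableSet_unitDisk.diff hm) fun ζ hζ => ?_
      have : ρ < ‖ζ‖ := by simpa using hζ.2
      have := norm_sub_norm_le ζ z
      rw [norm_sub_rev] at this
      linarith
    have h3 := h1.add (h2.integrable_indicator (measurableSet_unitDisk.diff hm)).integrableOn
    refine IntegrableOn.congr_fun h3 (fun ζ hζ => ?_) measurableSet_unitDisk
    by_cases hx : ζ ∈ Metric.closedBall (0 : ℂ) ρ <;> simp [hx, hζ]
  · simp [greenKernel_eq_zero (not_lt.1 hz)]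

lemma greenPotential_sub {f g : ℂ → ℝ} {z : ℂ}
    (hf : IntegrableOn (fun ζ => greenKernel z ζ * f ζ) unitDisk)
    (hg : IntegrableOn (fun ζ => greenKernel z ζ * g ζ) unitDisk) :
    greenPotential (fun ζ => f ζ - g ζ) z = greenPotential f z - greenPotential g z := by
  unfold greenPotential
  simp_rw [mul_sub (greenKernel _ _)]
  rw [integral_sub hf hg, mul_sub]

lemma continuousOn_greenPotential {f : ℂ → ℝ} (hf : WeightedIntegrable f)
    (hb : BoundedOnSmallerDisks f) : ContinuousOn (greenPotential f) unitDisk := by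
  intro z₀ hz₀
  refine ContinuousAt.continuousWithinAt ?_
  have hz := mem_unitDisk.1 hz₀
  set ρ := (1 + ‖z₀‖) / 2 with hρ
  obtain ⟨C, hC0, hC⟩ := hb.exists_bound (show ρ < 1 by linarith)
  have hm : MeasurableSet (Metric.closedBall (0 : ℂ) ρ) := Metric.isClosed_closedBall.measurableSet
  set f₁ := (Metric.closedBall (0 : ℂ) ρ).indicator f with hf₁
  have hf₁m : AEStronglyMeasurable f₁ (volume.restrict unitDisk) :=
    hf.aestronglyMeasurable.indicator hm
  have hf₁b : ∀ z ∈ unitDisk, |f₁ z| ≤ C := fun z _ => indicator_bound hC0 hC z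
  have hsplit : greenPotential f = fun z => greenPotential f₁ z +
      greenPotential (fun ζ => f ζ - f₁ ζ) z := by
    funext z
    rw [greenPotential_sub (integrable_greenKernel_mul hf hb z)
      (integrable_greenKernel_mul_of_bounded hf₁m hf₁b z)]
    ring
  rw [hsplit]
  refine (continuous_greenPotential hC0 hf₁m hf₁b).continuousAt.add ?_
  -- near `z₀` the remaining density stays at distance `d` from the pole
  set d := (1 - ‖z₀‖) / 4 with hd
  have hd0 : 0 < d := by linarith
  have hnear : Metric.ball z₀ d ∈ 𝓝 z₀ := Metric.ball_mem_nhds _ hd0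
  refine continuousAt_const.mul (continuousAt_of_dominated
    (bound := fun ζ => (d ^ 2)⁻¹ * ‖f ζ * (1 - ‖ζ‖)‖) ?_ ?_ (hf.norm.const_mul _) ?_)
  · exact Eventually.of_forall fun z => (measurable_greenKernel_right z).aestronglyMeasurable.mul
      (hf.aestronglyMeasurable.sub hf₁m)
  · filter_upwards [hnear] with z hzb
    refine (ae_restrict_iff' measurableSet_unitDisk).2 (Eventually.of_forall fun ζ hζ => ?_)
    have hζ1 := mem_unitDisk.1 hζ
    by_cases hx : ζ ∈ Metric.closedBall (0 : ℂ) ρ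
    · simp only [hf₁, hx, Set.indicator_of_mem, sub_self, mul_zero, norm_zero]; positivity
    · have hdist : d ≤ ‖z - ζ‖ := by
        have h1 : ρ < ‖ζ‖ := by simpa using hx
        have h2 := norm_sub_norm_le ζ z
        have h3 := norm_sub_norm_le z z₀
        rw [norm_sub_rev] at h2
        rw [Metric.mem_ball, dist_eq_norm] at hzb
        linarith
      have h4 := greenKernel_le_of_dist hd0 hdist hζ1
      simp only [hf₁, hx, not_false_eq_true, Set.indicator_of_notMem, sub_zero]
      rw [norm_mul, norm_mul, Real.norm_of_nonneg (greenKernel_nonneg _ _),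
        Real.norm_of_nonneg (r := 1 - ‖ζ‖) (by linarith)]
      calc _ ≤ (d ^ 2)⁻¹ * (1 - ‖ζ‖) * ‖f ζ‖ := by gcongr
        _ = _ := by ring
  · filter_upwards [ae_ne z₀] with ζ hζ
    exact (continuousAt_greenKernel hζ.symm).mul continuousAt_const

/-! ### Green potentials of weighted integrable densities -/

/-- Integrated over a compact part of the disk, the kernel decays linearly at the boundary. -/
lemma exists_integral_greenKernel_le {ρ : ℝ} (hρ0 : 0 < ρ) (hρ : ρ < 1) :
    ∃ C, 0 ≤ C ∧ ∀ ζ ∈ unitDisk,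
      IntegrableOn (fun z => greenKernel z ζ) (Metric.closedBall 0 ρ) ∧
      ∫ z in Metric.closedBall 0 ρ, greenKernel z ζ ≤ C * (1 - ‖ζ‖) := by
  set d := (1 - ρ) / 2 with hd
  have hd0 : 0 < d := by linarith
  have hsub : Metric.closedBall (0 : ℂ) ρ ⊆ unitDisk := Metric.closedBall_subset_ball hρ
  have hm : MeasurableSet (Metric.closedBall (0 : ℂ) ρ) := Metric.isClosed_closedBall.measurableSet
  set V := volume.real (Metric.closedBall (0 : ℂ) ρ) with hV
  have hV0 : 0 ≤ V := measureReal_nonneg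
  refine ⟨(d ^ 2)⁻¹ * V + 4 * π / d, by positivity, fun ζ hζ => ?_⟩
  have hζ1 := mem_unitDisk.1 hζ
  have hi : IntegrableOn (fun z => greenKernel z ζ) (Metric.closedBall 0 ρ) := by
    refine ((integrableOn_unitDisk_inv_norm_sub hζ1).mono_set hsub).mono'
      (measurable_greenKernel_left ζ).aestronglyMeasurable (Eventually.of_forall fun z => ?_)
    rw [Real.norm_of_nonneg (greenKernel_nonneg _ _), norm_sub_rev]
    exact greenKernel_le_inv z ζ
  refine ⟨hi, ?_⟩
  rcases le_total ‖ζ‖ (1 - d) with h | h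
  · have h1 : ∫ z in Metric.closedBall 0 ρ, greenKernel z ζ ≤ 2 * π * 2 := by
      refine le_trans ?_ (integral_inv_norm_sub_le (z := ζ) (by norm_num : (0:ℝ) ≤ 2)
        (hsub.trans (unitDisk_subset_ball hζ1)))
      refine integral_mono hi ((integrableOn_unitDisk_inv_norm_sub hζ1).mono_set hsub) fun z => ?_
      simp only
      rw [norm_sub_rev]
      exact greenKernel_le_inv z ζ
    have h2 : 2 * π * 2 ≤ 4 * π / d * (1 - ‖ζ‖) := by
      rw [div_mul_eq_mul_div, le_div_iff₀ hd0]
      nlinarith [Real.pi_pos]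
    have h3 : 0 ≤ (d ^ 2)⁻¹ * V * (1 - ‖ζ‖) := mul_nonneg (by positivity) (by linarith)
    linarith
  · have h1 : ∫ z in Metric.closedBall 0 ρ, greenKernel z ζ
        ≤ ∫ z in Metric.closedBall (0 : ℂ) ρ, (d ^ 2)⁻¹ * (1 - ‖ζ‖) := by
      refine setIntegral_mono_on hi
        ((continuous_const.locallyIntegrable).integrableOn_isCompact (isCompact_closedBall 0 ρ)) hm
        fun z hz => greenKernel_le_of_dist hd0 ?_ hζ1
      have h2 := norm_sub_norm_le ζ z
      rw [norm_sub_rev] at h2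
      have : ‖z‖ ≤ ρ := by simpa using hz
      linarith
    rw [setIntegral_const, smul_eq_mul] at h1
    have h3 : 0 ≤ 4 * π / d * (1 - ‖ζ‖) := mul_nonneg (by positivity) (by linarith)
    calc _ ≤ _ := h1
      _ = (d ^ 2)⁻¹ * V * (1 - ‖ζ‖) := by ring
      _ ≤ _ := by linarith

lemma WeightedIntegrable.integrable_prod {f : ℂ → ℝ} (hf : WeightedIntegrable f) {ρ : ℝ}
    (hρ0 : 0 < ρ) (hρ : ρ < 1) :
    Integrable (fun p : ℂ × ℂ => greenKernel p.1 p.2 * f p.2)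
      ((volume.restrict (Metric.closedBall 0 ρ)).prod (volume.restrict unitDisk)) := by
  obtain ⟨C, hC0, hC⟩ := exists_integral_greenKernel_le hρ0 hρ
  have hm : AEStronglyMeasurable (fun p : ℂ × ℂ => greenKernel p.1 p.2 * f p.2)
      ((volume.restrict (Metric.closedBall 0 ρ)).prod (volume.restrict unitDisk)) :=
    measurable_greenKernel.aestronglyMeasurable.mul hf.aestronglyMeasurable.comp_snd
  rw [integrable_prod_iff' hm]
  refine ⟨(ae_restrict_iff' measurableSet_unitDisk).2 (Eventually.of_forall fun ζ hζ =>
    (hC ζ hζ).1.mul_const (f ζ)), ?_⟩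
  refine Integrable.mono (hf.const_mul C) ?_
    ((ae_restrict_iff' measurableSet_unitDisk).2 (Eventually.of_forall fun ζ hζ => ?_))
  · refine AEStronglyMeasurable.integral_prod_right' (μ := volume.restrict unitDisk)
      (f := fun p : ℂ × ℂ => ‖greenKernel p.2 p.1 * f p.1‖) ?_
    exact ((measurable_greenKernel.comp measurable_swap).aestronglyMeasurable.mul
      hf.aestronglyMeasurable.comp_fst).norm
  · have hζ1 := mem_unitDisk.1 hζ
    simp only [norm_mul, Real.norm_of_nonneg (greenKernel_nonneg _ _)]
    rw [integral_mul_const, norm_mul, norm_norm, Real.norm_of_nonneg (r := C) hC0,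
      Real.norm_of_nonneg (r := 1 - ‖ζ‖) (by linarith), Real.norm_of_nonneg
      (integral_nonneg fun _ => greenKernel_nonneg _ _)]
    calc _ ≤ C * (1 - ‖ζ‖) * ‖f ζ‖ := by gcongr; exact (hC ζ hζ).2
      _ = _ := by ring

lemma WeightedIntegrable.integrableOn_greenPotential {f : ℂ → ℝ} (hf : WeightedIntegrable f)
    {ρ : ℝ} (hρ : ρ < 1) : IntegrableOn (greenPotential f) (Metric.closedBall 0 ρ) := by
  have h : IntegrableOn (greenPotential f) (Metric.closedBall 0 (max ρ (1 / 2))) :=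
    (hf.integrable_prod (by positivity) (max_lt hρ (by norm_num))).integral_prod_left.const_mul _
  exact h.mono_set (Metric.closedBall_subset_closedBall (le_max_left _ _))

lemma locallyIntegrableOn_of_closedBall {f : ℂ → ℝ}
    (h : ∀ ρ < 1, IntegrableOn f (Metric.closedBall 0 ρ)) : LocallyIntegrableOn f unitDisk := by
  intro z hz
  have hz := mem_unitDisk.1 hz
  refine ⟨Metric.closedBall 0 ((1 + ‖z‖) / 2), mem_nhdsWithin_of_mem_nhds ?_, h _ (by linarith)⟩
  exact Metric.closedBall_mem_nhds_of_mem (by rw [mem_ball_zero_iff]; linarith)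

lemma integrableOn_closedBall_of_locally {f : ℂ → ℝ} (h : LocallyIntegrableOn f unitDisk) {ρ : ℝ}
    (hρ : ρ < 1) : IntegrableOn f (Metric.closedBall 0 ρ) :=
  h.integrableOn_compact_subset (Metric.closedBall_subset_ball hρ) (isCompact_closedBall 0 ρ)

lemma integral_greenKernel_mul_laplacian {φ : ℂ → ℝ} (h : ContDiff ℝ ∞ φ)
    (hc : HasCompactSupport φ) (hs : tsupport φ ⊆ unitDisk) {ζ : ℂ} (hζ : ζ ∈ unitDisk) :
    ∫ z in unitDisk, greenKernel z ζ * Laplacian.laplacian φ z = -(2 * π * φ ζ) := by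
  have hζ1 := mem_unitDisk.1 hζ
  have h2 : ContDiff ℝ 2 φ := contDiff_infty.1 h 2
  have hl := integrable_log_mul_laplacian h2 hc ζ
  have hk : InnerProductSpace.HarmonicOnNhd (fun z => Real.log ‖1 - starRingEnd ℂ ζ * z‖)
    unitDisk := fun z hz => harmonicAt_log_norm_one_sub hζ1 (mem_unitDisk.1 hz)
  have h3 := integral_harmonic_mul_laplacian hk h hc hs
  have hzero : ∀ z ∉ unitDisk, Laplacian.laplacian φ z = 0 := fun z hz =>
    laplacian_eq_zero_of_notMem_tsupport fun hz' => hz (hs hz')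
  have h4 : ∫ z in unitDisk, Real.log ‖z - ζ‖ * Laplacian.laplacian φ z = 2 * π * φ ζ := by
    rw [← integral_log_norm_sub_mul_laplacian h2 hc ζ]
    exact setIntegral_eq_integral_of_forall_compl_eq_zero fun z hz => by rw [hzero z hz, mul_zero]
  have hki : IntegrableOn (fun z => Real.log ‖1 - starRingEnd ℂ ζ * z‖ *
      Laplacian.laplacian φ z) unitDisk := by
    obtain ⟨ρ, hρ0, hρ1, hρ⟩ := exists_closedBall_of_tsupport_subset hc hs
    have : IntegrableOn (fun z => Real.log ‖1 - starRingEnd ℂ ζ * z‖ *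
      Laplacian.laplacian φ z) (Metric.closedBall 0 ρ) := by
      refine ContinuousOn.integrableOn_compact (isCompact_closedBall 0 ρ) ?_
      exact (hk.continuousOn.mono (Metric.closedBall_subset_ball hρ1)).mul
        (continuous_laplacian h2).continuousOn
    refine this.of_forall_sdiff_eq_zero measurableSet_unitDisk fun z hz => ?_
    rw [laplacian_eq_zero_of_notMem_tsupport fun hz' => hz.2 (hρ hz'), mul_zero]
  calc _ = ∫ z in unitDisk, (Real.log ‖1 - starRingEnd ℂ ζ * z‖ * Laplacian.laplacian φ z
          - Real.log ‖z - ζ‖ * Laplacian.laplacian φ z) := by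
        refine integral_congr_ae ?_
        filter_upwards [ae_ne ζ, ae_restrict_mem measurableSet_unitDisk] with z hz hzD
        rw [greenKernel_eq_log (mem_unitDisk.1 hzD) hζ1 hz, sub_mul]
    _ = _ := by
        rw [integral_sub hki hl.integrableOn, h3, h4, zero_sub]

/-- `-Δ (G f) = f` in the weak sense. -/
lemma WeightedIntegrable.integral_greenPotential_mul_laplacian {f φ : ℂ → ℝ}
    (hf : WeightedIntegrable f) (h : ContDiff ℝ ∞ φ)
    (hc : HasCompactSupport φ) (hs : tsupport φ ⊆ unitDisk) :
    ∫ z in unitDisk, greenPotential f z * Laplacian.laplacian φ z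
      = -∫ z in unitDisk, f z * φ z := by
  obtain ⟨ρ, hρ0, hρ1, hρ⟩ := exists_closedBall_of_tsupport_subset hc hs
  have hcl : Continuous (Laplacian.laplacian φ) :=
    continuous_laplacian (contDiff_infty.1 h 2)
  have hzero : ∀ z ∉ Metric.closedBall (0 : ℂ) ρ, Laplacian.laplacian φ z = 0 := fun z hz =>
    laplacian_eq_zero_of_notMem_tsupport fun hz' => hz (hρ hz')
  obtain ⟨C, hC⟩ := (hasCompactSupport_laplacian hc).exists_bound_of_continuous hcl
  have hp : Integrable (fun p : ℂ × ℂ => greenKernel p.1 p.2 * f p.2 * Laplacian.laplacian φ p.1)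
      ((volume.restrict (Metric.closedBall 0 ρ)).prod (volume.restrict unitDisk)) :=
    (hf.integrable_prod hρ0 hρ1).mul_bdd (c := C)
      (hcl.comp continuous_fst).aestronglyMeasurable (Eventually.of_forall fun p => hC p.1)
  have hball : ∀ F : ℂ → ℝ, ∫ z in unitDisk, F z * Laplacian.laplacian φ z
      = ∫ z in Metric.closedBall 0 ρ, F z * Laplacian.laplacian φ z := fun F => by
    refine setIntegral_eq_of_subset_of_forall_sdiff_eq_zero measurableSet_unitDisk
      (Metric.closedBall_subset_ball hρ1) fun z hz => by rw [hzero z hz.2, mul_zero]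
  rw [hball]
  calc _ = (2 * π)⁻¹ * ∫ z in Metric.closedBall 0 ρ, (∫ ζ in unitDisk,
          greenKernel z ζ * f ζ * Laplacian.laplacian φ z) := by
        rw [← integral_const_mul]
        refine integral_congr_ae (Eventually.of_forall fun z => ?_)
        simp only [greenPotential]
        rw [integral_mul_const]; ring
    _ = (2 * π)⁻¹ * ∫ ζ in unitDisk, (∫ z in Metric.closedBall 0 ρ,
          greenKernel z ζ * f ζ * Laplacian.laplacian φ z) := by
        rw [integral_integral_swap hp]
    _ = (2 * π)⁻¹ * ∫ ζ in unitDisk, -(2 * π) * (f ζ * φ ζ) := by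
        congr 1
        refine setIntegral_congr_fun measurableSet_unitDisk fun ζ hζ => ?_
        have h1 := integral_greenKernel_mul_laplacian h hc hs hζ
        rw [hball] at h1
        have h2 : ∀ z, greenKernel z ζ * f ζ * Laplacian.laplacian φ z
          = f ζ * (greenKernel z ζ * Laplacian.laplacian φ z) := fun z => by ring
        simp only [h2]
        rw [integral_const_mul, h1]; ring
    _ = _ := by
        rw [integral_const_mul]; field_simp

/-- Circle means of a Green potential tend to zero at the boundary. -/
lemma WeightedIntegrable.tendsto_lintegral_circle {f : ℂ → ℝ} (hf : WeightedIntegrable f) :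
    Tendsto (fun r : ℝ => ∫⁻ θ, ‖greenPotential f (circleMap 0 r θ)‖ₑ ∂angleMeasure)
      (𝓝[<] 1) (𝓝 0) := by
  set B : ℝ → ℂ → ENNReal := fun r ζ => ‖f ζ‖ₑ * ENNReal.ofReal (-Real.log (max r ‖ζ‖)) with hB
  have hlim : Tendsto (fun r => ∫⁻ ζ in unitDisk, B r ζ) (𝓝[<] 1) (𝓝 0) := by
    have h0 : (0 : ENNReal) = ∫⁻ ζ in unitDisk, 0 := by simp
    rw [h0]
    refine tendsto_lintegral_filter_of_dominated_convergence'
      (fun ζ => ENNReal.ofReal 2 * ‖f ζ * (1 - ‖ζ‖)‖ₑ) ?_ ?_ ?_ ?_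
    · refine Eventually.of_forall fun r => hf.aestronglyMeasurable.enorm.mul ?_
      exact (by fun_prop : Measurable fun ζ : ℂ =>
        ENNReal.ofReal (-Real.log (max r ‖ζ‖))).aemeasurable
    · have h1 : Set.Ioo (1 / 2 : ℝ) 1 ∈ 𝓝[<] (1 : ℝ) := Ioo_mem_nhdsLT (by norm_num)
      filter_upwards [h1] with r hr
      refine (ae_restrict_iff' measurableSet_unitDisk).2 (Eventually.of_forall fun ζ hζ => ?_)
      have hζ1 := mem_unitDisk.1 hζ
      set x := max r ‖ζ‖ with hx
      have hx1 : 1 / 2 < x := hr.1.trans_le (le_max_left _ _)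
      have hx3 : ‖ζ‖ ≤ x := le_max_right _ _
      have h2 := Real.log_le_sub_one_of_pos (x := x⁻¹) (by positivity)
      rw [Real.log_inv] at h2
      have h3 : x⁻¹ - 1 ≤ 2 * (1 - ‖ζ‖) := by
        have hx2 : x < 1 := max_lt hr.2 hζ1
        have : x⁻¹ ≤ 2 := by rw [inv_le_comm₀ (by linarith) (by norm_num)]; linarith
        have h5 : x⁻¹ * x = 1 := inv_mul_cancel₀ (by linarith)
        nlinarith
      simp only [hB]
      rw [enorm_mul, mul_left_comm, ← ofReal_norm (1 - ‖ζ‖),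
        Real.norm_of_nonneg (r := 1 - ‖ζ‖) (by linarith), ← ENNReal.ofReal_mul (by norm_num)]
      gcongr
      linarith
    · have : ∫⁻ ζ in unitDisk, ENNReal.ofReal 2 * ‖f ζ * (1 - ‖ζ‖)‖ₑ < ⊤ := by
        rw [lintegral_const_mul' _ _ ENNReal.ofReal_ne_top]
        exact ENNReal.mul_lt_top ENNReal.ofReal_lt_top hf.2
      exact this.ne
    · refine (ae_restrict_iff' measurableSet_unitDisk).2 (Eventually.of_forall fun ζ hζ => ?_)
      have hζ1 := mem_unitDisk.1 hζ
      have h1 : Tendsto (fun r : ℝ => ENNReal.ofReal (-Real.log (max r ‖ζ‖))) (𝓝[<] 1)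
          (𝓝 (ENNReal.ofReal (-Real.log (max 1 ‖ζ‖)))) := by
        refine ENNReal.tendsto_ofReal (Tendsto.mono_left ?_ nhdsWithin_le_nhds)
        refine (ContinuousAt.neg (ContinuousAt.log ?_ ?_)).tendsto
        · fun_prop
        · positivity
      rw [max_eq_left hζ1.le, Real.log_one, neg_zero, ENNReal.ofReal_zero] at h1
      have h2 := ENNReal.Tendsto.const_mul h1 (a := ‖f ζ‖ₑ) (Or.inr enorm_ne_top)
      simpa [hB] using h2
  refine tendsto_of_tendsto_of_tendsto_of_le_of_le' tendsto_const_nhds hlim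
    (Eventually.of_forall fun _ => bot_le) ?_
  filter_upwards [Ioo_mem_nhdsLT (zero_lt_one : (0:ℝ) < 1)] with r hr
  calc _ ≤ ∫⁻ θ, ENNReal.ofReal (2 * π)⁻¹ * (∫⁻ ζ in unitDisk,
          ENNReal.ofReal (greenKernel (circleMap 0 r θ) ζ) * ‖f ζ‖ₑ) ∂angleMeasure := by
        refine lintegral_mono fun θ => ?_
        simp only [greenPotential]
        rw [enorm_mul, ← ofReal_norm (2 * π)⁻¹, Real.norm_of_nonneg (by positivity)]
        gcongr
        refine (enorm_integral_le_lintegral_enorm _).trans (lintegral_mono fun ζ => ?_)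
        simp only
        rw [enorm_mul, ← ofReal_norm (greenKernel _ _),
          Real.norm_of_nonneg (greenKernel_nonneg _ _)]
    _ = ENNReal.ofReal (2 * π)⁻¹ * ∫⁻ ζ in unitDisk, (∫⁻ θ,
          ENNReal.ofReal (greenKernel (circleMap 0 r θ) ζ) * ‖f ζ‖ₑ ∂angleMeasure) := by
        rw [lintegral_const_mul' _ _ ENNReal.ofReal_ne_top, lintegral_lintegral_swap]
        refine AEMeasurable.mul ?_ hf.aestronglyMeasurable.enorm.comp_snd
        refine (Measurable.ennreal_ofReal ?_).aemeasurable
        exact measurable_greenKernel.comp (((continuous_circleMap 0 r).measurable.comp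
          measurable_fst).prodMk measurable_snd)
    _ = ENNReal.ofReal (2 * π)⁻¹ * ∫⁻ ζ in unitDisk, ENNReal.ofReal (2 * π) * B r ζ := by
        congr 1
        refine setLIntegral_congr_fun measurableSet_unitDisk fun ζ hζ => ?_
        simp only [hB]
        rw [lintegral_mul_const' _ _ enorm_ne_top, lintegral_greenKernel_circle hr.1 hr.2
          (mem_unitDisk.1 hζ), ENNReal.ofReal_mul (by positivity)]
        ring
    _ = ∫⁻ ζ in unitDisk, B r ζ := by
        rw [lintegral_const_mul' _ _ ENNReal.ofReal_ne_top, ← mul_assoc,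
          ← ENNReal.ofReal_mul (by positivity), inv_mul_cancel₀ (by positivity)]
        simp
    _ ≤ _ := le_rfl

/-- Green potentials are superharmonic where the density is nonnegative. -/
lemma circleAverage_greenPotential_le {F : ℂ → ℝ} (hF : WeightedIntegrable F)
    (hb : BoundedOnSmallerDisks F) {z₀ : ℂ} {ρ : ℝ} (hρ : 0 < ρ)
    (hball : Metric.closedBall z₀ ρ ⊆ unitDisk)
    (hpos : ∀ᵐ ζ, ζ ∈ Metric.ball z₀ ρ → 0 ≤ F ζ) :
    Real.circleAverage (greenPotential F) z₀ ρ ≤ greenPotential F z₀ := by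
  have hball' : Metric.closedBall z₀ |ρ| ⊆ unitDisk := by rwa [abs_of_pos hρ]
  have hi0 : IntegrableOn (fun ζ => greenKernel z₀ ζ * F ζ) unitDisk :=
    integrable_greenKernel_mul hF hb z₀
  have hmc : Measurable (fun p : ℝ × ℂ => greenKernel (circleMap z₀ ρ p.1) p.2) :=
    measurable_greenKernel.comp (((continuous_circleMap z₀ ρ).measurable.comp
          measurable_fst).prodMk measurable_snd)
  have hmean : ∀ ζ ∈ unitDisk, ∫ θ, greenKernel (circleMap z₀ ρ θ) ζ ∂angleMeasure
      = 2 * π * Real.circleAverage (fun z => greenKernel z ζ) z₀ ρ := fun ζ _ => by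
    rw [circleAverage_eq_angle]; field_simp
  have hp : Integrable (fun p : ℝ × ℂ => greenKernel (circleMap z₀ ρ p.1) p.2 * F p.2)
      (angleMeasure.prod (volume.restrict unitDisk)) := by
    have hm : AEStronglyMeasurable (fun p : ℝ × ℂ => greenKernel (circleMap z₀ ρ p.1) p.2 * F p.2)
        (angleMeasure.prod (volume.restrict unitDisk)) :=
      hmc.aestronglyMeasurable.mul hF.aestronglyMeasurable.comp_snd
    rw [integrable_prod_iff' hm]
    refine ⟨(ae_restrict_iff' measurableSet_unitDisk).2 (Eventually.of_forall fun ζ hζ =>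
      (circleIntegrable_iff_angle.1 (circleIntegrable_greenKernel (mem_unitDisk.1 hζ)
        hball')).mul_const (F ζ)), ?_⟩
    refine Integrable.mono (hi0.const_mul (2 * π)) ?_ ?_
    · refine AEStronglyMeasurable.integral_prod_right' (μ := volume.restrict unitDisk)
        (f := fun p : ℂ × ℝ => ‖greenKernel (circleMap z₀ ρ p.2) p.1 * F p.1‖) ?_
      exact ((hmc.comp measurable_swap).aestronglyMeasurable.mul
        hF.aestronglyMeasurable.comp_fst).norm
    · filter_upwards [ae_ne z₀, ae_restrict_mem measurableSet_unitDisk] with ζ hne hζ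
      simp only [norm_mul, Real.norm_of_nonneg (greenKernel_nonneg _ _)]
      rw [integral_mul_const, hmean ζ hζ, norm_mul, norm_norm, Real.norm_of_nonneg]
      · have := circleAverage_greenKernel_le hρ (mem_unitDisk.1 hζ) hball hne
        rw [Real.norm_of_nonneg (r := 2) (by norm_num), Real.norm_of_nonneg Real.pi_pos.le,
          ← mul_assoc]
        gcongr
      · rw [← hmean ζ hζ]; exact integral_nonneg fun _ => greenKernel_nonneg _ _
  rw [circleAverage_eq_angle]
  simp only [greenPotential]
  rw [integral_const_mul, integral_integral_swap hp, ← mul_assoc, mul_comm (2 * π)⁻¹, mul_assoc]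
  gcongr
  rw [← integral_const_mul]
  refine integral_mono_ae (hp.integral_prod_right.const_mul _) hi0 ?_
  filter_upwards [ae_ne z₀, ae_restrict_mem measurableSet_unitDisk, ae_restrict_of_ae hpos]
    with ζ hne hζ hζp
  rw [integral_mul_const, hmean ζ hζ]
  have e : (2 * π)⁻¹ * (2 * π * Real.circleAverage (fun z => greenKernel z ζ) z₀ ρ * F ζ)
      = Real.circleAverage (fun z => greenKernel z ζ) z₀ ρ * F ζ := by field_simp
  rw [e]
  by_cases hx : ζ ∈ Metric.ball z₀ ρ
  · exact mul_le_mul_of_nonneg_right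
      (circleAverage_greenKernel_le hρ (mem_unitDisk.1 hζ) hball hne) (hζp hx)
  · rw [circleAverage_greenKernel_eq hρ (mem_unitDisk.1 hζ) hball]
    rw [Metric.mem_ball, not_lt, dist_eq_norm, norm_sub_rev] at hx
    exact hx

/-! ### Poisson integrals -/

/-- The Poisson integral of a function on the unit circle; meaningful for `z` in the unit disk. -/
noncomputable def poissonIntegral (h : Circle → ℝ) (z : ℂ) : ℝ :=
  (2 * π)⁻¹ * ∫ θ, poissonKernel 0 z (circleMap 0 1 θ) * h (Circle.exp θ) ∂angleMeasure

lemma integrable_angle_of_continuous {f : ℝ → ℝ} (hf : Continuous f) :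
    Integrable f angleMeasure := by
  rw [angleMeasure, ← IntegrableOn, ← intervalIntegrable_iff_integrableOn_Ioc_of_le (by positivity)]
  exact hf.intervalIntegrable _ _

lemma exists_bound_of_boundaryLInfty {h : Circle → ℝ} (hh : IsBoundaryLInfty h) :
    ∃ M, 0 ≤ M ∧ ∀ᵐ θ ∂angleMeasure, |h (Circle.exp θ)| ≤ M := by
  refine ⟨(eLpNorm (fun θ : ℝ => h (Circle.exp θ)) ⊤ angleMeasure).toReal,
    ENNReal.toReal_nonneg, ?_⟩
  filter_upwards [ae_le_eLpNormEssSup (f := fun θ : ℝ => h (Circle.exp θ)) (μ := angleMeasure)]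
    with θ hθ
  rw [← eLpNorm_exponent_top] at hθ
  have := ENNReal.toReal_mono hh.2.ne hθ
  simpa using this

lemma integrable_of_boundaryLInfty {h : Circle → ℝ} (hh : IsBoundaryLInfty h) :
    Integrable (fun θ : ℝ => h (Circle.exp θ)) angleMeasure :=
  MemLp.integrable le_top hh

/-- The function `h ∘ exp ∘ arg` on `ℂ`, constant along rays, extends `h`. Mathlib's circle averages
are stated for functions on `ℂ`. -/
lemma circle_extension (h : Circle → ℝ) (θ : ℝ) :
    h (Circle.exp (Complex.arg (circleMap 0 1 θ))) = h (Circle.exp θ) := by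
  rw [← circleExp_coe, Circle.exp_arg]

lemma poissonKernel_nonneg {z ζ : ℂ} (hz : ‖z‖ < 1) (hζ : ‖ζ‖ = 1) : 0 ≤ poissonKernel 0 z ζ := by
  rw [poissonKernel_def]
  simp only [sub_zero, hζ]
  have : 0 ≤ 1 ^ 2 - ‖z‖ ^ 2 := by nlinarith [norm_nonneg z]
  positivity

lemma continuous_poissonKernel_circle {z : ℂ} (hz : ‖z‖ < 1) :
    Continuous (fun θ : ℝ => poissonKernel 0 z (circleMap 0 1 θ)) := by
  simp only [poissonKernel_def, sub_zero]
  have hc := continuous_circleMap 0 1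
  refine Continuous.div (by fun_prop) (by fun_prop) fun θ => ?_
  refine pow_ne_zero _ (norm_ne_zero_iff.2 (sub_ne_zero.2 fun h => ?_))
  rw [← h] at hz
  simp at hz

lemma integrable_poissonKernel_mul {h : ℝ → ℝ} (hh : Integrable h angleMeasure) {z : ℂ}
    (hz : ‖z‖ < 1) :
    Integrable (fun θ => poissonKernel 0 z (circleMap 0 1 θ) * h θ) angleMeasure := by
  have hc := continuous_poissonKernel_circle hz
  obtain ⟨C, hC⟩ := (isCompact_Icc (a := (0:ℝ)) (b := 2 * π)).exists_bound_of_continuousOn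
    hc.continuousOn
  refine hh.bdd_mul (c := C) hc.aestronglyMeasurable ((ae_restrict_iff' measurableSet_Ioc).2
    (Eventually.of_forall fun θ hθ => hC θ (Set.Ioc_subset_Icc_self hθ)))

lemma poissonIntegral_mono {h₁ h₂ : Circle → ℝ}
    (hi₁ : Integrable (fun θ : ℝ => h₁ (Circle.exp θ)) angleMeasure)
    (hi₂ : Integrable (fun θ : ℝ => h₂ (Circle.exp θ)) angleMeasure)
    (h : ∀ᵐ θ ∂angleMeasure, h₁ (Circle.exp θ) ≤ h₂ (Circle.exp θ)) {z : ℂ} (hz : ‖z‖ < 1) :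
    poissonIntegral h₁ z ≤ poissonIntegral h₂ z := by
  unfold poissonIntegral
  refine mul_le_mul_of_nonneg_left ?_ (by positivity)
  refine integral_mono_ae (integrable_poissonKernel_mul hi₁ hz)
    (integrable_poissonKernel_mul hi₂ hz) ?_
  filter_upwards [h] with θ hθ
  exact mul_le_mul_of_nonneg_left hθ (poissonKernel_nonneg hz (by simp))

/-- Poisson integrals of integrable functions are harmonic, being real parts of Herglotz
integrals. -/
lemma harmonicOnNhd_poissonIntegral {h : Circle → ℝ}
    (hi : Integrable (fun θ : ℝ => h (Circle.exp θ)) angleMeasure) :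
    InnerProductSpace.HarmonicOnNhd (poissonIntegral h) unitDisk := by
  set hh : ℂ → ℝ := fun ζ => h (Circle.exp (Complex.arg ζ)) with hhd
  have hci : CircleIntegrable hh 0 1 := by
    rw [circleIntegrable_iff_angle]
    simpa only [hhd, circle_extension] using hi
  have hcc : CircleIntegrable (fun ζ => (hh ζ : ℂ)) 0 1 := by
    simp only [CircleIntegrable, intervalIntegrable_iff] at hci ⊢
    exact Complex.ofRealCLM.integrable_comp hci
  have ha := analyticOnNhd_circleAverage_herglotzRieszKernel_smul hcc
  intro z hz
  refine (InnerProductSpace.harmonicAt_congr_nhds ?_).1 (AnalyticAt.harmonicAt_re (ha z hz))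
  filter_upwards [isOpen_unitDisk.mem_nhds hz] with w hw
  rw [re_circleAverage_herglotzRieszKernel_smul hci hw, ← poissonKernel_eq_re_herglotzRieszKernel,
    circleAverage_eq_angle]
  simp only [Pi.smul_apply', smul_eq_mul, hhd, circle_extension]
  rfl

/-- The Poisson formula: a harmonic function is the Poisson integral of its boundary values. -/
lemma poissonIntegral_of_harmonic {k : ℂ → ℝ}
    (hk : InnerProductSpace.HarmonicOnNhd k (Metric.closedBall 0 1)) {z : ℂ} (hz : ‖z‖ < 1) :
    poissonIntegral (fun ζ => k ζ) z = k z := by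
  have := hk.circleAverage_poissonKernel_smul (w := z) (by simpa using hz)
  rw [circleAverage_eq_angle] at this
  rw [← this]
  simp only [poissonIntegral, circleExp_coe, Pi.smul_apply', smul_eq_mul]

lemma poissonIntegral_const (c : ℝ) {z : ℂ} (hz : ‖z‖ < 1) :
    poissonIntegral (fun _ => c) z = c :=
  poissonIntegral_of_harmonic (k := fun _ => c)
    (InnerProductSpace.harmonicOnNhd_const c) hz

lemma poissonIntegral_le {h : Circle → ℝ}
    (hi : Integrable (fun θ : ℝ => h (Circle.exp θ)) angleMeasure) {M : ℝ}
    (h' : ∀ᵐ θ ∂angleMeasure, h (Circle.exp θ) ≤ M) {z : ℂ} (hz : ‖z‖ < 1) :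
    poissonIntegral h z ≤ M :=
  (poissonIntegral_mono hi (integrable_const M) h' hz).trans_eq (poissonIntegral_const M hz)

lemma le_poissonIntegral {h : Circle → ℝ}
    (hi : Integrable (fun θ : ℝ => h (Circle.exp θ)) angleMeasure) {M : ℝ}
    (h' : ∀ᵐ θ ∂angleMeasure, M ≤ h (Circle.exp θ)) {z : ℂ} (hz : ‖z‖ < 1) :
    M ≤ poissonIntegral h z :=
  (poissonIntegral_const M hz).symm.trans_le (poissonIntegral_mono (integrable_const M) hi h' hz)

lemma poissonIntegral_sub {h₁ h₂ : Circle → ℝ}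
    (hi₁ : Integrable (fun θ : ℝ => h₁ (Circle.exp θ)) angleMeasure)
    (hi₂ : Integrable (fun θ : ℝ => h₂ (Circle.exp θ)) angleMeasure) {z : ℂ} (hz : ‖z‖ < 1) :
    poissonIntegral (fun ζ => h₁ ζ - h₂ ζ) z = poissonIntegral h₁ z - poissonIntegral h₂ z := by
  unfold poissonIntegral
  simp_rw [mul_sub (poissonKernel _ _ _)]
  rw [integral_sub (integrable_poissonKernel_mul hi₁ hz) (integrable_poissonKernel_mul hi₂ hz),
    mul_sub]

/-! ### Boundary values of Poisson integrals -/

lemma continuous_comp_circleExp (φ : C(Circle, ℝ)) : Continuous (fun θ : ℝ => φ (Circle.exp θ)) :=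
  φ.continuous.comp Circle.exp.continuous

/-- Radial limits of Poisson integrals of continuous functions. The kernel tested against
`|ζ - ζ₀|² = 2 - 2 Re (ζ ζ̄₀)` is explicit, which controls its concentration at `ζ₀`. -/
lemma tendsto_poissonIntegral_radial (φ : C(Circle, ℝ)) (θ₀ : ℝ) :
    Tendsto (fun r : ℝ => poissonIntegral φ (circleMap 0 r θ₀)) (𝓝[<] 1)
      (𝓝 (φ (Circle.exp θ₀))) := by
  set ζ₀ := Circle.exp θ₀ with hζ₀
  set a : ℂ := starRingEnd ℂ (ζ₀ : ℂ) with ha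
  have hint : ∀ ψ : C(Circle, ℝ), Integrable (fun θ : ℝ => ψ (Circle.exp θ)) angleMeasure :=
    fun ψ => integrable_angle_of_continuous (continuous_comp_circleExp ψ)
  have hharm : ∀ c d : ℝ, InnerProductSpace.HarmonicOnNhd
      (fun z : ℂ => c + d * (2 - 2 * (z * a).re)) (Metric.closedBall 0 1) := fun c d z _ => by
    have h1 : AnalyticAt ℂ (fun z : ℂ => (c : ℂ) + d * (2 - 2 * (z * a))) z := by fun_prop
    have h2 := h1.harmonicAt_re
    refine (InnerProductSpace.harmonicAt_congr_nhds (Eventually.of_forall fun w => ?_)).1 h2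
    simp
  have hval : ∀ r : ℝ, ((circleMap 0 r θ₀) * a).re = r := fun r => by
    have : (ζ₀ : ℂ) * a = 1 := by rw [ha, Complex.mul_conj]; simp
    rw [circleMap_zero_eq, ← circleExp_coe, ← hζ₀, mul_assoc, this]; simp
  have hdist : ∀ ζ : Circle, 2 - 2 * ((ζ : ℂ) * a).re = ‖(ζ : ℂ) - ζ₀‖ ^ 2 := fun ζ => by
    have h1 := Complex.normSq_sub (ζ : ℂ) ζ₀
    rw [Complex.sq_norm, h1]
    simp only [Circle.normSq_coe, ha]; ring
  have hbd : ∀ ζ : Circle, |φ ζ| ≤ ‖φ‖ := fun ζ => φ.norm_coe_le_norm ζ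
  rw [Metric.tendsto_nhds]
  intro ε hε
  obtain ⟨δ, hδ, hδφ⟩ := Metric.continuousAt_iff.1 (φ.continuous.continuousAt (x := ζ₀)) (ε / 2)
    (by positivity)
  -- chosen so that `K |ζ - ζ₀|²` dominates the oscillation of `φ` outside the `δ`-neighbourhood
  set K := 2 * ‖φ‖ / δ ^ 2 with hK
  have hK0 : 0 ≤ K := by positivity
  have hbound : ∀ ζ : Circle, |φ ζ - φ ζ₀| ≤ ε / 2 + K * (2 - 2 * ((ζ : ℂ) * a).re) := fun ζ => by
    rw [hdist]
    by_cases hd : dist ζ ζ₀ < δ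
    · have := hδφ hd
      rw [Real.dist_eq] at this
      have : 0 ≤ K * ‖(ζ : ℂ) - ζ₀‖ ^ 2 := by positivity
      linarith
    · have h1 : δ ≤ ‖(ζ : ℂ) - ζ₀‖ := by
        rw [not_lt] at hd; exact hd.trans_eq (dist_eq_norm (ζ : ℂ) ζ₀)
      have h2 : 2 * ‖φ‖ ≤ K * ‖(ζ : ℂ) - ζ₀‖ ^ 2 := by
        rw [hK, div_mul_eq_mul_div, le_div_iff₀ (by positivity)]
        gcongr
      have h3 := abs_sub (φ ζ) (φ ζ₀)
      linarith [hbd ζ, hbd ζ₀]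
  have hcont : ∀ c d : ℝ, Continuous (fun ζ : Circle => c + d * (2 - 2 * ((ζ : ℂ) * a).re)) :=
    fun c d => by
      have h2 : Continuous (fun ζ : Circle => (ζ : ℂ)) := continuous_subtype_val
      fun_prop
  have hlim : Tendsto (fun r : ℝ => K * (2 - 2 * r)) (𝓝[<] 1) (𝓝 (K * (2 - 2 * 1))) :=
    ((by fun_prop : Continuous fun r : ℝ => K * (2 - 2 * r)).tendsto 1).mono_left nhdsWithin_le_nhds
  rw [mul_one, sub_self, mul_zero] at hlim
  filter_upwards [hlim.eventually_lt_const (show 0 < ε / 2 by positivity),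
    Ioo_mem_nhdsLT (zero_lt_one : (0:ℝ) < 1)] with r hr hr1
  have hz : ‖circleMap 0 r θ₀‖ < 1 := by simp [abs_of_pos hr1.1, hr1.2]
  have hup : poissonIntegral φ (circleMap 0 r θ₀) ≤ (φ ζ₀ + ε / 2) + K * (2 - 2 * r) := by
    have h1 := poissonIntegral_mono (hint φ) (hint ⟨_, hcont (φ ζ₀ + ε / 2) K⟩)
      (Eventually.of_forall fun θ => ?_) hz
    · refine h1.trans_eq ?_
      have := poissonIntegral_of_harmonic (hharm (φ ζ₀ + ε / 2) K) hz
      rw [hval] at this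
      exact this
    · have := abs_le.1 (hbound (Circle.exp θ))
      simp only [ContinuousMap.coe_mk]
      linarith [this.2]
  have hlo : (φ ζ₀ - ε / 2) + (-K) * (2 - 2 * r) ≤ poissonIntegral φ (circleMap 0 r θ₀) := by
    have h1 := poissonIntegral_mono (hint ⟨_, hcont (φ ζ₀ - ε / 2) (-K)⟩) (hint φ)
      (Eventually.of_forall fun θ => ?_) hz
    · refine Eq.trans_le ?_ h1
      have := poissonIntegral_of_harmonic (hharm (φ ζ₀ - ε / 2) (-K)) hz
      rw [hval] at this
      exact this.symm
    · have := abs_le.1 (hbound (Circle.exp θ))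
      simp only [ContinuousMap.coe_mk]
      linarith [this.1]
  rw [Real.dist_eq, abs_lt]
  constructor <;> linarith

lemma poissonKernel_symm (r θ τ : ℝ) :
    poissonKernel 0 (circleMap 0 r θ) (circleMap 0 1 τ)
      = poissonKernel 0 (circleMap 0 r τ) (circleMap 0 1 θ) := by
  simp only [poissonKernel_def, sub_zero, norm_circleMap_zero]
  congr 1
  rw [Complex.sq_norm, Complex.sq_norm, Complex.normSq_sub, Complex.normSq_sub]
  rw [← Complex.sq_norm, ← Complex.sq_norm, ← Complex.sq_norm, ← Complex.sq_norm]
  simp only [norm_circleMap_zero]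
  rw [circleMap_zero_eq r θ, circleMap_zero_eq r τ]
  simp
  ring

lemma poissonKernel_le {r : ℝ} (hr0 : 0 < r) (hr : r < 1) (θ τ : ℝ) :
    ‖poissonKernel 0 (circleMap 0 r θ) (circleMap 0 1 τ)‖ ≤ ((1 - r) ^ 2)⁻¹ := by
  have hz : ‖circleMap 0 r θ‖ < 1 := by simp [abs_of_pos hr0, hr]
  rw [Real.norm_of_nonneg (poissonKernel_nonneg hz (by simp)), poissonKernel_def]
  simp only [sub_zero, norm_circleMap_zero, abs_one, abs_of_pos hr0]
  have h1 := norm_sub_norm_le (circleMap 0 1 τ) (circleMap 0 r θ)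
  simp only [norm_circleMap_zero, abs_one, abs_of_pos hr0] at h1
  have h2 : 0 < 1 - r := by linarith
  rw [inv_eq_one_div]
  gcongr
  nlinarith

/-- Bounded boundary data are attained by their Poisson integral in the weak-* sense. -/
lemma hasWeakBoundaryValues_poissonIntegral {h : Circle → ℝ} (hh : IsBoundaryLInfty h) :
    HasWeakBoundaryValues (poissonIntegral h) h := by
  have hi := integrable_of_boundaryLInfty hh
  have hcont := (harmonicOnNhd_poissonIntegral hi).continuousOn
  have h01 := Ioo_mem_nhdsLT (zero_lt_one : (0:ℝ) < 1)
  refine ⟨?_, fun φ => ?_⟩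
  · filter_upwards [h01] with r hr
    refine integrable_angle_of_continuous
      (hcont.comp_continuous (continuous_circleMap 0 r) fun θ => ?_)
    simp [abs_of_pos hr.1, hr.2]
  have hφc := continuous_comp_circleExp φ
  have hφi := integrable_angle_of_continuous hφc
  have hbd : ∀ ζ : Circle, |φ ζ| ≤ ‖φ‖ := fun ζ => φ.norm_coe_le_norm ζ
  -- by symmetry of the kernel the pairing can be computed on the test function
  have hswap : ∀ r ∈ Set.Ioo (0 : ℝ) 1,
      ∫ θ, φ (Circle.exp θ) * poissonIntegral h (circleMap 0 r θ) ∂angleMeasure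
        = ∫ τ, poissonIntegral φ (circleMap 0 r τ) * h (Circle.exp τ) ∂angleMeasure := by
    intro r hr
    have hp : Integrable (fun p : ℝ × ℝ => poissonKernel 0 (circleMap 0 r p.1) (circleMap 0 1 p.2)
        * (φ (Circle.exp p.1) * h (Circle.exp p.2))) (angleMeasure.prod angleMeasure) := by
      refine (hφi.mul_prod hi).bdd_mul (c := ((1 - r) ^ 2)⁻¹) ?_
        (Eventually.of_forall fun p => poissonKernel_le hr.1 hr.2 _ _)
      have h1 := (continuous_circleMap 0 r).comp (continuous_fst (X := ℝ) (Y := ℝ))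
      have h2 := (continuous_circleMap 0 1).comp (continuous_snd (X := ℝ) (Y := ℝ))
      simp only [poissonKernel_def]
      refine Measurable.aestronglyMeasurable ?_
      have h1 := h1.measurable
      have h2 := h2.measurable
      simp only [Function.comp_def] at h1 h2
      fun_prop
    calc _ = (2 * π)⁻¹ * ∫ θ, (∫ τ, poissonKernel 0 (circleMap 0 r θ) (circleMap 0 1 τ)
        * (φ (Circle.exp θ) * h (Circle.exp τ)) ∂angleMeasure) ∂angleMeasure := by
          rw [← integral_const_mul]
          refine integral_congr_ae (Eventually.of_forall fun θ => ?_)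
          simp only [poissonIntegral]
          rw [mul_left_comm, ← integral_const_mul]
          congr 2; funext τ; ring
      _ = (2 * π)⁻¹ * ∫ τ, (∫ θ, poissonKernel 0 (circleMap 0 r θ) (circleMap 0 1 τ)
        * (φ (Circle.exp θ) * h (Circle.exp τ)) ∂angleMeasure) ∂angleMeasure := by
          rw [integral_integral_swap hp]
      _ = _ := by
          rw [← integral_const_mul]
          refine integral_congr_ae (Eventually.of_forall fun τ => ?_)
          simp only [poissonIntegral]
          rw [mul_assoc, ← integral_mul_const]
          congr 2; funext θ
          rw [poissonKernel_symm]; ring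
  have hle : ∀ r ∈ Set.Ioo (0 : ℝ) 1, ∀ τ, |poissonIntegral φ (circleMap 0 r τ)| ≤ ‖φ‖ :=
    fun r hr τ => by
      have hz : ‖circleMap 0 r τ‖ < 1 := by simp [abs_of_pos hr.1, hr.2]
      rw [abs_le]
      exact ⟨le_poissonIntegral hφi (Eventually.of_forall fun θ => (abs_le.1 (hbd _)).1) hz,
        poissonIntegral_le hφi (Eventually.of_forall fun θ => (abs_le.1 (hbd _)).2) hz⟩
  have hmain : Tendsto (fun r : ℝ => ∫ τ, poissonIntegral φ (circleMap 0 r τ) * h (Circle.exp τ)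
      ∂angleMeasure) (𝓝[<] 1) (𝓝 (∫ τ, φ (Circle.exp τ) * h (Circle.exp τ) ∂angleMeasure)) := by
    refine tendsto_integral_filter_of_dominated_convergence
      (fun τ => ‖φ‖ * ‖h (Circle.exp τ)‖) ?_ ?_ (hi.norm.const_mul _) ?_
    · filter_upwards [h01] with r hr
      refine Continuous.aestronglyMeasurable ?_ |>.mul hi.1
      refine (harmonicOnNhd_poissonIntegral hφi).continuousOn.comp_continuous
        (continuous_circleMap 0 r) fun θ => ?_
      simp [abs_of_pos hr.1, hr.2]
    · filter_upwards [h01] with r hr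
      refine Eventually.of_forall fun τ => ?_
      rw [norm_mul]
      exact mul_le_mul_of_nonneg_right (hle r hr τ) (norm_nonneg _)
    · exact Eventually.of_forall fun τ => (tendsto_poissonIntegral_radial φ τ).mul_const _
  refine hmain.congr' ?_
  filter_upwards [h01] with r hr
  rw [hswap r hr]

/-! ### Comparison principles -/

/-- Maximum principle for a continuous function that satisfies the sub-mean value inequality where
it is positive and is asymptotically nonpositive at the boundary. -/
lemma nonpos_of_subharmonic_where_pos {w : ℂ → ℝ} (hc : ContinuousOn w unitDisk)
    (hb : ∀ ε > 0, ∃ ρ < 1, ∀ z ∈ unitDisk, ρ ≤ ‖z‖ → w z ≤ ε)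
    (hs : ∀ z ∈ unitDisk, 0 < w z → ∀ᶠ r in 𝓝[>] (0 : ℝ), w z ≤ Real.circleAverage w z r) :
    ∀ z ∈ unitDisk, w z ≤ 0 := by
  by_contra! hcon
  obtain ⟨z₁, hz₁, hw₁⟩ := hcon
  obtain ⟨ρ₀, hρ₀, hb⟩ := hb (w z₁ / 2) (by positivity)
  set ρ := max ρ₀ ‖z₁‖ with hρ
  have hρ1 : ρ < 1 := max_lt hρ₀ (mem_unitDisk.1 hz₁)
  have hsub : Metric.closedBall (0 : ℂ) ρ ⊆ unitDisk := Metric.closedBall_subset_ball hρ1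
  have hcK := hc.mono hsub
  have hz₁K : z₁ ∈ Metric.closedBall (0 : ℂ) ρ := by simp [hρ]
  obtain ⟨z₂, hz₂, hmax⟩ := (isCompact_closedBall (0 : ℂ) ρ).exists_isMaxOn ⟨z₁, hz₁K⟩ hcK
  have hM : w z₁ ≤ w z₂ := hmax hz₁K
  -- among the maximum points pick one farthest from the origin
  have hS : IsCompact (Metric.closedBall (0 : ℂ) ρ ∩ w ⁻¹' {w z₂}) :=
    (isCompact_closedBall (0 : ℂ) ρ).of_isClosed_subset
      (hcK.preimage_isClosed_of_isClosed Metric.isClosed_closedBall isClosed_singleton)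
      Set.inter_subset_left
  obtain ⟨z, ⟨hzK, hzw⟩, hfar⟩ := hS.exists_isMaxOn ⟨z₂, hz₂, rfl⟩ continuous_norm.continuousOn
  have hzw : w z = w z₂ := hzw
  have hzD := hsub hzK
  have hle : ∀ x ∈ unitDisk, w x ≤ w z := fun x hx => by
    rw [hzw]
    rcases le_total ‖x‖ ρ with h | h
    · exact hmax (show x ∈ Metric.closedBall (0 : ℂ) ρ by simpa using h)
    · have := hb x hx ((le_max_left _ _).trans h)
      linarith
  have hlt : ∀ x ∈ unitDisk, ‖z‖ < ‖x‖ → w x < w z := fun x hx hzx => by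
    refine lt_of_le_of_ne (hle x hx) fun he => ?_
    rcases le_total ‖x‖ ρ with h | h
    · have : ‖x‖ ≤ ‖z‖ := hfar ⟨show x ∈ Metric.closedBall (0 : ℂ) ρ by simpa using h, by
        rw [Set.mem_preimage, he, hzw]; rfl⟩
      linarith
    · have := hb x hx ((le_max_left _ _).trans h)
      linarith
  have hr := hs z hzD (by linarith)
  obtain ⟨d, hd0, hd⟩ := Metric.isOpen_iff.1 isOpen_unitDisk z hzD
  obtain ⟨r, hrw, hr0, hrd⟩ := (hr.and (Ioo_mem_nhdsGT hd0)).exists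
  have hcirc : ∀ θ, circleMap z r θ ∈ unitDisk := fun θ => hd (by
    rw [Metric.mem_ball, dist_eq_norm]; simp [circleMap, abs_of_pos hr0, hrd])
  have hcont : Continuous fun θ => w (circleMap z r θ) :=
    hc.comp_continuous (continuous_circleMap z r) hcirc
  -- the circle around that point contains a point farther out
  obtain ⟨θ₀, hθ₀, hfarther⟩ : ∃ θ₀ ∈ Set.Icc 0 (2 * π), ‖z‖ < ‖circleMap z r θ₀‖ := by
    by_contra! hcon
    have h1 := hcon 0 ⟨le_rfl, by positivity⟩
    have h2 := hcon π ⟨Real.pi_pos.le, by linarith [Real.pi_pos]⟩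
    have e1 : circleMap z r 0 = z + r := by simp [circleMap]
    have e2 : circleMap z r π = z - r := by simp [circleMap, Complex.exp_pi_mul_I, sub_eq_add_neg]
    rw [e1] at h1; rw [e2] at h2
    have h3 := parallelogram_law_with_norm ℝ z (r : ℂ)
    have h4 : ‖(r : ℂ)‖ = r := by simp [abs_of_pos hr0]
    rw [h4] at h3
    nlinarith [norm_nonneg z, norm_nonneg (z + r), norm_nonneg (z - r)]
  have hstrict := intervalIntegral.integral_lt_integral_of_continuousOn_of_le_of_exists_lt
    (f := fun θ => w (circleMap z r θ)) (g := fun _ => w z) (a := 0) (b := 2 * π) (by positivity)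
    hcont.continuousOn continuousOn_const (fun θ _ => hle _ (hcirc θ))
    ⟨θ₀, hθ₀, hlt _ (hcirc θ₀) hfarther⟩
  rw [Real.circleAverage_def, smul_eq_mul, le_inv_mul_iff₀ (by positivity)] at hrw
  simp only [intervalIntegral.integral_const, smul_eq_mul, sub_zero] at hstrict
  linarith

lemma greenPotential_mono {f g : ℂ → ℝ} {z : ℂ}
    (hf : IntegrableOn (fun ζ => greenKernel z ζ * f ζ) unitDisk)
    (hg : IntegrableOn (fun ζ => greenKernel z ζ * g ζ) unitDisk)
    (h : ∀ᵐ ζ ∂(volume.restrict unitDisk), f ζ ≤ g ζ) :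
    greenPotential f z ≤ greenPotential g z := by
  refine mul_le_mul_of_nonneg_left (integral_mono_ae hf hg ?_) (by positivity)
  filter_upwards [h] with ζ hζ
  exact mul_le_mul_of_nonneg_left hζ (greenKernel_nonneg _ _)

/-- Dominated convergence for Green potentials. -/
lemma tendsto_greenPotential {F : ℕ → ℂ → ℝ} {f g : ℂ → ℝ} {z : ℂ}
    (hF : ∀ n, AEStronglyMeasurable (F n) (volume.restrict unitDisk))
    (hg : IntegrableOn (fun ζ => greenKernel z ζ * g ζ) unitDisk)
    (hb : ∀ n, ∀ ζ ∈ unitDisk, |F n ζ| ≤ g ζ)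
    (hlim : ∀ ζ ∈ unitDisk, Tendsto (fun n => F n ζ) atTop (𝓝 (f ζ))) :
    Tendsto (fun n => greenPotential (F n) z) atTop (𝓝 (greenPotential f z)) := by
  refine (tendsto_integral_of_dominated_convergence _ (fun n =>
    (measurable_greenKernel_right z).aestronglyMeasurable.mul (hF n)) hg
    (fun n => ?_) ?_).const_mul _
  · refine (ae_restrict_iff' measurableSet_unitDisk).2 (Eventually.of_forall fun ζ hζ => ?_)
    rw [Pi.mul_apply, norm_mul, Real.norm_of_nonneg (greenKernel_nonneg _ _)]
    exact mul_le_mul_of_nonneg_left (hb n ζ hζ) (greenKernel_nonneg _ _)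
  · exact (ae_restrict_iff' measurableSet_unitDisk).2 (Eventually.of_forall fun ζ hζ =>
      (hlim ζ hζ).const_mul _)

/-- Comparison principle: if `k ≤ 0` is harmonic and `F ≥ 0` almost everywhere on the set where
`k - G F` is positive, then that set is empty. The negative part of `F` is cut off near the
boundary, so that the resulting subsolution is asymptotically nonpositive there and the maximum
principle applies. -/
theorem harmonic_le_greenPotential {k F : ℂ → ℝ}
    (hk : InnerProductSpace.HarmonicOnNhd k unitDisk) (hk0 : ∀ z ∈ unitDisk, k z ≤ 0)
    (hF : WeightedIntegrable F) (hFb : BoundedOnSmallerDisks F)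
    (hpos : ∀ᵐ z, z ∈ unitDisk → greenPotential F z < k z → 0 ≤ F z) :
    ∀ z ∈ unitDisk, k z ≤ greenPotential F z := by
  classical
  set ρ : ℕ → ℝ := fun n => 1 - 1 / ((n : ℝ) + 1) with hρ
  have hρ1 : ∀ n, ρ n < 1 := fun n => by
    simp only [hρ]
    linarith [show 0 < 1 / ((n : ℝ) + 1) by positivity]
  set Fn : ℕ → ℂ → ℝ := fun n =>
    (Metric.closedBall 0 (ρ n)).piecewise F (fun z => max (F z) 0) with hFn
  have hm : ∀ n, MeasurableSet (Metric.closedBall (0 : ℂ) (ρ n)) := fun n =>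
    Metric.isClosed_closedBall.measurableSet
  have hFnm : ∀ n, AEStronglyMeasurable (Fn n) (volume.restrict unitDisk) := fun n =>
    AEStronglyMeasurable.piecewise (hm n)
      (hF.aestronglyMeasurable.mono_measure Measure.restrict_le_self)
      ((hF.aestronglyMeasurable.sup aestronglyMeasurable_const).mono_measure
        Measure.restrict_le_self)
  have hFnabs : ∀ n z, |Fn n z| ≤ |F z| := fun n z => by
    by_cases hz : z ∈ Metric.closedBall (0 : ℂ) (ρ n)
    · simp [hFn, hz]
    · simp only [hFn, Set.piecewise, hz, if_false]
      rw [abs_of_nonneg (le_max_right _ _)]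
      exact max_le (le_abs_self _) (abs_nonneg _)
  have hFFn : ∀ n z, F z ≤ Fn n z := fun n z => by
    by_cases hz : z ∈ Metric.closedBall (0 : ℂ) (ρ n) <;> simp [hFn, hz]
  have hFnpos : ∀ n z, 0 ≤ F z → 0 ≤ Fn n z := fun n z h => h.trans (hFFn n z)
  have hFnw : ∀ n, WeightedIntegrable (Fn n) := fun n => hF.mono (hFnm n) fun z _ => hFnabs n z
  have hFnb : ∀ n, BoundedOnSmallerDisks (Fn n) := fun n r hr => by
    obtain ⟨C, hC⟩ := hFb r hr
    exact ⟨C, fun z hz => (hFnabs n z).trans (hC z hz)⟩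
  have hint := integrable_greenKernel_mul hF hFb
  have hintn := fun n => integrable_greenKernel_mul (hFnw n) (hFnb n)
  have hGG : ∀ n z, greenPotential F z ≤ greenPotential (Fn n) z := fun n z =>
    greenPotential_mono (hint z) (hintn n z) (Eventually.of_forall (hFFn n))
  have key : ∀ n, ∀ z ∈ unitDisk, k z - greenPotential (Fn n) z ≤ 0 := by
    intro n
    refine nonpos_of_subharmonic_where_pos
      (hk.continuousOn.sub (continuousOn_greenPotential (hFnw n) (hFnb n))) ?_ ?_
    -- `F_n` dominates the bounded density `-|F| 1_{|z| ≤ ρ_n}`, whose potential vanishes at the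
    -- boundary
    · intro ε hε
      obtain ⟨C, hC0, hC⟩ := hFb.exists_bound (hρ1 n)
      set N : ℂ → ℝ := (Metric.closedBall (0 : ℂ) (ρ n)).indicator (fun z => -|F z|) with hN
      have hNb : ∀ z, |N z| ≤ C := indicator_bound hC0 (fun z hz => by simpa using hC z hz)
      have hNm : AEStronglyMeasurable N (volume.restrict unitDisk) :=
        hF.aestronglyMeasurable.norm.neg.indicator (hm n)
      have hNF : ∀ z, N z ≤ Fn n z := fun z => by
        by_cases hz : z ∈ Metric.closedBall (0 : ℂ) (ρ n)
        · simp only [hN, hFn, Set.piecewise, hz, Set.indicator_of_mem, if_true]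
          exact neg_abs_le _
        · simp [hN, hFn, hz]
      have hcont : Continuous fun r : ℝ => 2 * C * √(max 0 (1 - r ^ 2)) := by fun_prop
      have hlim : Tendsto (fun r : ℝ => 2 * C * √(max 0 (1 - r ^ 2))) (𝓝 1) (𝓝 0) := by
        have := hcont.tendsto 1
        simpa using this
      obtain ⟨δ, hδ, hlt⟩ := Metric.eventually_nhds_iff.1 (hlim.eventually_lt_const hε)
      refine ⟨1 - δ / 2, by linarith, fun z hz hzρ => ?_⟩
      have h1 := hlt (y := ‖z‖) (by
        have := mem_unitDisk.1 hz
        rw [Real.dist_eq, abs_lt]; constructor <;> linarith)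
      have h2 := abs_greenPotential_le hC0 (fun z _ => hNb z) z
      have h3 := greenPotential_mono (z := z)
        (integrable_greenKernel_mul_of_bounded hNm (fun z _ => hNb z) z)
        (hintn n z) (Eventually.of_forall hNF)
      have h4 := neg_abs_le (greenPotential N z)
      linarith [hk0 z hz]
    -- where `k - G F_n > 0` also `k - G F > 0`, hence `F_n ≥ F ≥ 0` and `G F_n` is superharmonic
    · intro z hz hwz
      have hopen : IsOpen {x ∈ unitDisk | 0 < k x - greenPotential F x} :=
        (hk.continuousOn.sub (continuousOn_greenPotential hF hFb)).isOpen_inter_preimage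
          isOpen_unitDisk isOpen_Ioi
      have hmem : z ∈ {x ∈ unitDisk | 0 < k x - greenPotential F x} :=
        ⟨hz, by linarith [hGG n z]⟩
      obtain ⟨d, hd0, hd⟩ := Metric.isOpen_iff.1 hopen z hmem
      filter_upwards [Ioo_mem_nhdsGT hd0] with r hr
      have hcb : Metric.closedBall z r ⊆ {x ∈ unitDisk | 0 < k x - greenPotential F x} :=
        (Metric.closedBall_subset_ball hr.2).trans hd
      have hcb' : Metric.closedBall z r ⊆ unitDisk := fun x hx => (hcb hx).1
      have hsph : Metric.sphere z |r| ⊆ unitDisk := by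
        rw [abs_of_pos hr.1]; exact Metric.sphere_subset_closedBall.trans hcb'
      have h1 := circleAverage_greenPotential_le (hFnw n) (hFnb n) hr.1 hcb' (by
        filter_upwards [hpos] with x hx hxb
        have := hcb (Metric.ball_subset_closedBall hxb)
        exact hFnpos n x (hx this.1 (by linarith [this.2])))
      have h2 : Real.circleAverage k z r = k z :=
        InnerProductSpace.HarmonicOnNhd.circleAverage_eq (hk.mono (by rwa [abs_of_pos hr.1]))
      rw [Real.circleAverage_fun_sub (hk.continuousOn.mono hsph).circleIntegrable'
        ((continuousOn_greenPotential (hFnw n) (hFnb n)).mono hsph).circleIntegrable', h2]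
      linarith
  intro z hz
  have hlim : Tendsto (fun n => greenPotential (Fn n) z) atTop (𝓝 (greenPotential F z)) := by
    refine tendsto_greenPotential (g := fun ζ => |F ζ|) hFnm ?_ (fun n ζ _ => hFnabs n ζ)
      fun ζ hζ => ?_
    · refine Integrable.congr (hint z).norm (Eventually.of_forall fun ζ => ?_)
      simp [abs_of_nonneg (greenKernel_nonneg _ _)]
    · refine tendsto_const_nhds.congr' ?_
      have h1 : Tendsto ρ atTop (𝓝 (1 - 0)) :=
        tendsto_const_nhds.sub tendsto_one_div_add_atTop_nhds_zero_nat
      rw [sub_zero] at h1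
      filter_upwards [h1.eventually_const_lt (mem_unitDisk.1 hζ)] with n hn
      have : ζ ∈ Metric.closedBall (0 : ℂ) (ρ n) := by simpa using hn.le
      simp [hFn, this]
  exact ge_of_tendsto hlim (Eventually.of_forall fun n => by linarith [key n z hz])

/-! ### Solving `v = G (a e^{-2v})` -/

section BoundedCoefficient

open scoped BoundedContinuousFunction

/-- The decreasing nonlinearity `s ↦ e^{-2 max(s, 0)}`; it is Lipschitz and agrees with `e^{-2s}`
for `s ≥ 0`. -/
noncomputable def truncExp (s : ℝ) : ℝ := Real.exp (-2 * max s 0)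

lemma antitone_truncExp : Antitone truncExp := fun s t h => by
  unfold truncExp
  have := max_le_max_right 0 h
  exact Real.exp_le_exp.2 (by linarith)

lemma truncExp_pos (s : ℝ) : 0 < truncExp s := Real.exp_pos _

lemma lipschitzWith_truncExp : LipschitzWith 2 truncExp := by
  have key : ∀ s t : ℝ, s ≤ t → truncExp s - truncExp t ≤ 2 * (t - s) := fun s t h => by
    unfold truncExp
    have h1 : max t 0 - max s 0 ≤ t - s := by
      rw [sub_le_iff_le_add, max_le_iff]
      constructor <;> linarith [le_max_left s 0, le_max_right s 0]
    have h2 := Real.add_one_le_exp (-2 * (max t 0 - max s 0))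
    have h3 : Real.exp (-2 * max t 0)
        = Real.exp (-2 * max s 0) * Real.exp (-2 * (max t 0 - max s 0)) := by
      rw [← Real.exp_add]; ring_nf
    have h4 : Real.exp (-2 * max s 0) ≤ 1 := by
      rw [Real.exp_le_one_iff]; linarith [le_max_right s 0]
    have h5 := Real.exp_pos (-2 * max s 0)
    have h6 := max_le_max_right 0 h
    rw [h3]
    nlinarith
  refine LipschitzWith.of_dist_le_mul fun s t => ?_
  rw [Real.dist_eq, Real.dist_eq]
  simp only [NNReal.coe_ofNat]
  rcases le_total s t with h | h
  · have := antitone_truncExp h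
    rw [abs_of_nonneg (by linarith), abs_of_nonpos (by linarith : s - t ≤ 0)]
    linarith [key s t h]
  · have := antitone_truncExp h
    rw [abs_of_nonpos (by linarith), abs_of_nonneg (by linarith : 0 ≤ s - t)]
    linarith [key t s h]

variable {a : ℂ → ℝ} {A : ℝ}

lemma bound_mul_bcf (hA : ∀ z ∈ unitDisk, |a z| ≤ A) (c : ℂ →ᵇ ℝ) :
    ∀ z ∈ unitDisk, |a z * c z| ≤ A * ‖c‖ := fun z hz => by
  rw [abs_mul]
  exact mul_le_mul (hA z hz) (c.norm_coe_le_norm z) (abs_nonneg _) ((abs_nonneg _).trans (hA z hz))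

lemma bound_nonneg (hA : ∀ z ∈ unitDisk, |a z| ≤ A) : 0 ≤ A :=
  (abs_nonneg _).trans (hA 0 (by simp))

lemma abs_greenPotential_mul_bcf_le (hA : ∀ z ∈ unitDisk, |a z| ≤ A) (c : ℂ →ᵇ ℝ) (z : ℂ) :
    ‖greenPotential (fun ζ => a ζ * c ζ) z‖ ≤ 2 * A * ‖c‖ := by
  have hA0 := bound_nonneg hA
  have h1 := abs_greenPotential_le (mul_nonneg hA0 (norm_nonneg c)) (bound_mul_bcf hA c) z
  have h2 : √(max 0 (1 - ‖z‖ ^ 2)) ≤ 1 := by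
    rw [Real.sqrt_le_one]
    exact max_le zero_le_one (by nlinarith [norm_nonneg z])
  calc _ ≤ _ := h1
    _ ≤ 2 * (A * ‖c‖) * 1 := by gcongr
    _ = _ := by ring

/-- The operator `c ↦ G (a c)` on bounded continuous functions. -/
noncomputable def greenOperator (ham : AEStronglyMeasurable a (volume.restrict unitDisk))
    (hA : ∀ z ∈ unitDisk, |a z| ≤ A) (c : ℂ →ᵇ ℝ) : ℂ →ᵇ ℝ :=
  BoundedContinuousFunction.ofNormedAddCommGroup (greenPotential (fun ζ => a ζ * c ζ))
    (continuous_greenPotential (mul_nonneg (bound_nonneg hA) (norm_nonneg c))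
      (ham.mul c.continuous.aestronglyMeasurable) (bound_mul_bcf hA c)) (2 * A * ‖c‖)
    (abs_greenPotential_mul_bcf_le hA c)

variable (ham : AEStronglyMeasurable a (volume.restrict unitDisk))
  (hA : ∀ z ∈ unitDisk, |a z| ≤ A)

lemma greenOperator_apply (c : ℂ →ᵇ ℝ) (z : ℂ) :
    greenOperator ham hA c z = greenPotential (fun ζ => a ζ * c ζ) z := rfl

lemma greenOperator_sub_apply (c₁ c₂ : ℂ →ᵇ ℝ) (z : ℂ) :
    greenOperator ham hA c₁ z - greenOperator ham hA c₂ z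
      = greenPotential (fun ζ => a ζ * (c₁ - c₂) ζ) z := by
  rw [greenOperator_apply, greenOperator_apply, ← greenPotential_sub]
  · simp [mul_sub]
  · exact integrable_greenKernel_mul_of_bounded (ham.mul c₁.continuous.aestronglyMeasurable)
      (bound_mul_bcf hA c₁) z
  · exact integrable_greenKernel_mul_of_bounded (ham.mul c₂.continuous.aestronglyMeasurable)
      (bound_mul_bcf hA c₂) z

lemma dist_greenOperator_le (c₁ c₂ : ℂ →ᵇ ℝ) :
    dist (greenOperator ham hA c₁) (greenOperator ham hA c₂) ≤ 2 * A * dist c₁ c₂ := by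
  have hA0 := bound_nonneg hA
  rw [BoundedContinuousFunction.dist_le (by positivity)]
  intro z
  rw [dist_eq_norm, dist_eq_norm, greenOperator_sub_apply]
  exact abs_greenPotential_mul_bcf_le hA _ z

/-- The composition of the nonlinearity with a bounded continuous function. -/
noncomputable def truncExpComp (v : ℂ →ᵇ ℝ) : ℂ →ᵇ ℝ :=
  BoundedContinuousFunction.comp truncExp lipschitzWith_truncExp v

lemma dist_truncExpComp_le (v₁ v₂ : ℂ →ᵇ ℝ) :
    dist (truncExpComp v₁) (truncExpComp v₂) ≤ 2 * dist v₁ v₂ :=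
  (BoundedContinuousFunction.lipschitz_comp lipschitzWith_truncExp).dist_le_mul v₁ v₂

/-- Stability of `v = t G (a φ(v)) + y` under perturbations of `y`, uniformly in `t ≥ 0`: since
`φ = truncExp` is decreasing, the comparison principle bounds the potential part of the
difference. -/
lemma sub_le_of_solutions (ha : ∀ z ∈ unitDisk, 0 ≤ a z) {t : ℝ} (ht : 0 ≤ t)
    {v₁ v₂ y₁ y₂ : ℂ →ᵇ ℝ} (h₁ : v₁ = t • greenOperator ham hA (truncExpComp v₁) + y₁)
    (h₂ : v₂ = t • greenOperator ham hA (truncExpComp v₂) + y₂) (z : ℂ) :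
    v₁ z - v₂ z ≤ 2 * dist y₁ y₂ := by
  set c := t • (truncExpComp v₂ - truncExpComp v₁) with hc
  have hp : ∀ z, v₁ z - v₂ z = y₁ z - y₂ z - greenPotential (fun ζ => a ζ * c ζ) z := fun z => by
    have e1 := congrArg (fun f : ℂ →ᵇ ℝ => f z) h₁
    have e2 := congrArg (fun f : ℂ →ᵇ ℝ => f z) h₂
    simp only [BoundedContinuousFunction.coe_add, BoundedContinuousFunction.coe_smul, Pi.add_apply,
      smul_eq_mul] at e1 e2
    have e3 : greenPotential (fun ζ => a ζ * c ζ) z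
        = t * greenPotential (fun ζ => a ζ * (truncExpComp v₂ - truncExpComp v₁) ζ) z := by
      simp only [greenPotential, hc, BoundedContinuousFunction.coe_smul, smul_eq_mul]
      have h3 : ∀ x ζ : ℂ, ∀ b : ℝ, greenKernel x ζ * (a ζ * (t * b))
          = t * (greenKernel x ζ * (a ζ * b)) := fun x ζ b => by ring
      simp only [h3]
      rw [integral_const_mul]
      ring
    rw [e3, ← greenOperator_sub_apply ham hA]
    linarith
  have hy : ∀ z, y₁ z - y₂ z ≤ dist y₁ y₂ := fun z =>
    (le_abs_self _).trans (by
      rw [← Real.dist_eq]; exact BoundedContinuousFunction.dist_coe_le_dist z)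
  have hpos : ∀ z ∈ unitDisk, greenPotential (fun ζ => a ζ * c ζ) z < -dist y₁ y₂ →
      0 ≤ a z * c z := fun z hz hlt => by
    refine mul_nonneg (ha z hz) (mul_nonneg ht (sub_nonneg.2 ?_))
    have hy' : -(y₁ z - y₂ z) ≤ dist y₁ y₂ :=
      (neg_le_abs _).trans (by
        rw [← Real.dist_eq]; exact BoundedContinuousFunction.dist_coe_le_dist z)
    exact antitone_truncExp (by linarith [hp z])
  have hcm := ham.mul c.continuous.aestronglyMeasurable
  have hb := bound_mul_bcf hA c
  by_cases hz : z ∈ unitDisk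
  · -- the comparison principle needs a density that is bounded on all of the disk only
    have hind : ∀ z, |unitDisk.indicator (fun ζ => a ζ * c ζ) z| ≤ A * ‖c‖ :=
      indicator_bound (mul_nonneg (bound_nonneg hA) (norm_nonneg c)) hb
    have hcongr : (fun ζ => a ζ * c ζ) =ᵐ[volume.restrict unitDisk]
        unitDisk.indicator (fun ζ => a ζ * c ζ) := by
      filter_upwards [ae_restrict_mem measurableSet_unitDisk] with ζ hζ
      simp [hζ]
    have hG := greenPotential_congr hcongr
    have hcm' := hcm.congr hcongr
    have := harmonic_le_greenPotential (k := fun _ => -dist y₁ y₂)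
      (InnerProductSpace.harmonicOnNhd_const _) (fun _ _ => by simp)
      (weightedIntegrable_of_bounded hcm' fun z _ => hind z) (fun _ _ => ⟨_, fun z _ => hind z⟩)
      (Eventually.of_forall fun ζ hζ hlt => by
        rw [← hG] at hlt
        rw [Set.indicator_of_mem hζ]
        exact hpos ζ hζ hlt) z hz
    rw [← hG] at this
    linarith [hp z, hy z]
  · have h0 : greenPotential (fun ζ => a ζ * c ζ) z = 0 := by
      simp [greenPotential, greenKernel_eq_zero (not_lt.1 fun h => hz (mem_unitDisk.2 h))]
    have := dist_nonneg (x := y₁) (y := y₂)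
    linarith [hp z, hy z]

lemma dist_le_of_solutions (ha : ∀ z ∈ unitDisk, 0 ≤ a z) {t : ℝ} (ht : 0 ≤ t)
    {v₁ v₂ y₁ y₂ : ℂ →ᵇ ℝ} (h₁ : v₁ = t • greenOperator ham hA (truncExpComp v₁) + y₁)
    (h₂ : v₂ = t • greenOperator ham hA (truncExpComp v₂) + y₂) :
    dist v₁ v₂ ≤ 2 * dist y₁ y₂ := by
  rw [BoundedContinuousFunction.dist_le (by positivity)]
  intro z
  rw [Real.dist_eq, abs_le]
  have h3 := sub_le_of_solutions ham hA ha ht h₁ h₂ z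
  have h4 := sub_le_of_solutions ham hA ha ht h₂ h₁ z
  rw [dist_comm y₂] at h4
  constructor <;> linarith

/-- Method of continuity: `v = t G (a φ(v)) + y` is solvable for every `t ≥ 0`, in particular for
`t = 1` and `y = 0`. The uniform stability estimate makes each step of fixed length a
contraction. -/
lemma exists_solution_truncExp (ha : ∀ z ∈ unitDisk, 0 ≤ a z) :
    ∃ v : ℂ →ᵇ ℝ, v = greenOperator ham hA (truncExpComp v) := by
  have hA0 := bound_nonneg hA
  -- one step is a contraction with constant `8 A δ`: `2` from stability, `2 A` from
  -- `greenOperator`, `2` from `truncExp`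
  set N : ℕ := ⌈16 * A⌉₊ + 1 with hN
  have hN0 : (0 : ℝ) < N := by positivity
  have hNA : 16 * A ≤ N := (Nat.le_ceil _).trans (by rw [hN]; push_cast; linarith)
  set δ : ℝ := 1 / N with hδ
  have hδ0 : 0 < δ := by positivity
  have hδA : 8 * A * δ ≤ 1 / 2 := by
    rw [hδ, mul_one_div, div_le_iff₀ hN0]; linarith
  have claim : ∀ n : ℕ, ∀ y : ℂ →ᵇ ℝ, ∃ v : ℂ →ᵇ ℝ,
      v = (n * δ) • greenOperator ham hA (truncExpComp v) + y := by
    intro n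
    induction n with
    | zero => intro y; exact ⟨y, by simp⟩
    | succ n ih =>
      intro y
      choose S hS using ih
      -- `S` solves the problem for `n δ`; the extra `δ G (a φ(v))` is moved into the inhomogeneity
      have hcontr : ContractingWith (1 / 2)
          (fun v => S (y + δ • greenOperator ham hA (truncExpComp v))) := by
        refine ⟨by rw [← NNReal.coe_lt_coe]; norm_num, LipschitzWith.of_dist_le_mul fun v₁ v₂ => ?_⟩
        have h1 := dist_le_of_solutions ham hA ha (t := n * δ) (by positivity)
          (hS (y + δ • greenOperator ham hA (truncExpComp v₁)))
          (hS (y + δ • greenOperator ham hA (truncExpComp v₂)))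
        rw [dist_add_left] at h1
        have h5 : ∀ x y : ℂ →ᵇ ℝ, dist (δ • x) (δ • y) ≤ δ * dist x y := fun x y => by
          rw [BoundedContinuousFunction.dist_le (by positivity)]
          intro z
          simp only [BoundedContinuousFunction.coe_smul, Real.dist_eq, smul_eq_mul, ← mul_sub,
            abs_mul, abs_of_pos hδ0]
          gcongr
          rw [← Real.dist_eq]
          exact BoundedContinuousFunction.dist_coe_le_dist z
        have h2 := dist_greenOperator_le ham hA (truncExpComp v₁) (truncExpComp v₂)
        have h3 := dist_truncExpComp_le v₁ v₂
        have h4 : dist (greenOperator ham hA (truncExpComp v₁))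
            (greenOperator ham hA (truncExpComp v₂)) ≤ 2 * A * (2 * dist v₁ v₂) :=
          h2.trans (by gcongr)
        calc _ ≤ _ := h1
          _ ≤ 2 * (δ * (2 * A * (2 * dist v₁ v₂))) := by
            gcongr
            exact (h5 _ _).trans (by gcongr)
          _ = 8 * A * δ * dist v₁ v₂ := by ring
          _ ≤ 1 / 2 * dist v₁ v₂ := by gcongr
          _ = _ := by norm_num
      have hfix := hcontr.fixedPoint_isFixedPt
      set v := hcontr.fixedPoint
      refine ⟨v, ?_⟩
      have h5 : S (y + δ • greenOperator ham hA (truncExpComp v)) = v := hfix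
      have h6 := hS (y + δ • greenOperator ham hA (truncExpComp v))
      rw [h5] at h6
      conv_lhs => rw [h6]
      push_cast
      rw [add_mul, one_mul, add_smul]
      abel
  obtain ⟨v, hv⟩ := claim N 0
  refine ⟨v, ?_⟩
  rwa [hδ, mul_one_div_cancel hN0.ne', one_smul, add_zero] at hv

/-- For nonnegative functions the truncation in the nonlinearity has no effect. -/
lemma exists_solution_of_bounded {a : ℂ → ℝ} {A : ℝ}
    (ham : AEStronglyMeasurable a (volume.restrict unitDisk))
    (hA : ∀ z ∈ unitDisk, |a z| ≤ A) (ha : ∀ z ∈ unitDisk, 0 ≤ a z) :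
    ∃ v : ℂ → ℝ, Continuous v ∧ (∀ z, 0 ≤ v z) ∧
      ∀ z, v z = greenPotential (fun ζ => a ζ * Real.exp (-2 * v ζ)) z := by
  obtain ⟨v, hv⟩ := exists_solution_truncExp ham hA ha
  have hv' : ∀ z, v z = greenPotential (fun ζ => a ζ * truncExp (v ζ)) z := fun z =>
    congrArg (fun f : ℂ →ᵇ ℝ => f z) hv
  have h0 : ∀ z, 0 ≤ v z := fun z => by
    rw [hv']
    exact greenPotential_nonneg (fun ζ hζ => mul_nonneg (ha ζ hζ) (truncExp_pos _).le) z
  refine ⟨v, v.continuous, h0, fun z => ?_⟩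
  rw [hv']
  simp only [truncExp, max_eq_left (h0 _)]

end BoundedCoefficient

lemma BoundedOnSmallerDisks.mono {f g : ℂ → ℝ} (hf : BoundedOnSmallerDisks f)
    (h : ∀ z ∈ unitDisk, |g z| ≤ |f z|) : BoundedOnSmallerDisks g := fun ρ hρ => by
  obtain ⟨C, hC⟩ := hf ρ hρ
  exact ⟨C, fun z hz => (h z (mem_unitDisk.2 (hz.trans_lt hρ))).trans (hC z hz)⟩

lemma abs_mul_exp_neg_le {a s : ℝ} (hs : 0 ≤ s) : |a * Real.exp (-2 * s)| ≤ |a| := by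
  rw [abs_mul, abs_of_pos (Real.exp_pos _)]
  exact mul_le_of_le_one_right (abs_nonneg a) (Real.exp_le_one_iff.2 (by linarith))

/-- Solutions of `v = G (a e^{-2v})` increase with the coefficient `a`. -/
lemma le_of_greenPotential_eq {a₁ a₂ v₁ v₂ : ℂ → ℝ}
    (h₁ : WeightedIntegrable (fun z => a₁ z * Real.exp (-2 * v₁ z)))
    (hb₁ : BoundedOnSmallerDisks (fun z => a₁ z * Real.exp (-2 * v₁ z)))
    (h₂ : WeightedIntegrable (fun z => a₂ z * Real.exp (-2 * v₂ z)))
    (hb₂ : BoundedOnSmallerDisks (fun z => a₂ z * Real.exp (-2 * v₂ z)))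
    (e₁ : ∀ z ∈ unitDisk, v₁ z = greenPotential (fun ζ => a₁ ζ * Real.exp (-2 * v₁ ζ)) z)
    (e₂ : ∀ z ∈ unitDisk, v₂ z = greenPotential (fun ζ => a₂ ζ * Real.exp (-2 * v₂ ζ)) z)
    (ha : ∀ z ∈ unitDisk, 0 ≤ a₁ z) (h : ∀ z ∈ unitDisk, a₁ z ≤ a₂ z) :
    ∀ z ∈ unitDisk, v₁ z ≤ v₂ z := by
  have hsub : ∀ z ∈ unitDisk, greenPotential (fun ζ => a₂ ζ * Real.exp (-2 * v₂ ζ)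
      - a₁ ζ * Real.exp (-2 * v₁ ζ)) z = v₂ z - v₁ z := fun z hz => by
    rw [greenPotential_sub (integrable_greenKernel_mul h₂ hb₂ z)
      (integrable_greenKernel_mul h₁ hb₁ z), e₁ z hz, e₂ z hz]
  intro z hz
  have := harmonic_le_greenPotential (k := fun _ => 0) (InnerProductSpace.harmonicOnNhd_const _)
    (fun _ _ => le_rfl) (h₂.sub h₁)
    (fun ρ hρ => by
      obtain ⟨C₁, hC₁⟩ := hb₁ ρ hρ
      obtain ⟨C₂, hC₂⟩ := hb₂ ρ hρ
      exact ⟨C₂ + C₁, fun z hz => (abs_sub _ _).trans (add_le_add (hC₂ z hz) (hC₁ z hz))⟩)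
    (Eventually.of_forall fun ζ hζ hlt => by
      rw [hsub ζ hζ] at hlt
      exact sub_nonneg.2 (mul_le_mul (h ζ hζ) (Real.exp_le_exp.2 (by linarith))
        (Real.exp_pos _).le ((ha ζ hζ).trans (h ζ hζ)))) z hz
  rw [hsub z hz] at this
  linarith

/-- The solution is the increasing limit of the solutions for the coefficients cut off near the
boundary. -/
theorem exists_solution_of_weightedIntegrable {a : ℂ → ℝ} (ha : WeightedIntegrable a)
    (hb : BoundedOnSmallerDisks a) (h0 : ∀ z ∈ unitDisk, 0 ≤ a z) :
    ∃ v : ℂ → ℝ, WeightedIntegrable (fun z => a z * Real.exp (-2 * v z)) ∧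
      (∀ z ∈ unitDisk, 0 ≤ v z) ∧
      ∀ z ∈ unitDisk, v z = greenPotential (fun ζ => a ζ * Real.exp (-2 * v ζ)) z := by
  set ρ : ℕ → ℝ := fun n => 1 - 1 / ((n : ℝ) + 1) with hρ
  have hρ1 : ∀ n, ρ n < 1 := fun n => by
    simp only [hρ]
    linarith [Nat.one_div_pos_of_nat (α := ℝ) (n := n)]
  have hρm : Monotone ρ := fun m n h => by
    have := Nat.one_div_le_one_div (α := ℝ) h
    simp only [hρ]; linarith
  have hρt : Tendsto ρ atTop (𝓝 1) := by
    simpa [hρ] using (tendsto_const_nhds (x := (1 : ℝ))).sub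
      (tendsto_one_div_add_atTop_nhds_zero_nat (𝕜 := ℝ))
  set b : ℕ → ℂ → ℝ := fun n => (Metric.closedBall (0 : ℂ) (ρ n)).indicator a with hbd
  have hbm : ∀ n, AEStronglyMeasurable (b n) (volume.restrict unitDisk) := fun n =>
    ha.aestronglyMeasurable.indicator Metric.isClosed_closedBall.measurableSet
  have hb0 : ∀ n, ∀ z ∈ unitDisk, 0 ≤ b n z := fun n z hz =>
    Set.indicator_apply_nonneg fun _ => h0 z hz
  have hba : ∀ n, ∀ z ∈ unitDisk, b n z ≤ a z := fun n z hz =>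
    Set.indicator_le_self' (fun _ _ => h0 z hz) z
  have hbmono : ∀ m n, m ≤ n → ∀ z ∈ unitDisk, b m z ≤ b n z := fun m n hmn z hz => by
    by_cases hzm : z ∈ Metric.closedBall (0 : ℂ) (ρ m)
    · have hzn := Metric.closedBall_subset_closedBall (hρm hmn) hzm
      simp [hbd, Set.indicator_of_mem hzm, Set.indicator_of_mem hzn]
    · simp only [hbd, Set.indicator_of_notMem hzm]
      exact hb0 n z hz
  have hblim : ∀ z ∈ unitDisk, ∀ᶠ n in atTop, b n z = a z := fun z hz => by
    filter_upwards [hρt.eventually_const_lt (mem_unitDisk.1 hz)] with n hn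
    exact Set.indicator_of_mem (by simpa using hn.le) _
  have hv : ∀ n, ∃ v : ℂ → ℝ, Continuous v ∧ (∀ z, 0 ≤ v z) ∧
      ∀ z, v z = greenPotential (fun ζ => b n ζ * Real.exp (-2 * v ζ)) z := fun n => by
    obtain ⟨C, hC0, hC⟩ := hb.exists_bound (hρ1 n)
    exact exists_solution_of_bounded (hbm n) (fun z _ => indicator_bound hC0 hC z) (hb0 n)
  choose v hvc hv0 hve using hv
  set F : ℕ → ℂ → ℝ := fun n ζ => b n ζ * Real.exp (-2 * v n ζ) with hF
  have hFm : ∀ n, AEStronglyMeasurable (F n) (volume.restrict unitDisk) := fun n =>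
    (hbm n).mul (by fun_prop : Continuous fun ζ => Real.exp (-2 * v n ζ)).aestronglyMeasurable
  have hFa : ∀ n, ∀ z ∈ unitDisk, |F n z| ≤ a z := fun n z hz => by
    refine (abs_mul_exp_neg_le (hv0 n z)).trans ?_
    rw [abs_of_nonneg (hb0 n z hz)]
    exact hba n z hz
  have hFa' : ∀ n, ∀ z ∈ unitDisk, |F n z| ≤ |a z| := fun n z hz =>
    (hFa n z hz).trans (le_abs_self _)
  have hFw : ∀ n, WeightedIntegrable (F n) := fun n => ha.mono (hFm n) (hFa' n)
  have hFb : ∀ n, BoundedOnSmallerDisks (F n) := fun n => hb.mono (hFa' n)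
  have hmono : ∀ z ∈ unitDisk, Monotone fun n => v n z := fun z hz m n hmn =>
    le_of_greenPotential_eq (hFw m) (hFb m) (hFw n) (hFb n) (fun z _ => hve m z)
      (fun z _ => hve n z) (hb0 m) (hbmono m n hmn) z hz
  have hint := integrable_greenKernel_mul ha hb
  have hle : ∀ n, ∀ z, v n z ≤ greenPotential a z := fun n z => by
    rw [hve n z]
    refine greenPotential_mono (integrable_greenKernel_mul (hFw n) (hFb n) z) (hint z) ?_
    filter_upwards [ae_restrict_mem measurableSet_unitDisk] with ζ hζ
    exact (le_abs_self _).trans (hFa n ζ hζ)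
  have hbdd : ∀ z, BddAbove (Set.range fun n => v n z) := fun z =>
    ⟨_, Set.forall_mem_range.2 fun n => hle n z⟩
  have hlim : ∀ z ∈ unitDisk, Tendsto (fun n => v n z) atTop (𝓝 (⨆ n, v n z)) := fun z hz =>
    tendsto_atTop_ciSup (hmono z hz) (hbdd z)
  have hFlim : ∀ z ∈ unitDisk, Tendsto (fun n => F n z) atTop
      (𝓝 (a z * Real.exp (-2 * ⨆ n, v n z))) := fun z hz =>
    (tendsto_const_nhds.congr' ((hblim z hz).mono fun _ h => h.symm)).mul
      ((Real.continuous_exp.tendsto _).comp ((hlim z hz).const_mul (-2)))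
  have h0' : ∀ z, 0 ≤ ⨆ n, v n z := fun z => Real.iSup_nonneg fun n => hv0 n z
  refine ⟨fun z => ⨆ n, v n z, ha.mono ?_ fun z _ => abs_mul_exp_neg_le (h0' z),
    fun z _ => h0' z, fun z hz => ?_⟩
  · refine aestronglyMeasurable_of_tendsto_ae atTop hFm ?_
    filter_upwards [ae_restrict_mem measurableSet_unitDisk] with z hz using hFlim z hz
  · refine tendsto_nhds_unique (hlim z hz) ?_
    refine (tendsto_greenPotential hFm (hint z) hFa hFlim).congr fun n => ?_
    exact (hve n z).symm

/-! ### Existence for the Dirichlet problem -/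

lemma weightedIntegrable_normSq {H : ℂ → ℂ} (hH : IsWeightedBergman H) :
    WeightedIntegrable (fun z => ‖H z‖ ^ 2) := hH.2

lemma boundedOnSmallerDisks_normSq {H : ℂ → ℂ} (hH : IsWeightedBergman H) :
    BoundedOnSmallerDisks (fun z => ‖H z‖ ^ 2) := fun ρ hρ => by
  have hc : ContinuousOn (fun z => |‖H z‖ ^ 2|) (Metric.closedBall 0 ρ) :=
    ((hH.1.continuousOn.mono (Metric.closedBall_subset_ball hρ)).norm.pow 2).abs
  obtain ⟨C, hC⟩ := (isCompact_closedBall (0 : ℂ) ρ).bddAbove_image hc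
  exact ⟨C, fun z hz => hC ⟨z, by simpa using hz, rfl⟩⟩

lemma abs_normSq_mul_exp_le {H : ℂ → ℂ} {z : ℂ} {s M : ℝ} (hs : s ≤ M) :
    |‖H z‖ ^ 2 * Real.exp (2 * s)| ≤ |Real.exp (2 * M) * ‖H z‖ ^ 2| := by
  rw [abs_of_nonneg (by positivity), abs_of_nonneg (by positivity), mul_comm]
  gcongr

lemma weightedIntegrable_normSq_mul_exp {H : ℂ → ℂ} (hH : IsWeightedBergman H) {w : ℂ → ℝ} {M : ℝ}
    (hw : AEStronglyMeasurable w (volume.restrict unitDisk)) (hM : ∀ z ∈ unitDisk, w z ≤ M) :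
    WeightedIntegrable (fun z => ‖H z‖ ^ 2 * Real.exp (2 * w z)) := by
  have h := weightedIntegrable_normSq hH
  have h' : WeightedIntegrable (fun z => Real.exp (2 * M) * ‖H z‖ ^ 2) := by
    unfold WeightedIntegrable
    simp only [mul_assoc]
    exact Integrable.const_mul h _
  exact h'.mono (h.aestronglyMeasurable.mul
    (Real.continuous_exp.comp_aestronglyMeasurable (hw.const_mul 2)))
    fun z hz => abs_normSq_mul_exp_le (hM z hz)

lemma boundedOnSmallerDisks_normSq_mul_exp {H : ℂ → ℂ} (hH : IsWeightedBergman H) {w : ℂ → ℝ}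
    {M : ℝ} (hM : ∀ z ∈ unitDisk, w z ≤ M) :
    BoundedOnSmallerDisks (fun z => ‖H z‖ ^ 2 * Real.exp (2 * w z)) := fun ρ hρ => by
  obtain ⟨C, hC⟩ := boundedOnSmallerDisks_normSq hH ρ hρ
  refine ⟨Real.exp (2 * M) * C, fun z hz => ?_⟩
  refine (abs_normSq_mul_exp_le (hM z (mem_unitDisk.2 (hz.trans_lt hρ)))).trans ?_
  rw [abs_mul, abs_of_pos (Real.exp_pos _)]
  gcongr
  exact hC z hz

lemma circleMap_mem_unitDisk {r : ℝ} (hr : r ∈ Set.Ioo (0 : ℝ) 1) (θ : ℝ) :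
    circleMap 0 r θ ∈ unitDisk := by
  simp [abs_of_pos hr.1, hr.2]

lemma integrable_circle_of_continuousOn {u : ℂ → ℝ} (hu : ContinuousOn u unitDisk) {r : ℝ}
    (hr : r ∈ Set.Ioo (0 : ℝ) 1) {φ : ℝ → ℝ} (hφ : Continuous φ) :
    Integrable (fun θ => φ θ * u (circleMap 0 r θ)) angleMeasure :=
  integrable_angle_of_continuous (hφ.mul (hu.comp_continuous (continuous_circleMap 0 r)
    (circleMap_mem_unitDisk hr)))

/-- Green potentials have boundary values `0`. -/
lemma WeightedIntegrable.tendsto_integral_circle {f : ℂ → ℝ} (hf : WeightedIntegrable f)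
    {φ : ℝ → ℝ} {C : ℝ} (hφ : ∀ θ, |φ θ| ≤ C) :
    Tendsto (fun r : ℝ => ∫ θ, φ θ * greenPotential f (circleMap 0 r θ) ∂angleMeasure)
      (𝓝[<] 1) (𝓝 0) := by
  have h1 : Tendsto (fun r : ℝ => ENNReal.ofReal C *
      ∫⁻ θ, ‖greenPotential f (circleMap 0 r θ)‖ₑ ∂angleMeasure) (𝓝[<] 1) (𝓝 0) := by
    simpa using ENNReal.Tendsto.const_mul hf.tendsto_lintegral_circle
      (Or.inr (ENNReal.ofReal_ne_top (r := C)))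
  rw [tendsto_zero_iff_enorm_tendsto_zero]
  refine tendsto_of_tendsto_of_tendsto_of_le_of_le tendsto_const_nhds h1 (fun _ => bot_le) ?_
  intro r
  refine (enorm_integral_le_lintegral_enorm _).trans ?_
  simp only
  rw [← lintegral_const_mul' _ _ ENNReal.ofReal_ne_top]
  refine lintegral_mono fun θ => ?_
  rw [enorm_mul]
  gcongr
  rw [Real.enorm_eq_ofReal_abs]
  exact ENNReal.ofReal_le_ofReal (hφ θ)

/-- Substituting `u = P h - v` turns the problem into `v = G (a e^{-2v})` with the coefficient
`a = |H|² e^{2 P h}`. -/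
theorem exists_isDirichletSolution {H : ℂ → ℂ} (hH : IsWeightedBergman H) {h : Circle → ℝ}
    (hh : IsBoundaryLInfty h) : ∃ u : ℂ → ℝ, IsDirichletSolution H h u := by
  have hi := integrable_of_boundaryLInfty hh
  have hPh := harmonicOnNhd_poissonIntegral hi
  have hPc := hPh.continuousOn
  have hPw := hasWeakBoundaryValues_poissonIntegral hh
  obtain ⟨M, hM0, hM⟩ := exists_bound_of_boundaryLInfty hh
  have hPM : ∀ z ∈ unitDisk, poissonIntegral h z ≤ M := fun z hz =>
    poissonIntegral_le hi (hM.mono fun _ h => (le_abs_self _).trans h) (mem_unitDisk.1 hz)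
  obtain ⟨v, hvw, hv0, hve⟩ := exists_solution_of_weightedIntegrable
    (weightedIntegrable_normSq_mul_exp hH
      (hPc.aestronglyMeasurable measurableSet_unitDisk) hPM)
    (boundedOnSmallerDisks_normSq_mul_exp hH hPM) (fun z _ => by positivity)
  have hf : (fun z => ‖H z‖ ^ 2 * Real.exp (2 * poissonIntegral h z) * Real.exp (-2 * v z))
      = fun z => ‖H z‖ ^ 2 * Real.exp (2 * (poissonIntegral h z - v z)) := by
    funext z
    rw [mul_assoc, ← Real.exp_add]
    ring_nf
  have hvb : BoundedOnSmallerDisks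
      (fun z => ‖H z‖ ^ 2 * Real.exp (2 * poissonIntegral h z) * Real.exp (-2 * v z)) :=
    (boundedOnSmallerDisks_normSq_mul_exp hH hPM).mono fun z hz => abs_mul_exp_neg_le (hv0 z hz)
  rw [hf] at hvw hve hvb
  set f := fun z => ‖H z‖ ^ 2 * Real.exp (2 * (poissonIntegral h z - v z)) with hfd
  have hvc : ContinuousOn v unitDisk := (continuousOn_greenPotential hvw hvb).congr hve
  have huc : ContinuousOn (fun z => poissonIntegral h z - v z) unitDisk := hPc.sub hvc
  have hfc : ContinuousOn f unitDisk :=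
    (hH.1.continuousOn.norm.pow 2).mul (Real.continuous_exp.comp_continuousOn (huc.const_mul 2))
  refine ⟨fun z => poissonIntegral h z - v z,
    ⟨huc.locallyIntegrableOn measurableSet_unitDisk, hfc.locallyIntegrableOn measurableSet_unitDisk,
      fun φ h1 h2 h3 => ?_⟩, ?_, fun φ => ?_⟩
  · have hΔc : Continuous (Laplacian.laplacian φ) := continuous_laplacian (contDiff_infty.1 h1 2)
    have hint : ∀ w : ℂ → ℝ, ContinuousOn w unitDisk →
        IntegrableOn (fun z => w z * Laplacian.laplacian φ z) unitDisk := fun w hw => by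
      have hK : IsCompact (tsupport φ) := h2
      have := ((hw.mono h3).mul hΔc.continuousOn).integrableOn_compact hK (μ := volume)
      refine (this.of_forall_sdiff_eq_zero measurableSet_unitDisk fun z hz => ?_)
      have h0 : Laplacian.laplacian φ z = 0 := laplacian_eq_zero_of_notMem_tsupport hz.2
      exact (congrArg (w z * ·) h0).trans (mul_zero _)
    simp only [sub_mul]
    rw [integral_sub (hint _ hPc) (hint _ hvc), integral_harmonic_mul_laplacian hPh h1 h2 h3,
      setIntegral_congr_fun measurableSet_unitDisk
        (g := fun z => greenPotential f z * Laplacian.laplacian φ z)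
        (fun z hz => congrArg (· * _) (hve z hz)),
      hvw.integral_greenPotential_mul_laplacian h1 h2 h3]
    ring
  · filter_upwards [Ioo_mem_nhdsLT (zero_lt_one : (0 : ℝ) < 1)] with r hr
    simpa using integrable_circle_of_continuousOn huc hr continuous_const (φ := fun _ => 1)
  · have hφc : Continuous fun θ : ℝ => φ (Circle.exp θ) := continuous_comp_circleExp φ
    have h1 := (hPw.2 φ).sub (hvw.tendsto_integral_circle
      (φ := fun θ => φ (Circle.exp θ)) fun θ => φ.norm_coe_le_norm _)
    rw [sub_zero] at h1
    refine h1.congr' ?_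
    filter_upwards [Ioo_mem_nhdsLT (zero_lt_one : (0 : ℝ) < 1)] with r hr
    have e : ∀ θ, greenPotential f (circleMap 0 r θ) = v (circleMap 0 r θ) := fun θ =>
      (hve _ (circleMap_mem_unitDisk hr θ)).symm
    simp only [e]
    rw [← integral_sub (integrable_circle_of_continuousOn hPc hr hφc)
      (integrable_circle_of_continuousOn hvc hr hφc)]
    simp only [mul_sub]

/-! ### Test functions with a prescribed Laplacian -/

section TestFunction

/-- `X(r) = ∫_1^r s^{-2n-1} (∫_0^s ρ) ds`, the solution of `(r^{2n+1} X')' = ρ` that vanishes near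
`r = 1` when `ρ` is supported in `(0, 1)` and has integral `0`. -/
noncomputable def radialProfile (n : ℕ) (ρ : ℝ → ℝ) (r : ℝ) : ℝ :=
  ∫ s in (1 : ℝ)..r, (s ^ (2 * n + 1))⁻¹ * ∫ t in (0 : ℝ)..s, ρ t

/-- The function `X(|z|) Re(e^{ic} z^n)` with `X = radialProfile n ρ`; its Laplacian at `re^{iθ}` is
`r^{-n-1} ρ(r) cos(nθ + c)`. -/
noncomputable def testFunction (n : ℕ) (c : ℝ) (ρ : ℝ → ℝ) (z : ℂ) : ℝ :=
  radialProfile n ρ ‖z‖ * (Complex.exp (c * Complex.I) * z ^ n).re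

variable {ρ : ℝ → ℝ} {α β : ℝ}

lemma hasDerivAt_primitive (hρ : ContDiff ℝ ∞ ρ) (s : ℝ) :
    HasDerivAt (fun s => ∫ t in (0 : ℝ)..s, ρ t) (ρ s) s :=
  intervalIntegral.integral_hasDerivAt_right (hρ.continuous.intervalIntegrable _ _)
    (hρ.continuous.stronglyMeasurableAtFilter _ _) hρ.continuous.continuousAt

lemma contDiff_of_hasDerivAt {f g : ℝ → ℝ} (hf : ∀ x, HasDerivAt f (g x) x) (hg : ContDiff ℝ ∞ g) :
    ContDiff ℝ ∞ f := by
  rw [contDiff_infty_iff_deriv]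
  exact ⟨fun x => (hf x).differentiableAt, by rwa [funext fun x => (hf x).deriv]⟩

lemma primitive_eq_zero_of_lt (hα : 0 < α) (h₁ : ∀ r < α, ρ r = 0) {s : ℝ} (hs : s < α) :
    ∫ t in (0 : ℝ)..s, ρ t = 0 := by
  rw [intervalIntegral.integral_congr (g := fun _ => 0)]
  · simp
  · intro t ht
    exact h₁ t ((Set.mem_uIcc.1 ht).elim (fun h => h.2.trans_lt hs) fun h => h.2.trans_lt hα)

lemma primitive_eq_zero_of_gt (hα : 0 < α) (h₁ : ∀ r < α, ρ r = 0) (h₂ : ∀ r, β < r → ρ r = 0)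
    (h₀ : ∫ r, ρ r = 0) {s : ℝ} (hs : β < s) : ∫ t in (0 : ℝ)..s, ρ t = 0 := by
  rw [intervalIntegral.integral_eq_integral_of_support_subset, h₀]
  intro t ht
  rw [Function.mem_support] at ht
  constructor
  · by_contra h
    exact ht (h₁ t (by linarith))
  · by_contra h
    exact ht (h₂ t (by linarith))

lemma contDiff_radialProfile_deriv (hρ : ContDiff ℝ ∞ ρ) (hα : 0 < α) (h₁ : ∀ r < α, ρ r = 0)
    (n : ℕ) : ContDiff ℝ ∞ fun s => (s ^ (2 * n + 1))⁻¹ * ∫ t in (0 : ℝ)..s, ρ t := by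
  have hA := contDiff_of_hasDerivAt (hasDerivAt_primitive hρ) hρ
  rw [contDiff_iff_contDiffAt]
  intro s
  by_cases hs : s < α
  · refine (contDiffAt_const (c := (0 : ℝ))).congr_of_eventuallyEq ?_
    filter_upwards [isOpen_Iio.mem_nhds hs] with t ht
    rw [primitive_eq_zero_of_lt hα h₁ ht, mul_zero]
  · have hs0 : s ≠ 0 := by linarith
    exact ((contDiff_id.pow _).contDiffAt.inv (pow_ne_zero _ hs0)).mul hA.contDiffAt

lemma hasDerivAt_radialProfile (hρ : ContDiff ℝ ∞ ρ) (hα : 0 < α) (h₁ : ∀ r < α, ρ r = 0) (n : ℕ)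
    (r : ℝ) :
    HasDerivAt (radialProfile n ρ) ((r ^ (2 * n + 1))⁻¹ * ∫ t in (0 : ℝ)..r, ρ t) r := by
  have h := (contDiff_radialProfile_deriv hρ hα h₁ n).continuous
  exact intervalIntegral.integral_hasDerivAt_right (h.intervalIntegrable _ _)
    (h.stronglyMeasurableAtFilter _ _) h.continuousAt

lemma radialProfile_eq_zero (hα : 0 < α) (hβ : β < 1) (h₁ : ∀ r < α, ρ r = 0)
    (h₂ : ∀ r, β < r → ρ r = 0) (h₀ : ∫ r, ρ r = 0) (n : ℕ) {r : ℝ} (hr : β < r) :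
    radialProfile n ρ r = 0 := by
  unfold radialProfile
  rw [intervalIntegral.integral_congr (g := fun _ => 0)]
  · simp
  · intro t ht
    have : β < t := (Set.mem_uIcc.1 ht).elim (fun h => hβ.trans_le h.1) fun h => hr.trans_le h.1
    simp only [primitive_eq_zero_of_gt hα h₁ h₂ h₀ this, mul_zero]

lemma radialProfile_eq_const (hρ : ContDiff ℝ ∞ ρ) (hα : 0 < α) (h₁ : ∀ r < α, ρ r = 0) (n : ℕ)
    {r : ℝ} (hr : r < α) : radialProfile n ρ r = radialProfile n ρ 0 := by
  have h := (contDiff_radialProfile_deriv hρ hα h₁ n).continuous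
  unfold radialProfile
  rw [← intervalIntegral.integral_add_adjacent_intervals (h.intervalIntegrable 1 0)
    (h.intervalIntegrable 0 r), add_eq_left, intervalIntegral.integral_congr (g := fun _ => 0)]
  · simp
  · intro t ht
    have : t < α := (Set.mem_uIcc.1 ht).elim (fun h => h.2.trans_lt hr) fun h => h.2.trans_lt hα
    simp only [primitive_eq_zero_of_lt hα h₁ this, mul_zero]

lemma contDiff_testFunction (hρ : ContDiff ℝ ∞ ρ) (hα : 0 < α) (h₁ : ∀ r < α, ρ r = 0) (n : ℕ)
    (c : ℝ) : ContDiff ℝ ∞ (testFunction n c ρ) := by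
  have hX := contDiff_of_hasDerivAt (hasDerivAt_radialProfile hρ hα h₁ n)
    (contDiff_radialProfile_deriv hρ hα h₁ n)
  have hre : ContDiff ℝ ∞ fun z : ℂ => (Complex.exp (c * Complex.I) * z ^ n).re :=
    Complex.reCLM.contDiff.comp (contDiff_const.mul (contDiff_id.pow n))
  refine ContDiff.mul ?_ hre
  rw [contDiff_iff_contDiffAt]
  intro z
  by_cases hz : z = 0
  · subst hz
    refine (contDiffAt_const (c := radialProfile n ρ 0)).congr_of_eventuallyEq ?_
    filter_upwards [Metric.ball_mem_nhds (0 : ℂ) hα] with z hz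
    exact radialProfile_eq_const hρ hα h₁ n (by simpa using hz)
  · exact hX.contDiffAt.comp z (contDiffAt_norm ℝ hz)

lemma tsupport_testFunction_subset (hα : 0 < α) (hβ : β < 1) (h₁ : ∀ r < α, ρ r = 0)
    (h₂ : ∀ r, β < r → ρ r = 0) (h₀ : ∫ r, ρ r = 0) (n : ℕ) (c : ℝ) :
    tsupport (testFunction n c ρ) ⊆ Metric.closedBall 0 β := by
  refine closure_minimal (fun z hz => ?_) Metric.isClosed_closedBall
  by_contra hzβ
  refine hz ?_
  simp only [testFunction]
  rw [radialProfile_eq_zero hα hβ h₁ h₂ h₀ n (by simpa using hzβ), zero_mul]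

lemma testFunction_circleMap (n : ℕ) (c : ℝ) (ρ : ℝ → ℝ) {r : ℝ} (hr : 0 < r) (θ : ℝ) :
    testFunction n c ρ (circleMap 0 r θ) = radialProfile n ρ r * r ^ n * Real.cos (n * θ + c) := by
  have h1 : Complex.exp (c * Complex.I) * (circleMap 0 r θ) ^ n
      = ((r ^ n : ℝ) : ℂ) * Complex.exp (((n * θ + c : ℝ) : ℂ) * Complex.I) := by
    simp only [circleMap, zero_add, mul_pow, ← Complex.exp_nat_mul]
    push_cast
    rw [mul_left_comm, ← Complex.exp_add]
    ring_nf
  rw [testFunction, h1, Complex.re_ofReal_mul, Complex.exp_ofReal_mul_I_re, norm_circleMap_zero,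
    abs_of_pos hr, mul_assoc]

lemma mul_laplacian_testFunction (hρ : ContDiff ℝ ∞ ρ) (hα : 0 < α) (h₁ : ∀ r < α, ρ r = 0) (n : ℕ)
    (c : ℝ) {r : ℝ} (hr : 0 < r) (θ : ℝ) :
    r * Laplacian.laplacian (testFunction n c ρ) (circleMap 0 r θ)
      = (r ^ n)⁻¹ * ρ r * Real.cos (n * θ + c) := by
  set φ := testFunction n c ρ with hφd
  set X := radialProfile n ρ with hX
  set Y : ℝ → ℝ := fun s => (s ^ (2 * n + 1))⁻¹ * ∫ t in (0 : ℝ)..s, ρ t with hY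
  have hφ : ContDiff ℝ 2 φ := contDiff_infty.1 (contDiff_testFunction hρ hα h₁ n c) 2
  have hX' : ∀ s, HasDerivAt X (Y s) s := hasDerivAt_radialProfile hρ hα h₁ n
  -- the radial derivative
  have hrad : ∀ s, 0 < s → s * fderiv ℝ φ (circleMap 0 s θ) (circleMap 0 1 θ)
      = ((s ^ n)⁻¹ * (∫ t in (0 : ℝ)..s, ρ t) + n * (X s * s ^ n)) * Real.cos (n * θ + c) := by
    intro s hs
    have e1 := hasDerivAt_comp_radial hφ θ s
    have e2 : HasDerivAt (fun s => X s * s ^ n * Real.cos (n * θ + c))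
        ((Y s * s ^ n + X s * (n * s ^ (n - 1))) * Real.cos (n * θ + c)) s :=
      ((hX' s).mul (hasDerivAt_pow n s)).mul_const _
    have e3 := e1.unique (e2.congr_of_eventuallyEq (by
      filter_upwards [isOpen_Ioi.mem_nhds hs] with t ht
      exact testFunction_circleMap n c ρ ht θ))
    rw [e3, hY]
    rcases n with _ | n
    · simp
      field_simp
    · simp only [Nat.add_sub_cancel]
      field_simp
      ring
  have hrad2 : fderiv ℝ φ (circleMap 0 r θ) (circleMap 0 1 θ) + r *
        fderiv ℝ (fderiv ℝ φ) (circleMap 0 r θ) (circleMap 0 1 θ) (circleMap 0 1 θ)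
      = ((r ^ n)⁻¹ * ρ r + n ^ 2 * (X r * r ^ n) * r⁻¹) * Real.cos (n * θ + c) := by
    have e1 := (hasDerivAt_id r).mul (hasDerivAt_fderiv_radial hφ θ r)
    have e2 : HasDerivAt (fun s => ((s ^ n)⁻¹ * (∫ t in (0 : ℝ)..s, ρ t) + n * (X s * s ^ n))
        * Real.cos (n * θ + c))
        ((-(n * r ^ (n - 1)) / (r ^ n) ^ 2 * (∫ t in (0 : ℝ)..r, ρ t) + (r ^ n)⁻¹ * ρ r
          + n * (Y r * r ^ n + X r * (n * r ^ (n - 1)))) * Real.cos (n * θ + c)) r :=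
      ((((hasDerivAt_pow n r).fun_inv (pow_ne_zero n hr.ne')).mul (hasDerivAt_primitive hρ r)).add
        (((hX' r).mul (hasDerivAt_pow n r)).const_mul (n : ℝ))).mul_const _
    have e3 := e1.unique (e2.congr_of_eventuallyEq (by
      filter_upwards [isOpen_Ioi.mem_nhds hr] with t ht
      exact hrad t ht))
    simp only [id, one_mul] at e3
    rw [e3, hY]
    rcases n with _ | n
    · simp
    · simp only [Nat.add_sub_cancel]
      field_simp
      ring
  -- the angular derivatives
  have hang : ∀ t, fderiv ℝ φ (circleMap 0 r t) (circleMap 0 r t * Complex.I)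
      = X r * r ^ n * (-Real.sin (n * t + c) * n) := by
    intro t
    have e1 := hasDerivAt_comp_angular hφ r t
    have e2 : HasDerivAt (fun t => X r * r ^ n * Real.cos (n * t + c))
        (X r * r ^ n * (-Real.sin (n * t + c) * n)) t := by
      have := (((hasDerivAt_id t).const_mul (n : ℝ)).add_const c).cos.const_mul (X r * r ^ n)
      simpa using this
    refine e1.unique (e2.congr_of_eventuallyEq (Eventually.of_forall fun t => ?_))
    exact testFunction_circleMap n c ρ hr t
  have hang2 : fderiv ℝ (fderiv ℝ φ) (circleMap 0 r θ) (circleMap 0 r θ * Complex.I)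
        (circleMap 0 r θ * Complex.I) - fderiv ℝ φ (circleMap 0 r θ) (circleMap 0 r θ)
      = -(n ^ 2 * (X r * r ^ n)) * Real.cos (n * θ + c) := by
    have e1 := hasDerivAt_fderiv_angular hφ r θ
    have e2 : HasDerivAt (fun t => X r * r ^ n * (-Real.sin (n * t + c) * n))
        (X r * r ^ n * (-(Real.cos (n * θ + c) * n) * n)) θ := by
      have := (((((hasDerivAt_id θ).const_mul (n : ℝ)).add_const c).sin.neg).mul_const
        (n : ℝ)).const_mul (X r * r ^ n)
      simpa using this
    rw [e1.unique (e2.congr_of_eventuallyEq (Eventually.of_forall hang))]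
    ring
  rw [mul_laplacian_polar φ hr, hrad2, hang2]
  ring

end TestFunction

/-! ### Angular modes -/

lemma integrable_mul_of_tsupport_subset {X : Type*} [TopologicalSpace X] [T2Space X]
    [MeasurableSpace X] [OpensMeasurableSpace X] {μ : Measure X} {U : Set X} {g ψ : X → ℝ}
    (hg : LocallyIntegrableOn g U μ) (hψ : Continuous ψ) (hc : HasCompactSupport ψ)
    (hs : tsupport ψ ⊆ U) : Integrable (fun x => g x * ψ x) μ := by
  have h := (hg.integrableOn_compact_subset hs hc).mul_continuousOn hψ.continuousOn hc
  refine (integrableOn_iff_integrable_of_support_subset fun x hx => ?_).1 h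
  by_contra hx'
  exact hx (by simp [image_eq_zero_of_notMem_tsupport hx'])

lemma integrable_mul_laplacian {g φ : ℂ → ℝ} (hg : LocallyIntegrableOn g unitDisk)
    (h : ContDiff ℝ ∞ φ) (hc : HasCompactSupport φ) (hs : tsupport φ ⊆ unitDisk) :
    Integrable (fun z => g z * Laplacian.laplacian φ z) :=
  integrable_mul_of_tsupport_subset hg (continuous_laplacian (contDiff_infty.1 h 2))
    (hasCompactSupport_laplacian hc) (fun _ hz => hs (tsupport_laplacian_subset hz))

/-- The angular mode `∫ g(re^{iθ}) cos(nθ + c) dθ`; the phases `c = 0` and `c = -π/2` give the real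
and imaginary parts of the Fourier coefficients. -/
noncomputable def angularMode (g : ℂ → ℝ) (n : ℕ) (c r : ℝ) : ℝ :=
  ∫ θ, g (circleMap 0 r θ) * Real.cos (n * θ + c) ∂angleMeasure

lemma integrable_radialMeasure_iff {f : ℝ → ℝ} :
    Integrable f radialMeasure ↔ IntegrableOn (fun r => r * f r) (Set.Ioi 0) := by
  unfold radialMeasure
  rw [integrable_withDensity_iff_integrable_smul' (by fun_prop) (by simp)]
  refine integrable_congr ?_
  filter_upwards [ae_restrict_mem measurableSet_Ioi] with r hr
  simp [ENNReal.toReal_ofReal (le_of_lt hr)]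

lemma locallyIntegrableOn_angularMode {g : ℂ → ℝ} (hg : LocallyIntegrableOn g unitDisk) (n : ℕ)
    (c : ℝ) : LocallyIntegrableOn (fun r => r * angularMode g n c r) (Set.Ioo 0 1) := by
  intro r₀ hr₀
  set β := (r₀ + 1) / 2 with hβ
  have hβ1 : β < 1 := by rw [hβ]; linarith [hr₀.2]
  have h1 : Integrable ((Metric.closedBall (0 : ℂ) β).indicator g) :=
    (integrable_indicator_iff Metric.isClosed_closedBall.measurableSet).2
      (integrableOn_closedBall_of_locally hg hβ1)
  have h2 : Integrable (fun p : ℝ × ℝ => (Metric.closedBall (0 : ℂ) β).indicator g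
      (circleMap 0 p.1 p.2) * Real.cos (n * p.2 + c)) (radialMeasure.prod angleMeasure) :=
    (integrable_polar h1).mul_bdd (c := 1)
      (by fun_prop : Continuous fun p : ℝ × ℝ => Real.cos (n * p.2 + c)).aestronglyMeasurable
      (Eventually.of_forall fun p => by simpa using Real.abs_cos_le_one _)
  have h3 := integrable_radialMeasure_iff.1 h2.integral_prod_left
  refine ⟨Set.Ioo 0 β,
    mem_nhdsWithin_of_mem_nhds (Ioo_mem_nhds hr₀.1 (by rw [hβ]; linarith [hr₀.2])),
    (h3.mono_set (Set.Ioo_subset_Ioi_self)).congr_fun (fun r hr => ?_) measurableSet_Ioo⟩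
  have h4 : ∀ θ, (Metric.closedBall (0 : ℂ) β).indicator g (circleMap 0 r θ)
      = g (circleMap 0 r θ) := fun θ =>
    Set.indicator_of_mem (by simpa [abs_of_pos hr.1] using hr.2.le) _
  simp only [h4, angularMode]

lemma locallyIntegrableOn_inv_pow_mul_angularMode {g : ℂ → ℝ} (hg : LocallyIntegrableOn g unitDisk)
    (n : ℕ) (c : ℝ) :
    LocallyIntegrableOn (fun r => (r ^ n)⁻¹ * angularMode g n c r) (Set.Ioo 0 1) := by
  have h1 : ContinuousOn (fun r : ℝ => (r ^ (n + 1))⁻¹) (Set.Ioo 0 1) :=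
    (continuous_pow (n + 1)).continuousOn.inv₀ fun r hr => pow_ne_zero _ hr.1.ne'
  have h2 := (locallyIntegrableOn_angularMode hg n c).continuousOn_mul h1 isOpen_Ioo.isLocallyClosed
  rw [locallyIntegrableOn_iff isOpen_Ioo.isLocallyClosed] at h2 ⊢
  intro K hK hKc
  refine (h2 K hK hKc).congr_fun (fun r hr => ?_) hKc.measurableSet
  have := (hK hr).1.ne'
  simp only
  field_simp
  ring

/-- `Δu = f` in the unit disk in the sense of distributions. -/
def WeakLaplacianEq (u f : ℂ → ℝ) : Prop :=
  ∀ φ : ℂ → ℝ, ContDiff ℝ ∞ φ → HasCompactSupport φ → tsupport φ ⊆ unitDisk →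
    ∫ z in unitDisk, u z * Laplacian.laplacian φ z = ∫ z in unitDisk, f z * φ z

section

variable {ρ : ℝ → ℝ} {α β : ℝ}

lemma tsupport_subset_Icc (h₁ : ∀ r < α, ρ r = 0) (h₂ : ∀ r, β < r → ρ r = 0) :
    tsupport ρ ⊆ Set.Icc α β :=
  closure_minimal (fun _ hr => ⟨not_lt.1 fun h => hr (h₁ _ h), not_lt.1 fun h => hr (h₂ _ h)⟩)
    isClosed_Icc

lemma integrable_mul_of_locallyIntegrableOn_Ioo (hρ : Continuous ρ) (hα : 0 < α) (hβ : β < 1)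
    (h₁ : ∀ r < α, ρ r = 0) (h₂ : ∀ r, β < r → ρ r = 0) {κ : ℝ → ℝ}
    (hκ : LocallyIntegrableOn κ (Set.Ioo 0 1)) : Integrable (fun r => κ r * ρ r) :=
  integrable_mul_of_tsupport_subset hκ hρ
    (isCompact_Icc.of_isClosed_subset (isClosed_tsupport _) (tsupport_subset_Icc h₁ h₂))
    ((tsupport_subset_Icc h₁ h₂).trans (Set.Icc_subset_Ioo hα hβ))

lemma hasCompactSupport_testFunction (hα : 0 < α) (hβ : β < 1)
    (h₁ : ∀ r < α, ρ r = 0) (h₂ : ∀ r, β < r → ρ r = 0) (h₀ : ∫ r, ρ r = 0) (n : ℕ) (c : ℝ) :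
    HasCompactSupport (testFunction n c ρ) :=
  (isCompact_closedBall 0 β).of_isClosed_subset (isClosed_tsupport _)
    (tsupport_testFunction_subset hα hβ h₁ h₂ h₀ n c)

lemma tsupport_testFunction_subset_unitDisk (hα : 0 < α) (hβ : β < 1)
    (h₁ : ∀ r < α, ρ r = 0) (h₂ : ∀ r, β < r → ρ r = 0) (h₀ : ∫ r, ρ r = 0) (n : ℕ) (c : ℝ) :
    tsupport (testFunction n c ρ) ⊆ unitDisk :=
  (tsupport_testFunction_subset hα hβ h₁ h₂ h₀ n c).trans (Metric.closedBall_subset_ball hβ)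

/-- In polar coordinates the pairing with the Laplacian of a test function is the pairing of the
angular mode with an arbitrary radial function of integral zero. -/
lemma integral_mul_laplacian_testFunction {g : ℂ → ℝ} (hg : LocallyIntegrableOn g unitDisk)
    (hρ : ContDiff ℝ ∞ ρ) (hα : 0 < α) (hβ : β < 1)
    (h₁ : ∀ r < α, ρ r = 0) (h₂ : ∀ r, β < r → ρ r = 0) (h₀ : ∫ r, ρ r = 0) (n : ℕ) (c : ℝ) :
    ∫ z in unitDisk, g z * Laplacian.laplacian (testFunction n c ρ) z
      = ∫ r, (r ^ n)⁻¹ * angularMode g n c r * ρ r := by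
  have hs := tsupport_testFunction_subset_unitDisk hα hβ h₁ h₂ h₀ n c
  have hint := integrable_mul_laplacian hg (contDiff_testFunction hρ hα h₁ n c)
    (hasCompactSupport_testFunction hα hβ h₁ h₂ h₀ n c) hs
  have hr0 : ∫ r in Set.Ioi (0 : ℝ), (r ^ n)⁻¹ * angularMode g n c r * ρ r
      = ∫ r, (r ^ n)⁻¹ * angularMode g n c r * ρ r :=
    setIntegral_eq_integral_of_forall_compl_eq_zero fun r hr => by
      rw [h₁ r ((not_lt.1 hr).trans_lt hα), mul_zero]
  rw [setIntegral_eq_integral_of_forall_compl_eq_zero fun z hz => ?_, integral_polar hint, ← hr0]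
  · refine setIntegral_congr_fun measurableSet_Ioi fun r hr => ?_
    simp only [angularMode]
    rw [← integral_const_mul, mul_right_comm, ← integral_const_mul]
    congr 1
    funext θ
    rw [mul_left_comm, mul_laplacian_testFunction hρ hα h₁ n c hr θ]
    ring
  · rw [laplacian_eq_zero_of_notMem_tsupport fun h => hz (hs h), mul_zero]

end

lemma exists_contDiff_bump {a b : ℝ} (hab : a < b) : ∃ η : ℝ → ℝ, ContDiff ℝ ∞ η ∧ (∀ r, 0 ≤ η r) ∧
    (∀ r < a, η r = 0) ∧ (∀ r, b < r → η r = 0) ∧ ∫ r, η r = 1 := by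
  set B : ContDiffBump ((a + b) / 2) := ⟨(b - a) / 4, (b - a) / 2, by linarith, by linarith⟩
  have h0 : ∀ r, r ∉ Metric.ball ((a + b) / 2) ((b - a) / 2) →
      B.normed volume r = 0 := fun r hr => by
    rw [← Function.notMem_support, ContDiffBump.support_normed_eq]
    exact hr
  refine ⟨B.normed volume, B.contDiff_normed, B.nonneg_normed, fun r hr => h0 r ?_,
    fun r hr => h0 r ?_, B.integral_normed⟩ <;>
  · rw [Real.ball_eq_Ioo]
    intro h
    linarith [h.1, h.2]

/-! ### Weighted integrability of the right-hand side -/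

/-- The profile for `ρ = η - η₀`, with `η` concentrated near `1`, is comparable with the distance to
the boundary. -/
lemma le_radialProfile_sub {η η₀ : ℝ → ℝ} {ε : ℝ} (hε : 0 < ε) (hε2 : ε < 1 / 2)
    (hη : ContDiff ℝ ∞ η) (hη0 : ∀ r, 0 ≤ η r) (hη1 : ∀ r < 1 - ε / 2, η r = 0)
    (hηi : ∫ r, η r = 1)
    (hη₀ : ContDiff ℝ ∞ η₀) (hη₀0 : ∀ r, 0 ≤ η₀ r) (hη₀1 : ∀ r < 1 / 4, η₀ r = 0)
    (hη₀2 : ∀ r, 1 / 2 < r → η₀ r = 0) (hη₀i : ∫ r, η₀ r = 1) {r : ℝ} (hr0 : 0 ≤ r) (hr1 : r ≤ 1) :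
    0 ≤ radialProfile 0 (fun r => η r - η₀ r) r ∧
      (1 - r) / 2 - ε ≤ radialProfile 0 (fun r => η r - η₀ r) r := by
  have hint : Integrable η := by
    by_contra h
    rw [integral_undef h] at hηi
    exact zero_ne_one hηi
  set Y : ℝ → ℝ := fun s => (s ^ (2 * 0 + 1))⁻¹ * ∫ t in (0 : ℝ)..s, (η t - η₀ t) with hY
  have hYc : Continuous Y := (contDiff_radialProfile_deriv (hη.sub hη₀) (α := 1 / 4) (by norm_num)
    (fun r hr => by rw [hη1 r (by linarith), hη₀1 r hr, sub_zero]) 0).continuous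
  have hsplit : ∀ s, ∫ t in (0 : ℝ)..s, (η t - η₀ t)
      = (∫ t in (0 : ℝ)..s, η t) - ∫ t in (0 : ℝ)..s, η₀ t := fun s =>
    intervalIntegral.integral_sub (hη.continuous.intervalIntegrable _ _)
      (hη₀.continuous.intervalIntegrable _ _)
  have hY1 : ∀ s, 0 ≤ s → s ≤ 1 - ε → -Y s = s⁻¹ * ∫ t in (0 : ℝ)..s, η₀ t := fun s hs hs' => by
    simp only [hY, hsplit]
    rw [primitive_eq_zero_of_lt (α := 1 - ε / 2) (by linarith) hη1 (by linarith)]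
    simp
  have hA1 : ∀ s, 1 / 2 ≤ s → ∫ t in (0 : ℝ)..s, η₀ t = 1 := fun s hs => by
    rw [intervalIntegral.integral_eq_integral_of_support_subset, hη₀i]
    intro t ht
    rw [Function.mem_support] at ht
    constructor
    · by_contra h
      exact ht (hη₀1 t (by linarith))
    · by_contra h
      exact ht (hη₀2 t (by linarith))
  have hY0 : ∀ s, 0 ≤ s → 0 ≤ -Y s := fun s hs => by
    rcases le_total s (1 - ε) with h | h
    · rw [hY1 s hs h]
      exact mul_nonneg (inv_nonneg.2 hs) (intervalIntegral.integral_nonneg hs fun t _ => hη₀0 t)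
    · have h1 : ∫ t in (0 : ℝ)..s, η t ≤ 1 := by
        rw [intervalIntegral.integral_of_le hs, ← hηi]
        exact setIntegral_le_integral hint (Eventually.of_forall hη0)
      simp only [hY, hsplit]
      rw [hA1 s (by linarith), ← mul_neg]
      exact mul_nonneg (inv_nonneg.2 (by positivity)) (by linarith)
  have hX : radialProfile 0 (fun r => η r - η₀ r) r = ∫ s in r..1, -Y s := by
    rw [intervalIntegral.integral_neg, ← intervalIntegral.integral_symm]
    rfl
  have hX0 : 0 ≤ ∫ s in r..1, -Y s :=
    intervalIntegral.integral_nonneg hr1 fun s hs => hY0 s (hr0.trans hs.1)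
  rw [hX]
  refine ⟨hX0, ?_⟩
  rcases le_total (1 - ε) (max r (1 / 2)) with h | h
  -- the claimed lower bound is negative for `r ≥ 1 - ε`
  · have : 1 - ε ≤ r := by
      rcases le_max_iff.1 h with h | h
      · exact h
      · linarith
    linarith
  -- between `1/2` and `1 - ε` the integrand `-Y s` equals `s⁻¹ ≥ 1`
  · have h1 : ∫ s in (max r (1 / 2))..(1 - ε), (1 : ℝ) ≤ ∫ s in (max r (1 / 2))..(1 - ε), -Y s := by
      refine intervalIntegral.integral_mono_on h (by simp) (hYc.neg.intervalIntegrable _ _)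
        fun s hs => ?_
      have hs2 : 1 / 2 ≤ s := (le_max_right _ _).trans hs.1
      rw [hY1 s (by linarith) hs.2, hA1 s hs2, mul_one]
      exact (one_le_inv₀ (by linarith)).2 (by linarith [hs.2])
    have h2 : ∫ s in (max r (1 / 2))..(1 - ε), -Y s ≤ ∫ s in r..1, -Y s := by
      refine intervalIntegral.integral_mono_interval (le_max_left _ _) h (by linarith) ?_
        (hYc.neg.intervalIntegrable _ _)
      filter_upwards [ae_restrict_mem measurableSet_Ioc] with s hs
      exact hY0 s (hr0.trans hs.1.le)
    simp only [intervalIntegral.integral_const, smul_eq_mul, mul_one] at h1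
    have h3 : max r (1 / 2) ≤ (1 + r) / 2 := max_le (by linarith) (by linarith)
    linarith

/-- If `Δu = f ≥ 0` and the circle means of `u` stay bounded near the boundary, then `f` is
integrable against the distance to the boundary: for radial test functions comparable with that
distance the pairing with `u` stays bounded. -/
theorem weightedIntegrable_of_weakLaplacianEq {u f : ℂ → ℝ} (hu : LocallyIntegrableOn u unitDisk)
    (hf : LocallyIntegrableOn f unitDisk) (hf0 : ∀ z, 0 ≤ f z) (hw : WeakLaplacianEq u f)
    {r₀ B : ℝ} (hr₀ : r₀ < 1) (hB : ∀ r ∈ Set.Ioo r₀ 1, |angularMode u 0 0 r| ≤ B) :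
    WeightedIntegrable f := by
  obtain ⟨η₀, hη₀, hη₀0, hη₀1, hη₀2, hη₀i⟩ := exists_contDiff_bump (a := 1 / 4) (b := 1 / 2)
    (by norm_num)
  set κ := angularMode u 0 0 with hκd
  have hκ : LocallyIntegrableOn κ (Set.Ioo 0 1) := by
    simpa using locallyIntegrableOn_inv_pow_mul_angularMode hu 0 0
  set C := B + |∫ r, κ r * η₀ r| with hC
  have key : ∀ ε, 0 < ε → ε < 1 / 2 → ε < 1 - r₀ →
      ∫ z in Metric.closedBall (0 : ℂ) (1 - 4 * ε), f z * (1 - ‖z‖) ≤ 4 * C := by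
    intro ε hε hε2 hεr
    obtain ⟨η, hη, hη0, hη1, hη2, hηi⟩ := exists_contDiff_bump (a := 1 - ε / 2) (b := 1 - ε / 4)
      (by linarith)
    set ρ : ℝ → ℝ := fun r => η r - η₀ r with hρd
    have hρ : ContDiff ℝ ∞ ρ := hη.sub hη₀
    have h₁ : ∀ r < 1 / 4, ρ r = 0 := fun r hr => by
      simp only [hρd]
      rw [hη1 r (by linarith), hη₀1 r hr, sub_zero]
    have h₂ : ∀ r, 1 - ε / 4 < r → ρ r = 0 := fun r hr => by
      simp only [hρd]
      rw [hη2 r hr, hη₀2 r (by linarith), sub_zero]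
    have hβ : 1 - ε / 4 < 1 := by linarith
    have hα : (0 : ℝ) < 1 / 4 := by norm_num
    have hiη : Integrable η := by
      by_contra h
      rw [integral_undef h] at hηi
      exact zero_ne_one hηi
    have hiη₀ : Integrable η₀ := by
      by_contra h
      rw [integral_undef h] at hη₀i
      exact zero_ne_one hη₀i
    have h₀ : ∫ r, ρ r = 0 := by
      simp only [hρd]
      rw [integral_sub hiη hiη₀, hηi, hη₀i, sub_self]
    set φ := testFunction 0 0 ρ with hφd
    have hφ : ContDiff ℝ ∞ φ := contDiff_testFunction hρ hα h₁ 0 0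
    have hφc : HasCompactSupport φ := hasCompactSupport_testFunction hα hβ h₁ h₂ h₀ 0 0
    have hφs : tsupport φ ⊆ unitDisk := tsupport_testFunction_subset_unitDisk hα hβ h₁ h₂ h₀ 0 0
    have hφX : ∀ z, φ z = radialProfile 0 ρ ‖z‖ := fun z => by simp [hφd, testFunction]
    have hφ0 : ∀ z ∈ unitDisk, 0 ≤ φ z ∧ (1 - ‖z‖) / 2 - ε ≤ φ z := fun z hz => by
      rw [hφX]
      exact le_radialProfile_sub hε hε2 hη hη0 hη1 hηi hη₀ hη₀0 hη₀1 hη₀2 hη₀i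
        (norm_nonneg z) (mem_unitDisk.1 hz).le
    have h3 := hw φ hφ hφc hφs
    rw [integral_mul_laplacian_testFunction hu hρ hα hβ h₁ h₂ h₀] at h3
    have hi1 : Integrable fun r => κ r * η r := integrable_mul_of_locallyIntegrableOn_Ioo
      hη.continuous (by linarith) hβ hη1 hη2 hκ
    have hi2 : Integrable fun r => κ r * η₀ r := integrable_mul_of_locallyIntegrableOn_Ioo
      hη₀.continuous hα (by norm_num) hη₀1 hη₀2 hκ
    have h4 : ∫ r, κ r * η r ≤ B := by
      calc ∫ r, κ r * η r ≤ ∫ r, B * η r := by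
            refine integral_mono hi1 (hiη.const_mul B) fun r => ?_
            by_cases hr : r ∈ Set.Ioo r₀ 1
            · exact mul_le_mul_of_nonneg_right ((le_abs_self _).trans (hB r hr)) (hη0 r)
            · have : η r = 0 := by
                by_cases hr' : r < 1 - ε / 2
                · exact hη1 r hr'
                · exact hη2 r (by by_contra h; exact hr ⟨by linarith, by linarith⟩)
              simp [this]
        _ = B := by rw [integral_const_mul, hηi, mul_one]
    have h5 : ∫ z in unitDisk, f z * φ z ≤ C := by
      rw [← h3]
      simp only [pow_zero, inv_one, one_mul, hρd, mul_sub]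
      rw [integral_sub hi1 hi2]
      linarith [neg_abs_le (∫ r, κ r * η₀ r)]
    have hfφ : Integrable fun z => f z * φ z :=
      integrable_mul_of_tsupport_subset hf hφ.continuous hφc hφs
    have hsub : Metric.closedBall (0 : ℂ) (1 - 4 * ε) ⊆ unitDisk :=
      Metric.closedBall_subset_ball (by linarith)
    calc ∫ z in Metric.closedBall (0 : ℂ) (1 - 4 * ε), f z * (1 - ‖z‖)
        ≤ ∫ z in Metric.closedBall (0 : ℂ) (1 - 4 * ε), 4 * (f z * φ z) := by
          refine setIntegral_mono_on ?_ (hfφ.const_mul 4).integrableOn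
            Metric.isClosed_closedBall.measurableSet fun z hz => ?_
          · exact (integrableOn_closedBall_of_locally hf (by linarith)).mul_continuousOn
              (by fun_prop) (isCompact_closedBall _ _)
          · have := (hφ0 z (hsub hz)).2
            have hz' : ‖z‖ ≤ 1 - 4 * ε := by simpa using hz
            have : 1 - ‖z‖ ≤ 4 * φ z := by linarith
            calc f z * (1 - ‖z‖) ≤ f z * (4 * φ z) := mul_le_mul_of_nonneg_left this (hf0 z)
              _ = _ := by ring
      _ ≤ ∫ z in unitDisk, 4 * (f z * φ z) := by
          refine setIntegral_mono_set (hfφ.const_mul 4).integrableOn ?_ hsub.eventuallyLE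
          filter_upwards [ae_restrict_mem measurableSet_unitDisk] with z hz
          exact mul_nonneg (by norm_num) (mul_nonneg (hf0 z) (hφ0 z hz).1)
      _ ≤ 4 * C := by
          rw [integral_const_mul]
          linarith
  set δ := min (1 / 4) ((1 - r₀) / 2) with hδ
  have hδ0 : 0 < δ := lt_min (by norm_num) (by linarith)
  have hδ1 : δ ≤ 1 / 4 := min_le_left _ _
  have hδ2 : δ ≤ (1 - r₀) / 2 := min_le_right _ _
  set ε : ℕ → ℝ := fun n => δ * (1 / ((n : ℝ) + 1)) with hεd
  have hε0 : ∀ n, 0 < ε n := fun n => mul_pos hδ0 Nat.one_div_pos_of_nat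
  have hεδ : ∀ n, ε n ≤ δ := fun n => by
    refine mul_le_of_le_one_right hδ0.le ?_
    rw [div_le_one (by positivity)]
    linarith [Nat.cast_nonneg (α := ℝ) n]
  have hεt : Tendsto (fun n => 1 - 4 * ε n) atTop (𝓝 1) := by
    simpa [hεd] using ((tendsto_one_div_add_atTop_nhds_zero_nat (𝕜 := ℝ)).const_mul δ).const_mul 4
      |>.const_sub 1
  have hcover : AECover (volume.restrict unitDisk) atTop
      fun n => Metric.closedBall (0 : ℂ) (1 - 4 * ε n) := by
    refine ⟨?_, fun n => Metric.isClosed_closedBall.measurableSet⟩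
    filter_upwards [ae_restrict_mem measurableSet_unitDisk] with z hz
    filter_upwards [hεt.eventually_const_lt (mem_unitDisk.1 hz)] with n hn
    simpa using hn.le
  have hres : ∀ n, (volume.restrict unitDisk).restrict (Metric.closedBall (0 : ℂ) (1 - 4 * ε n))
      = volume.restrict (Metric.closedBall (0 : ℂ) (1 - 4 * ε n)) := fun n =>
    Measure.restrict_restrict_of_subset (Metric.closedBall_subset_ball (by linarith [hε0 n]))
  refine hcover.integrable_of_integral_bounded_of_nonneg_ae (4 * C) (fun n => ?_) ?_
    (Eventually.of_forall fun n => ?_)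
  · unfold IntegrableOn
    rw [hres]
    exact (integrableOn_closedBall_of_locally hf (by linarith [hε0 n])).mul_continuousOn
      (by fun_prop) (isCompact_closedBall _ _)
  · filter_upwards [ae_restrict_mem measurableSet_unitDisk] with z hz
    exact mul_nonneg (hf0 z) (by linarith [mem_unitDisk.1 hz])
  · rw [hres]
    exact key _ (hε0 n) (by linarith [hεδ n]) (by linarith [hεδ n])

/-! ### Uniqueness for weakly harmonic functions -/

/-- Angular modes of a weakly harmonic function that vanish at the boundary are zero. Weak
harmonicity pairs `r^{-n}` times the mode with radial functions of integral zero only; a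
bump function near the boundary, where the mode is small, compensates a nonzero integral. -/
lemma ae_angularMode_eq_zero {d : ℂ → ℝ} (hd : LocallyIntegrableOn d unitDisk)
    (hw : WeakLaplacianEq d fun _ => 0) {n : ℕ} {c : ℝ}
    (hlim : Tendsto (angularMode d n c) (𝓝[<] 1) (𝓝 0)) :
    ∀ᵐ r, r ∈ Set.Ioo (0 : ℝ) 1 → angularMode d n c r = 0 := by
  set κ : ℝ → ℝ := fun r => (r ^ n)⁻¹ * angularMode d n c r with hκd
  have hκ : LocallyIntegrableOn κ (Set.Ioo 0 1) :=
    locallyIntegrableOn_inv_pow_mul_angularMode hd n c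
  have hκlim : Tendsto κ (𝓝[<] 1) (𝓝 0) := by
    have h1 : Tendsto (fun r : ℝ => (r ^ n)⁻¹) (𝓝[<] 1) (𝓝 (1 ^ n)⁻¹) :=
      (((continuous_pow n).tendsto (1 : ℝ)).inv₀ (by simp)).mono_left nhdsWithin_le_nhds
    simpa using h1.mul hlim
  have key : ∀ g : ℝ → ℝ, ContDiff ℝ ∞ g → HasCompactSupport g → tsupport g ⊆ Set.Ioo 0 1 →
      ∫ r, g r • κ r = 0 := by
    intro g hg hgc hgs
    have hK : IsCompact (tsupport g) := hgc
    obtain ⟨α, β, hα, hβ, hαβ⟩ : ∃ α β : ℝ, 0 < α ∧ β < 1 ∧ tsupport g ⊆ Set.Icc α β := by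
      rcases (tsupport g).eq_empty_or_nonempty with he | hne
      · exact ⟨1 / 2, 1 / 2, by norm_num, by norm_num, by simp [he]⟩
      · exact ⟨sInf (tsupport g), sSup (tsupport g), (hgs (hK.sInf_mem hne)).1,
          (hgs (hK.sSup_mem hne)).2, fun x hx => ⟨csInf_le hK.bddBelow hx, le_csSup hK.bddAbove hx⟩⟩
    have hg1 : ∀ r < α, g r = 0 := fun r hr =>
      image_eq_zero_of_notMem_tsupport fun h => hr.not_ge (hαβ h).1
    have hg2 : ∀ r, β < r → g r = 0 := fun r hr =>
      image_eq_zero_of_notMem_tsupport fun h => hr.not_ge (hαβ h).2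
    have hgi : Integrable g := hg.continuous.integrable_of_hasCompactSupport hgc
    have hgκ : Integrable fun r => κ r * g r :=
      integrable_mul_of_locallyIntegrableOn_Ioo hg.continuous hα hβ hg1 hg2 hκ
    have hle : ∀ ε > 0, |∫ r, κ r * g r| ≤ |∫ r, g r| * ε := by
      intro ε hε
      obtain ⟨r₀, hr₀, hr₀B⟩ : ∃ r₀ < 1, ∀ r ∈ Set.Ioo r₀ 1, |κ r| ≤ ε := by
        have h1 : ∀ᶠ r in 𝓝[<] (1 : ℝ), |κ r| ≤ ε := by
          have := hκlim.abs
          rw [abs_zero] at this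
          exact this.eventually_le_const hε
        exact (mem_nhdsLT_iff_exists_Ioo_subset (a := (1 : ℝ))).1 h1
      set a := (1 + max r₀ (1 / 2)) / 2 with ha
      have hm : max r₀ (1 / 2) < 1 := max_lt hr₀ (by norm_num)
      have ha1 : a < 1 := by rw [ha]; linarith
      have ha0 : 0 < a := by rw [ha]; linarith [le_max_right r₀ (1 / 2)]
      have har : r₀ < a := by rw [ha]; linarith [le_max_left r₀ (1 / 2)]
      obtain ⟨η, hη, hη0, hη1, hη2, hηi⟩ := exists_contDiff_bump (a := a) (b := (1 + a) / 2)
        (by linarith)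
      have hb1 : (1 + a) / 2 < 1 := by linarith
      have hiη : Integrable η := by
        by_contra h
        rw [integral_undef h] at hηi
        exact zero_ne_one hηi
      have hηκ : Integrable fun r => κ r * η r :=
        integrable_mul_of_locallyIntegrableOn_Ioo hη.continuous ha0 hb1 hη1 hη2 hκ
      set m := ∫ r, g r with hmd
      set ρ : ℝ → ℝ := fun r => g r - m * η r with hρd
      have hρ : ContDiff ℝ ∞ ρ := hg.sub (contDiff_const.mul hη)
      have h₁ : ∀ r < min α a, ρ r = 0 := fun r hr => by
        simp only [hρd]
        rw [hg1 r (hr.trans_le (min_le_left _ _)), hη1 r (hr.trans_le (min_le_right _ _)), mul_zero,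
          sub_zero]
      have h₂ : ∀ r, max β ((1 + a) / 2) < r → ρ r = 0 := fun r hr => by
        simp only [hρd]
        rw [hg2 r ((le_max_left _ _).trans_lt hr), hη2 r ((le_max_right _ _).trans_lt hr), mul_zero,
          sub_zero]
      have h₀ : ∫ r, ρ r = 0 := by
        simp only [hρd]
        rw [integral_sub hgi (hiη.const_mul m), integral_const_mul, hηi, mul_one, sub_self]
      have hα' := lt_min hα ha0
      have hβ' := max_lt hβ hb1
      have h3 := hw _ (contDiff_testFunction hρ hα' h₁ n c)
        (hasCompactSupport_testFunction hα' hβ' h₁ h₂ h₀ n c)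
        (tsupport_testFunction_subset_unitDisk hα' hβ' h₁ h₂ h₀ n c)
      rw [integral_mul_laplacian_testFunction hd hρ hα' hβ' h₁ h₂ h₀] at h3
      simp only [zero_mul, integral_zero] at h3
      have h4 : ∫ r, κ r * g r = m * ∫ r, κ r * η r := by
        rw [← integral_const_mul, ← sub_eq_zero, ← integral_sub hgκ (hηκ.const_mul m), ← h3]
        congr 1
        funext r
        simp only [hρd, hκd]
        ring
      rw [h4, abs_mul]
      refine mul_le_mul_of_nonneg_left ?_ (abs_nonneg m)
      calc |∫ r, κ r * η r| ≤ ∫ r, |κ r * η r| := abs_integral_le_integral_abs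
        _ ≤ ∫ r, ε * η r := by
            refine integral_mono hηκ.abs (hiη.const_mul ε) fun r => ?_
            simp only [abs_mul, abs_of_nonneg (hη0 r)]
            by_cases hr : r ∈ Set.Ioo r₀ 1
            · exact mul_le_mul_of_nonneg_right (hr₀B r hr) (hη0 r)
            · have : η r = 0 := by
                by_cases hr' : r < a
                · exact hη1 r hr'
                · exact hη2 r (by by_contra h; exact hr ⟨by linarith, by linarith⟩)
              simp [this]
        _ = ε := by rw [integral_const_mul, hηi, mul_one]
    have h0 : |∫ r, κ r * g r| ≤ 0 := by
      have ht : Tendsto (fun ε : ℝ => |∫ r, g r| * ε) (𝓝[>] 0) (𝓝 0) := by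
        have : Tendsto (fun ε : ℝ => |∫ r, g r| * ε) (𝓝 0) (𝓝 (|∫ r, g r| * 0)) :=
          tendsto_id.const_mul _
        rw [mul_zero] at this
        exact this.mono_left nhdsWithin_le_nhds
      refine ge_of_tendsto ht ?_
      filter_upwards [self_mem_nhdsWithin] with ε hε using hle ε hε
    have h1 : ∫ r, κ r * g r = 0 := abs_eq_zero.1 (le_antisymm h0 (abs_nonneg _))
    simpa only [smul_eq_mul, mul_comm] using h1
  filter_upwards [isOpen_Ioo.ae_eq_zero_of_integral_contDiff_smul_eq_zero hκ key] with r hr hr'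
  have h1 := hr hr'
  simpa only [hκd, mul_eq_zero, inv_eq_zero, (pow_ne_zero n hr'.1.ne'), false_or] using h1

/-- An integrable function on the circle all of whose Fourier coefficients vanish is zero. -/
lemma ae_eq_zero_of_integral_mul_cos {g : ℝ → ℝ} (hg : Integrable g angleMeasure)
    (h1 : ∀ n : ℕ, ∫ θ, g θ * Real.cos (n * θ) ∂angleMeasure = 0)
    (h2 : ∀ n : ℕ, ∫ θ, g θ * Real.sin (n * θ) ∂angleMeasure = 0) : g =ᵐ[angleMeasure] 0 := by
  have : Fact (0 < 2 * π) := ⟨Real.two_pi_pos⟩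
  have hgC : Integrable (fun θ => (g θ : ℂ)) angleMeasure := hg.ofReal
  have hint : ∀ F : C(AddCircle (2 * π), ℂ),
      Integrable (fun θ : ℝ => (g θ : ℂ) * F (θ : AddCircle (2 * π))) angleMeasure := fun F =>
    hgC.mul_bdd (c := ‖F‖)
      (F.continuous.comp (AddCircle.continuous_mk' (2 * π))).aestronglyMeasurable
      (Eventually.of_forall fun θ => F.norm_coe_le_norm _)
  -- integration against `g` is a functional on continuous functions; it vanishes on the characters
  set Λ : C(AddCircle (2 * π), ℂ) →L[ℂ] ℂ := LinearMap.mkContinuous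
    { toFun := fun F => ∫ θ : ℝ, (g θ : ℂ) * F (θ : AddCircle (2 * π)) ∂angleMeasure
      map_add' := fun F G => by
        simp only [ContinuousMap.add_apply, mul_add]
        exact integral_add (hint F) (hint G)
      map_smul' := fun a F => by
        simp only [ContinuousMap.smul_apply, smul_eq_mul, RingHom.id_apply]
        rw [← integral_const_mul]
        congr 1
        funext θ
        ring } (∫ θ, ‖(g θ : ℂ)‖ ∂angleMeasure) (fun F => by
      rw [← integral_mul_const]
      refine (norm_integral_le_integral_norm _).trans
        (integral_mono (hint F).norm (hgC.norm.mul_const _) fun θ => ?_)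
      simp only [norm_mul]
      gcongr
      exact F.norm_coe_le_norm _) with hΛ
  have hΛa : ∀ F, Λ F = ∫ θ : ℝ, (g θ : ℂ) * F (θ : AddCircle (2 * π)) ∂angleMeasure := fun F => rfl
  have hcos : ∀ n : ℕ, Integrable (fun θ => g θ * Real.cos (n * θ)) angleMeasure := fun n =>
    hg.mul_bdd (c := 1)
      (by fun_prop : Continuous fun θ : ℝ => Real.cos (n * θ)).aestronglyMeasurable
      (Eventually.of_forall fun θ => by simpa using Real.abs_cos_le_one _)
  have hsin : ∀ n : ℕ, Integrable (fun θ => g θ * Real.sin (n * θ)) angleMeasure := fun n =>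
    hg.mul_bdd (c := 1)
      (by fun_prop : Continuous fun θ : ℝ => Real.sin (n * θ)).aestronglyMeasurable
      (Eventually.of_forall fun θ => by simpa using Real.abs_sin_le_one _)
  have hcomb : ∀ (n : ℕ) (s : ℂ), ∫ θ : ℝ, (((g θ * Real.cos (n * θ) : ℝ) : ℂ)
      + s * ((g θ * Real.sin (n * θ) : ℝ) : ℂ)) ∂angleMeasure = 0 := fun n s => by
    have hc : Integrable (fun θ => ((g θ * Real.cos (n * θ) : ℝ) : ℂ)) angleMeasure :=
      (hcos n).ofReal
    have hs : Integrable (fun θ => ((g θ * Real.sin (n * θ) : ℝ) : ℂ)) angleMeasure :=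
      (hsin n).ofReal
    rw [integral_add hc (hs.const_mul s), integral_const_mul, integral_complex_ofReal,
      integral_complex_ofReal, h1, h2]
    simp
  have hΛ0 : Λ = 0 := by
    refine ContinuousLinearMap.ext_on (s := Set.range (@fourier (2 * π))) ?_ ?_
    · rw [Submodule.dense_iff_topologicalClosure_eq_top]
      exact span_fourier_closure_eq_top
    · rintro _ ⟨n, rfl⟩
      rw [hΛa]
      simp only [zero_apply]
      have hexp : ∀ θ : ℝ, fourier n (θ : AddCircle (2 * π))
          = Complex.exp (((n * θ : ℝ) : ℂ) * Complex.I) := fun θ => by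
        rw [fourier_coe_apply]
        congr 1
        have : (π : ℂ) ≠ 0 := by exact_mod_cast Real.pi_ne_zero
        push_cast
        field_simp
      simp only [hexp]
      obtain ⟨m, rfl | rfl⟩ := n.eq_nat_or_neg
      · rw [← hcomb m Complex.I]
        congr 1
        funext θ
        rw [Complex.exp_mul_I, ← Complex.ofReal_cos, ← Complex.ofReal_sin]
        push_cast
        ring
      · rw [← hcomb m (-Complex.I)]
        congr 1
        funext θ
        rw [Complex.exp_mul_I, ← Complex.ofReal_cos, ← Complex.ofReal_sin]
        simp only [Int.cast_neg, Int.cast_natCast, neg_mul, Real.cos_neg, Real.sin_neg]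
        push_cast
        ring
  have hloc : LocallyIntegrableOn g (Set.Ioo 0 (2 * π)) :=
    (IntegrableOn.mono_set (t := Set.Ioc 0 (2 * π)) hg Set.Ioo_subset_Ioc_self).locallyIntegrableOn
  have key := isOpen_Ioo.ae_eq_zero_of_integral_contDiff_smul_eq_zero hloc (fun φ hφ hφc hφs => by
    have hφ0 : ∀ x, x ∉ Set.Ioo 0 (2 * π) → φ x = 0 := fun x hx =>
      image_eq_zero_of_notMem_tsupport fun h => hx (hφs h)
    -- a test function on `(0, 2π)` extends to a continuous function on the circle
    have hF : Continuous (AddCircle.liftIco (2 * π) 0 fun x => (φ x : ℂ)) := by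
      refine AddCircle.liftIco_continuous ?_ (by
        have := hφ.continuous
        fun_prop)
      rw [hφ0 0 (by simp), hφ0 (0 + 2 * π) (by simp)]
    have h3 : ∀ θ ∈ Set.Ioc 0 (2 * π), AddCircle.liftIco (2 * π) 0 (fun x => (φ x : ℂ))
        (θ : AddCircle (2 * π)) = φ θ := fun θ hθ => by
      rcases hθ.2.eq_or_lt with rfl | hlt
      · have e : ((2 * π : ℝ) : AddCircle (2 * π)) = ((0 : ℝ) : AddCircle (2 * π)) := by
          rw [AddCircle.coe_period]; rfl
        rw [hφ0 (2 * π) (by simp), e, AddCircle.liftIco_coe_apply (by simp [Real.pi_pos]),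
          hφ0 0 (by simp)]
      · exact AddCircle.liftIco_coe_apply ⟨hθ.1.le, by simpa using hlt⟩
    have h4 : Λ ⟨_, hF⟩ = 0 := by rw [hΛ0]; rfl
    rw [hΛa] at h4
    have h5 : ((∫ θ in Set.Ioc 0 (2 * π), φ θ • g θ : ℝ) : ℂ) = 0 := by
      rw [← h4, ← integral_complex_ofReal]
      refine setIntegral_congr_fun measurableSet_Ioc fun θ hθ => ?_
      simp only [ContinuousMap.coe_mk, h3 θ hθ, smul_eq_mul]
      push_cast
      ring
    rw [← setIntegral_eq_integral_of_forall_compl_eq_zero (s := Set.Ioc 0 (2 * π)) fun x hx => ?_]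
    · exact_mod_cast h5
    · rw [hφ0 x fun h => hx (Set.Ioo_subset_Ioc_self h), zero_smul])
  unfold angleMeasure
  rw [← Measure.restrict_congr_set (Ioo_ae_eq_Ioc (a := (0 : ℝ)) (b := 2 * π)),
    EventuallyEq, ae_restrict_iff' measurableSet_Ioo]
  exact key

/-- A weakly harmonic function with boundary values zero vanishes almost everywhere, since on almost
every circle all its Fourier coefficients do. -/
theorem ae_eq_zero_of_weakLaplacianEq_zero {d : ℂ → ℝ} (hd : LocallyIntegrableOn d unitDisk)
    (hw : WeakLaplacianEq d fun _ => 0)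
    (hlim : ∀ n c, Tendsto (angularMode d n c) (𝓝[<] 1) (𝓝 0)) :
    d =ᵐ[volume.restrict unitDisk] 0 := by
  have hm : AEStronglyMeasurable d (volume.restrict unitDisk) := hd.aestronglyMeasurable
  have hmi : AEMeasurable (unitDisk.indicator d) :=
    ((aestronglyMeasurable_indicator_iff measurableSet_unitDisk).2 hm).aemeasurable
  have hae : ∀ᵐ r, 0 < r → ∫⁻ θ, ‖unitDisk.indicator d (circleMap 0 r θ)‖ₑ ∂angleMeasure = 0 := by
    have hintk : ∀ k : ℕ, ∀ᵐ r, 0 < r → Integrable (fun θ => (Metric.closedBall (0 : ℂ)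
        (1 - 1 / ((k : ℝ) + 1))).indicator d (circleMap 0 r θ)) angleMeasure := fun k => by
      rw [← ae_radialMeasure]
      have h1 := integrableOn_closedBall_of_locally hd
        (ρ := 1 - 1 / ((k : ℝ) + 1)) (by linarith [Nat.one_div_pos_of_nat (α := ℝ) (n := k)])
      exact (integrable_polar ((integrable_indicator_iff
        Metric.isClosed_closedBall.measurableSet).2 h1)).prod_right_ae
    have hc := ae_all_iff.2 fun n : ℕ => ae_angularMode_eq_zero hd hw (hlim n 0)
    have hs := ae_all_iff.2 fun n : ℕ => ae_angularMode_eq_zero hd hw (hlim n (-(π / 2)))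
    filter_upwards [ae_all_iff.2 hintk, hc, hs] with r h1 h2 h3 hr0
    by_cases hr1 : r < 1
    · have hr : r ∈ Set.Ioo (0 : ℝ) 1 := ⟨hr0, hr1⟩
      have hmem := circleMap_mem_unitDisk hr
      have hi : Integrable (fun θ => d (circleMap 0 r θ)) angleMeasure := by
        obtain ⟨k, hk⟩ := exists_nat_one_div_lt (sub_pos.2 hr1)
        refine (h1 k hr0).congr (Eventually.of_forall fun θ => ?_)
        refine Set.indicator_of_mem ?_ _
        rw [mem_closedBall_zero_iff, norm_circleMap_zero, abs_of_pos hr0]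
        linarith
      have h4 := ae_eq_zero_of_integral_mul_cos hi (fun n => by simpa [angularMode] using h2 n hr)
        (fun n => by
          have := h3 n hr
          simpa only [angularMode, ← sub_eq_add_neg, Real.cos_sub_pi_div_two] using this)
      rw [lintegral_eq_zero_iff' (by
        simp only [fun θ => Set.indicator_of_mem (hmem θ) d]
        exact hi.1.enorm)]
      filter_upwards [h4] with θ hθ
      rw [Set.indicator_of_mem (hmem θ), hθ]
      simp
    · have : ∀ θ, unitDisk.indicator d (circleMap 0 r θ) = 0 := fun θ =>
        Set.indicator_of_notMem (by simpa [abs_of_pos hr0] using hr1) _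
      simp [this]
  have h0 : ∫⁻ z, ‖unitDisk.indicator d z‖ₑ = 0 := by
    rw [lintegral_polar hmi.enorm, lintegral_congr_ae (ae_radialMeasure.2 hae), lintegral_zero]
  rw [lintegral_eq_zero_iff' hmi.enorm] at h0
  rw [EventuallyEq, ae_restrict_iff' measurableSet_unitDisk]
  filter_upwards [h0] with z hz hzD
  rw [Set.indicator_of_mem hzD] at hz
  simpa using hz

/-! ### Representation of solutions and comparison -/

lemma WeightedIntegrable.measurable_greenPotential {f : ℂ → ℝ} (hf : WeightedIntegrable f) :
    Measurable (greenPotential f) := by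
  have hm := hf.aestronglyMeasurable
  rw [greenPotential_congr hm.ae_eq_mk]
  have h1 : StronglyMeasurable fun p : ℂ × ℂ => greenKernel p.1 p.2 * hm.mk f p.2 :=
    (measurable_greenKernel.mul
      (hm.stronglyMeasurable_mk.measurable.comp measurable_snd)).stronglyMeasurable
  exact (h1.integral_prod_right' (ν := volume.restrict unitDisk)).measurable.const_mul _

lemma WeightedIntegrable.eventually_integrable_circle {f : ℂ → ℝ} (hf : WeightedIntegrable f) :
    ∀ᶠ r in 𝓝[<] (1 : ℝ),
      Integrable (fun θ => greenPotential f (circleMap 0 r θ)) angleMeasure := by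
  filter_upwards [hf.tendsto_lintegral_circle.eventually_lt_const ENNReal.zero_lt_top] with r hr
  exact ⟨(hf.measurable_greenPotential.comp
    (continuous_circleMap 0 r).measurable).aestronglyMeasurable, hr⟩

lemma tendsto_angularMode {u : ℂ → ℝ} {h : Circle → ℝ} (hb : HasWeakBoundaryValues u h) (n : ℕ)
    (c : ℝ) : Tendsto (angularMode u n c) (𝓝[<] 1)
      (𝓝 (∫ θ, Real.cos (n * θ + c) * h (Circle.exp θ) ∂angleMeasure)) := by
  set φ : C(Circle, ℝ) := ⟨fun z => (Complex.exp (c * Complex.I) * (z : ℂ) ^ n).re, by fun_prop⟩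
  have hφ : ∀ θ : ℝ, φ (Circle.exp θ) = Real.cos (n * θ + c) := fun θ => by
    have h1 : Complex.exp (c * Complex.I) * (Circle.exp θ : ℂ) ^ n
        = Complex.exp (((n * θ + c : ℝ) : ℂ) * Complex.I) := by
      rw [Circle.coe_exp, ← Complex.exp_nat_mul, ← Complex.exp_add]
      push_cast
      ring_nf
    change (Complex.exp (c * Complex.I) * (Circle.exp θ : ℂ) ^ n).re = _
    rw [h1, Complex.exp_ofReal_mul_I_re]
  have := hb.2 φ
  simp only [hφ] at this
  refine this.congr fun r => ?_
  simp only [angularMode, mul_comm]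

lemma integrable_mul_cos {g : ℝ → ℝ} (hg : Integrable g angleMeasure) (n : ℕ) (c : ℝ) :
    Integrable (fun θ => g θ * Real.cos (n * θ + c)) angleMeasure :=
  hg.mul_bdd (c := 1)
    (by fun_prop : Continuous fun θ : ℝ => Real.cos (n * θ + c)).aestronglyMeasurable
    (Eventually.of_forall fun θ => by simpa using Real.abs_cos_le_one _)

/-- A distributional solution of `Δu = f ≥ 0` with boundary values `h` is, up to a null set, the
Poisson integral of `h` minus the Green potential of `f`. -/
theorem ae_eq_poissonIntegral_sub_greenPotential {u f : ℂ → ℝ} {h : Circle → ℝ}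
    (hh : IsBoundaryLInfty h) (hu : LocallyIntegrableOn u unitDisk)
    (hf : LocallyIntegrableOn f unitDisk) (hf0 : ∀ z, 0 ≤ f z) (hw : WeakLaplacianEq u f)
    (hb : HasWeakBoundaryValues u h) :
    WeightedIntegrable f ∧
      u =ᵐ[volume.restrict unitDisk] fun z => poissonIntegral h z - greenPotential f z := by
  have hi := integrable_of_boundaryLInfty hh
  have hPh := harmonicOnNhd_poissonIntegral hi
  have hPc := hPh.continuousOn
  have hPb := hasWeakBoundaryValues_poissonIntegral hh
  have hPl : LocallyIntegrableOn (poissonIntegral h) unitDisk :=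
    hPc.locallyIntegrableOn measurableSet_unitDisk
  have hfw : WeightedIntegrable f := by
    have h1 := (tendsto_angularMode hb 0 0).abs.eventually_le_const (lt_add_one _)
    obtain ⟨r₀, hr₀, hB⟩ := (mem_nhdsLT_iff_exists_Ioo_subset (a := (1 : ℝ))).1 h1
    exact weightedIntegrable_of_weakLaplacianEq hu hf hf0 hw hr₀ fun r hr => hB hr
  have hGl : LocallyIntegrableOn (greenPotential f) unitDisk :=
    locallyIntegrableOn_of_closedBall fun ρ hρ => hfw.integrableOn_greenPotential hρ
  refine ⟨hfw, ?_⟩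
  set d : ℂ → ℝ := fun z => u z - (poissonIntegral h z - greenPotential f z) with hd
  have hdl : LocallyIntegrableOn d unitDisk := hu.sub (hPl.sub hGl)
  have hdw : WeakLaplacianEq d fun _ => 0 := by
    intro φ h1 h2 h3
    have i1 := (integrable_mul_laplacian hu h1 h2 h3).integrableOn (s := unitDisk)
    have i2 := (integrable_mul_laplacian hPl h1 h2 h3).integrableOn (s := unitDisk)
    have i3 := (integrable_mul_laplacian hGl h1 h2 h3).integrableOn (s := unitDisk)
    have i4 : IntegrableOn (fun z => poissonIntegral h z * Laplacian.laplacian φ z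
        - greenPotential f z * Laplacian.laplacian φ z) unitDisk := i2.sub i3
    simp only [hd, sub_mul]
    rw [integral_sub i1 i4, integral_sub i2 i3, hw φ h1 h2 h3,
      integral_harmonic_mul_laplacian hPh h1 h2 h3,
      hfw.integral_greenPotential_mul_laplacian h1 h2 h3]
    simp
  have hlim : ∀ n c, Tendsto (angularMode d n c) (𝓝[<] 1) (𝓝 0) := by
    intro n c
    have hG : Tendsto (angularMode (greenPotential f) n c) (𝓝[<] 1) (𝓝 0) := by
      refine (hfw.tendsto_integral_circle (φ := fun θ => Real.cos (n * θ + c)) (C := 1)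
        fun θ => Real.abs_cos_le_one _).congr fun r => ?_
      simp only [angularMode, mul_comm]
    have h1 := (tendsto_angularMode hb n c).sub ((tendsto_angularMode hPb n c).sub hG)
    rw [sub_zero, sub_self] at h1
    refine h1.congr' ?_
    filter_upwards [hb.1, hPb.1, hfw.eventually_integrable_circle] with r h2 h3 h4
    simp only [angularMode, hd, sub_mul]
    have i2 := integrable_mul_cos h2 n c
    have i3 := integrable_mul_cos h3 n c
    have i4 := integrable_mul_cos h4 n c
    have i5 : Integrable (fun θ => poissonIntegral h (circleMap 0 r θ) * Real.cos (n * θ + c)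
        - greenPotential f (circleMap 0 r θ) * Real.cos (n * θ + c)) angleMeasure := i3.sub i4
    rw [integral_sub i2 i5, integral_sub i3 i4]
  filter_upwards [ae_eq_zero_of_weakLaplacianEq_zero hdl hdw hlim] with z hz
  exact sub_eq_zero.1 hz

/-- Every solution agrees almost everywhere with a function that solves the integral equation at
every point of the disk and whose right-hand side is bounded on smaller disks; the bound comes from
`G f ≥ 0`, which gives `u ≤ P h`. -/
lemma exists_representative {H : ℂ → ℂ} (hH : IsWeightedBergman H) {h : Circle → ℝ} {u : ℂ → ℝ}
    (hh : IsBoundaryLInfty h) (hu : IsDirichletSolution H h u) :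
    ∃ v : ℂ → ℝ, u =ᵐ[volume.restrict unitDisk] v ∧
      WeightedIntegrable (fun z => ‖H z‖ ^ 2 * Real.exp (2 * v z)) ∧
      BoundedOnSmallerDisks (fun z => ‖H z‖ ^ 2 * Real.exp (2 * v z)) ∧
      ∀ z, v z = poissonIntegral h z
        - greenPotential (fun z => ‖H z‖ ^ 2 * Real.exp (2 * v z)) z := by
  have hi := integrable_of_boundaryLInfty hh
  obtain ⟨M, hM0, hM⟩ := exists_bound_of_boundaryLInfty hh
  obtain ⟨⟨hul, hfl, hw⟩, hb⟩ := hu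
  have hf0 : ∀ z, 0 ≤ ‖H z‖ ^ 2 * Real.exp (2 * u z) := fun z => by positivity
  obtain ⟨hfw, hae⟩ := ae_eq_poissonIntegral_sub_greenPotential hh hul hfl hf0 hw hb
  set f := fun z => ‖H z‖ ^ 2 * Real.exp (2 * u z) with hf
  set v := fun z => poissonIntegral h z - greenPotential f z with hv
  have hvM : ∀ z ∈ unitDisk, v z ≤ M := fun z hz => by
    have h1 := poissonIntegral_le hi (hM.mono fun _ h => (le_abs_self _).trans h)
      (mem_unitDisk.1 hz)
    have h2 := greenPotential_nonneg (fun z _ => hf0 z) z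
    simp only [hv]
    linarith
  have hfv : f =ᵐ[volume.restrict unitDisk] fun z => ‖H z‖ ^ 2 * Real.exp (2 * v z) := by
    filter_upwards [hae] with z hz
    simp only [hf, hz]
  refine ⟨v, hae, hfw.congr hfv, boundedOnSmallerDisks_normSq_mul_exp hH hvM, fun z => ?_⟩
  rw [← greenPotential_congr hfv]

/-- Where `u₁ > u₂` also `|H|² e^{2u₁} ≥ |H|² e^{2u₂}`, so the comparison principle applies to the
difference of the integral equations. -/
theorem ae_le_of_isDirichletSolution {H : ℂ → ℂ} (hH : IsWeightedBergman H) {h₁ h₂ : Circle → ℝ}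
    {u₁ u₂ : ℂ → ℝ} (hh₁ : IsBoundaryLInfty h₁) (hh₂ : IsBoundaryLInfty h₂)
    (hle : ∀ᵐ θ ∂angleMeasure, h₁ (Circle.exp θ) ≤ h₂ (Circle.exp θ))
    (hu₁ : IsDirichletSolution H h₁ u₁) (hu₂ : IsDirichletSolution H h₂ u₂) :
    u₁ ≤ᵐ[volume.restrict unitDisk] u₂ := by
  have hi₁ := integrable_of_boundaryLInfty hh₁
  have hi₂ := integrable_of_boundaryLInfty hh₂
  obtain ⟨v₁, huv₁, hw₁, hb₁, hv₁⟩ := exists_representative hH hh₁ hu₁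
  obtain ⟨v₂, huv₂, hw₂, hb₂, hv₂⟩ := exists_representative hH hh₂ hu₂
  have hk : ∀ z ∈ unitDisk, poissonIntegral (fun x => h₁ x - h₂ x) z
      = poissonIntegral h₁ z - poissonIntegral h₂ z := fun z hz =>
    poissonIntegral_sub hi₁ hi₂ (mem_unitDisk.1 hz)
  have hG : ∀ z, greenPotential (fun z => ‖H z‖ ^ 2 * Real.exp (2 * v₁ z)
      - ‖H z‖ ^ 2 * Real.exp (2 * v₂ z)) z
      = (poissonIntegral h₁ z - poissonIntegral h₂ z) - (v₁ z - v₂ z) := fun z => by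
    rw [greenPotential_sub (integrable_greenKernel_mul hw₁ hb₁ z)
      (integrable_greenKernel_mul hw₂ hb₂ z)]
    linarith [hv₁ z, hv₂ z]
  have key := harmonic_le_greenPotential (k := poissonIntegral fun x => h₁ x - h₂ x)
    (harmonicOnNhd_poissonIntegral (hi₁.sub hi₂))
    (fun z hz => by
      rw [hk z hz]
      exact sub_nonpos.2 (poissonIntegral_mono hi₁ hi₂ hle (mem_unitDisk.1 hz)))
    (hw₁.sub hw₂)
    (fun ρ hρ => by
      obtain ⟨C₁, hC₁⟩ := hb₁ ρ hρ
      obtain ⟨C₂, hC₂⟩ := hb₂ ρ hρ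
      exact ⟨C₁ + C₂, fun z hz => (abs_sub _ _).trans (add_le_add (hC₁ z hz) (hC₂ z hz))⟩)
    (Eventually.of_forall fun z hz hlt => by
      rw [hG z, hk z hz] at hlt
      refine sub_nonneg.2 (mul_le_mul_of_nonneg_left (Real.exp_le_exp.2 ?_) (by positivity))
      linarith)
  filter_upwards [huv₁, huv₂, ae_restrict_mem measurableSet_unitDisk] with z h1 h2 hz
  have := key z hz
  rw [hG z, hk z hz] at this
  rw [h1, h2]
  linarith

end DiskDirichlet

open DiskDirichlet

theorem mainTheorem2 (H : ℂ → ℂ) (hH : IsWeightedBergman H) :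
    (∀ h : Circle → ℝ, IsBoundaryLInfty h →
      ∃ u : ℂ → ℝ, IsDirichletSolution H h u ∧
        ∀ v : ℂ → ℝ, IsDirichletSolution H h v → v =ᵐ[volume.restrict unitDisk] u) ∧
    (∀ (h₁ h₂ : Circle → ℝ) (u₁ u₂ : ℂ → ℝ), IsBoundaryLInfty h₁ → IsBoundaryLInfty h₂ →
      (∀ᵐ θ ∂angleMeasure, h₁ (Circle.exp θ) ≤ h₂ (Circle.exp θ)) →
      IsDirichletSolution H h₁ u₁ → IsDirichletSolution H h₂ u₂ →
      u₁ ≤ᵐ[volume.restrict unitDisk] u₂) := by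
  refine ⟨fun h hh => ?_, fun h₁ h₂ u₁ u₂ hh₁ hh₂ hle hu₁ hu₂ =>
    ae_le_of_isDirichletSolution hH hh₁ hh₂ hle hu₁ hu₂⟩
  obtain ⟨u, hu⟩ := exists_isDirichletSolution hH hh
  refine ⟨u, hu, fun v hv => ?_⟩
  have hrefl : ∀ᵐ θ ∂angleMeasure, h (Circle.exp θ) ≤ h (Circle.exp θ) :=
    Eventually.of_forall fun _ => le_rfl
  exact (ae_le_of_isDirichletSolution hH hh hh hrefl hv hu).antisymm
    (ae_le_of_isDirichletSolution hH hh hh hrefl hu hv)
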